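/- **Setting.** Let $1\le d\le 3$ and let $\Omega\subset\mathbb R^d$ be a bounded, connected, open polyhedral set (the interior of the triangulated set $\overline\Omega$). $H^1_0(\Omega)$ carries the $H^1(\Omega)$ norm, and $L^\infty(\Omega)^{d\times d}$ the norm $\max_{i,j}\|h_{ij}\|_{L^\infty}$. Let $\underline q,\overline q>0$, $f\in L^2(\Omega)$, and $$\mathcal Q_{ad}=\{Q\in L^\infty(\Omega)^{d\times d}: Q(x)\text{ is symmetric and }\underline q I\preceq Q(x)\preceq\overline q I\text{ for a.e. }x\}.$$ For a coefficient $Q$, $U(Q)\in H^1_0(\Omega)$ is the weak solution of $-\operatorname{div}(Q\nabla u)=f$, $u|_{\partial\Omega}=0$; this defines $U$ also on a neighbourhood of $\mathcal Q_{ad}$ in $L^\infty(\Omega)^{d\times d}$. Let $\overline u\in U(\mathcal Q_{ad})$ and let $Q^\dagger$ be the minimizer of $\|Q\|_{L^2}$ over $\{Q\in\mathcal Q_{ad}:U(Q)=\overline u\}$. A coercivity constant is a $\kappa>0$ such that $\int_\Omega Q\nabla u\cdot\nabla u\ge\kappa\|u\|_{H^1}^2$ for all $u\in H^1_0(\Omega)$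 and all symmetric $Q\in L^\infty(\Omega)^{d\times d}$ with $Q\succeq\underline qI$ a.e. Let $(\mathcal T_h)_{0<h<1}$ be finite conforming simplicial triangulations of $\overline\Omega$ such that, for some $c>0$ independent of $h$, every $T\in\mathcal T_h$ satisfies $ch\le\operatorname{diam}T\le h$ and contains a ball of radius $c\operatorname{diam}T$. Let $V_h$ be the space of functions in $C(\overline\Omega)\cap H^1_0(\Omega)$ that are affine on each $T\in\mathcal T_h$, and let $U_h(Q)\in V_h$ be the solution of $\int_\Omega Q\nabla U_h(Q)\cdot\nabla v=\int_\Omega fv$ for all $v\in V_h$. Let $\Pi_h:H^1_0(\Omega)\to V_h$ be Clément's operator: at a vertex $a\in\Omega$ the value of $\Pi_h v$ is the value at $a$ of the $L^2$-orthogonal projection of $v$ onto the affine functions on the union of the simplices containing $a$; at boundary vertices it is $0$. Put $\sigma_h(Q)=\|U(Q)-U_h(Q)\|_{H^1}$ and $\gamma_h(\varphi)=\|\varphi-\Pi_h\varphi\|_{H^1}$. For $\rho,\delta>0$ and data $z^\delta\in H^1_0(\Omega)$ with $\|z^\delta-\overline u\|_{H^1}\le\delta$, let $Q_h=Q_h^{\rho,\delta}$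 be the minimizer over $\mathcal Q_{ad}$ of $$\int_\Omega Q\nabla(U_h(Q)-\Pi_hz^\delta)\cdot\nabla(U_h(Q)-\Pi_hz^\delta)+\rho\|Q\|_{L^2}^2 .$$ **Theorem 5.1.** A coercivity constant exists, $U$ is Fréchet differentiable at $Q^\dagger$, and the minimizer $Q_h$ exists and is unique for all $h\in(0,1)$, $\rho>0$ and all data $z^\delta\in H^1_0(\Omega)$. Let $\kappa$ be any coercivity constant. (a) Assume that the source condition $U'(Q^\dagger)^*w^*=Q^\dagger$ holds for some $w^*\in H^1_0(\Omega)^*$, where $Q^\dagger$ is regarded as the functional $H\mapsto\int_\Omega H\cdot Q^\dagger$ on $L^\infty(\Omega)^{d\times d}$, and let $w\in H^1_0(\Omega)$ be the weak solution of $-\operatorname{div}(Q^\dagger\nabla w)=w^*$, $w|_{\partial\Omega}=0$. Then there is a constant $C$, independent of $h$, $\delta$, $\rho$ and $z^\delta$, such that for all $h\in(0,1)$ and $\delta,\rho>0$ $$\frac\kappa4\|U_h(Q_h)-U(Q^\dagger)\|_{H^1}^2+\rho\|Q_h-Q^\dagger\|_{L^2}^2\le C\left(\delta^2+\sigma_h^2(Q^\dagger)+\gamma_h^2(U(Q^\dagger))+\gamma_h^2(w)+\rho^2\right).$$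 (b) For every $w\in H^1_0(\Omega)$ there is such a constant $C$ for which this estimate holds for all those $h\in(0,1)$, $\delta,\rho>0$ and $z^\delta$ for which $$\int_\Omega(Q^\dagger-Q_h)\cdot Q^\dagger\le\left|\int_\Omega(Q^\dagger-Q_h)\nabla U(Q^\dagger)\cdot\nabla w\right| .$$ No smallness condition on $w^*$ or $w$ is imposed. -/

import Mathlib

open MeasureTheory
open scoped ENNReal ContDiff

noncomputable section

namespace EllipticID

/-- The Euclidean space of dimension `d`. -/
abbrev E (d : ℕ) := EuclideanSpace ℝ (Fin d)

variable {d : ℕ}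

/-! ### Function spaces on an open set -/

/-- Lebesgue measure on `Ω`. -/
abbrev vol (Ω : Set (E d)) : Measure (E d) := volume.restrict Ω

/-- The real space `L²(Ω)`. -/
abbrev L2 (Ω : Set (E d)) := Lp ℝ 2 (vol Ω)

/-- Matrix fields with entries in `L^∞(Ω)`, with the norm `max_{i,j} ‖h i j‖_{L^∞}`. -/
abbrev LinfMat (Ω : Set (E d)) := Fin d → Fin d → Lp ℝ ∞ (vol Ω)

/-- Pairs `(u, g)` of a scalar and a vector field in `L²(Ω)`, with
`‖(u, g)‖² = ‖u‖²_{L²} + ‖g‖²_{L²}`; on pairs `(u, ∇u)` this is the `H¹(Ω)` norm. -/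
abbrev L2Pair (Ω : Set (E d)) := WithLp 2 (Lp ℝ 2 (vol Ω) × Lp (E d) 2 (vol Ω))

/-- The pairs `(φ, ∇φ)` with `φ` a smooth function compactly supported in `Ω`. -/
def testPairs (Ω : Set (E d)) : Submodule ℝ (L2Pair Ω) where
  carrier := {p | ∃ φ : E d → ℝ, ContDiff ℝ ∞ φ ∧ HasCompactSupport φ ∧ tsupport φ ⊆ Ω ∧
    p.fst =ᵐ[vol Ω] φ ∧ p.snd =ᵐ[vol Ω] gradient φ}
  add_mem' := by
    rintro p q ⟨φ, hφ, hφc, hφs, hp1, hp2⟩ ⟨ψ, hψ, hψc, hψs, hq1, hq2⟩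
    refine ⟨φ + ψ, hφ.add hψ, hφc.add hψc,
      (tsupport_add φ ψ).trans (Set.union_subset hφs hψs), ?_, ?_⟩
    · exact (Lp.coeFn_add p.fst q.fst).trans (hp1.add hq1)
    · refine (Lp.coeFn_add p.snd q.snd).trans ((hp2.add hq2).trans (Filter.Eventually.of_forall ?_))
      intro x
      have h1 : DifferentiableAt ℝ φ x := (hφ.differentiable (by simp)) x
      have h2 : DifferentiableAt ℝ ψ x := (hψ.differentiable (by simp)) x
      simp [gradient, fderiv_add h1 h2]
  zero_mem' := by
    refine ⟨0, contDiff_const, HasCompactSupport.zero, ?_, ?_, ?_⟩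
    · simp [tsupport]
    · exact Lp.coeFn_zero ℝ 2 (vol Ω)
    · refine (Lp.coeFn_zero (E d) 2 (vol Ω)).trans (Filter.Eventually.of_forall ?_)
      intro x
      simp [gradient]
  smul_mem' := by
    rintro c p ⟨φ, hφ, hφc, hφs, hp1, hp2⟩
    refine ⟨c • φ, contDiff_const.smul hφ, hφc.smul_left,
      (tsupport_smul_subset_right (fun _ => c) φ).trans hφs, ?_, ?_⟩
    · exact (Lp.coeFn_smul c p.fst).trans (hp1.const_smul c)
    · refine (Lp.coeFn_smul c p.snd).trans
        ((hp2.const_smul c).trans (Filter.Eventually.of_forall ?_))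
      intro x
      have h1 : DifferentiableAt ℝ φ x := (hφ.differentiable (by simp)) x
      simp [gradient, fderiv_const_smul h1]

/-- The Sobolev space `H¹₀(Ω)`: the closure of the smooth functions compactly supported in `Ω` in
the `H¹` norm. An element is recorded together with its weak gradient (which it determines); the
norm and inner product are those of `H¹(Ω)`. -/
abbrev H10 (Ω : Set (E d)) : Submodule ℝ (L2Pair Ω) := (testPairs Ω).topologicalClosure

/-- The underlying `L²` function of an element of `H¹₀(Ω)`. -/
def val {Ω : Set (E d)} (u : H10 Ω) : L2 Ω := (u : L2Pair Ω).fst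

/-- The weak gradient of an element of `H¹₀(Ω)`. -/
def grad {Ω : Set (E d)} (u : H10 Ω) : Lp (E d) 2 (vol Ω) := (u : L2Pair Ω).snd

/-! ### The direct problem -/

/-- `∫_Ω Q ∇u · ∇v`. -/
def form {Ω : Set (E d)} (Q : LinfMat Ω) (u v : H10 Ω) : ℝ :=
  ∫ x in Ω, ∑ i, ∑ j, Q i j x * grad u x j * grad v x i

/-- `∫_Ω H · M`, the entrywise product of two matrix fields; it is both the inner product of
`L²(Ω)^{d×d}` and the action of `M`, seen as a functional on `L^∞(Ω)^{d×d}`, on `H`. -/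
def pairing {Ω : Set (E d)} (H M : LinfMat Ω) : ℝ :=
  ∫ x in Ω, ∑ i, ∑ j, H i j x * M i j x

/-- The squared `L²(Ω)^{d×d}` norm. -/
def normSqL2 {Ω : Set (E d)} (Q : LinfMat Ω) : ℝ := pairing Q Q

/-- The symmetric matrices `M` with `qlo I ≼ M ≼ qhi I`. -/
def matK (d : ℕ) (qlo qhi : ℝ) : Set (Matrix (Fin d) (Fin d) ℝ) :=
  {M | M.IsSymm ∧ ∀ ξ : Fin d → ℝ,
    qlo * (ξ ⬝ᵥ ξ) ≤ M.mulVec ξ ⬝ᵥ ξ ∧ M.mulVec ξ ⬝ᵥ ξ ≤ qhi * (ξ ⬝ᵥ ξ)}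

/-- The admissible set of coefficient matrices. -/
def Qad (Ω : Set (E d)) (qlo qhi : ℝ) : Set (LinfMat Ω) :=
  {Q | ∀ᵐ x ∂(vol Ω), Matrix.of (fun i j => Q i j x) ∈ matK d qlo qhi}

/-- `κ` is a coercivity constant on `H¹₀(Ω)` for all coefficients bounded below by `qlo`. -/
def IsCoercivityConst (Ω : Set (E d)) (qlo κ : ℝ) : Prop :=
  0 < κ ∧ ∀ qhi : ℝ, ∀ Q ∈ Qad Ω qlo qhi, ∀ u : H10 Ω, κ * ‖u‖ ^ 2 ≤ form Q u u

/-- The functional `v ↦ ∫_Ω f v`. -/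
def load {Ω : Set (E d)} (f : L2 Ω) (v : H10 Ω) : ℝ := ∫ x in Ω, f x * val v x

open Classical in
/-- The weak solution `u ∈ H¹₀(Ω)` of `-div (Q ∇u) = F`, `u = 0` on `∂Ω` (and `0` if there is no
unique weak solution). -/
def weakSol {Ω : Set (E d)} (F : H10 Ω → ℝ) (Q : LinfMat Ω) : H10 Ω :=
  if h : ∃! u : H10 Ω, ∀ v : H10 Ω, form Q u v = F v then h.choose else 0

/-- The coefficient-to-solution operator `U`. It is given by the same formula on all of
`L^∞(Ω)^{d×d}`, in particular on a neighbourhood of the admissible set, so that it can be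
differentiated in all directions. -/
def solOp {Ω : Set (E d)} (f : L2 Ω) : LinfMat Ω → H10 Ω := weakSol (load f)

/-- `Q` is a solution of smallest `L²` norm among the admissible `Q` with `U(Q) = u`. -/
def IsMinNormSol {Ω : Set (E d)} (f : L2 Ω) (qlo qhi : ℝ) (u : H10 Ω) (Q : LinfMat Ω) : Prop :=
  (Q ∈ Qad Ω qlo qhi ∧ solOp f Q = u) ∧
    ∀ Q' ∈ Qad Ω qlo qhi, solOp f Q' = u → normSqL2 Q ≤ normSqL2 Q'

/-- The source condition `U'(Q)^* w^* = Q`, an identity in the dual of `L^∞(Ω)^{d×d}`; here `U'(Q)`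
is the Fréchet derivative and `U'(Q)^*` its dual operator. -/
def SourceCondition {Ω : Set (E d)} (f : L2 Ω) (Q : LinfMat Ω) (wstar : H10 Ω →L[ℝ] ℝ) : Prop :=
  ∀ H : LinfMat Ω, wstar (fderiv ℝ (solOp f) Q H) = pairing H Q

/-! ### Triangulations -/

/-- A simplicial complex in Euclidean space. Complexes are conforming: two simplices meet in a
common face or not at all. -/
abbrev Mesh (d : ℕ) := Geometry.SimplicialComplex ℝ (E d)

/-- The simplices of full dimension, given by their vertices. -/
def cells (K : Mesh d) : Set (Finset (E d)) := {s | s ∈ K.faces ∧ s.card = d + 1}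

/-- `K` is a finite triangulation of the closure of the polyhedral domain `Ω`, and `Ω` is the
interior of the triangulated set. -/
def IsTriangulation (Ω : Set (E d)) (K : Mesh d) : Prop :=
  K.faces.Finite ∧ K.space = closure Ω ∧ interior K.space = Ω

/-- A family `(T h)`, `0 < h < 1`, of regular and quasi-uniform triangulations of the closure
of `Ω` with mesh size `h`: with a constant `c > 0` independent of `h`, every cell of `T h` contains
a ball of radius at least `c` times its diameter, and its diameter lies between `c h` and `h`. -/
def IsRegularQuasiUniform (Ω : Set (E d)) (T : ℝ → Mesh d) : Prop :=
  (∀ h ∈ Set.Ioo (0 : ℝ) 1, IsTriangulation Ω (T h) ∧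
    ∀ s ∈ cells (T h), Metric.diam (convexHull ℝ (s : Set (E d))) ≤ h) ∧
  ∃ c : ℝ, 0 < c ∧ ∀ h ∈ Set.Ioo (0 : ℝ) 1, ∀ s ∈ cells (T h),
    (∃ x, Metric.closedBall x (c * Metric.diam (convexHull ℝ (s : Set (E d)))) ⊆
      convexHull ℝ (s : Set (E d))) ∧
    c * h ≤ Metric.diam (convexHull ℝ (s : Set (E d)))

/-! ### Finite elements -/

/-- The space `V¹_h` of elements of `C(closure Ω) ∩ H¹₀(Ω)` that are affine on every cell. -/
def Vh (Ω : Set (E d)) (K : Mesh d) : Submodule ℝ (H10 Ω) where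
  carrier := {u | ∃ g : E d → ℝ, ContinuousOn g (closure Ω) ∧ val u =ᵐ[vol Ω] g ∧
    ∀ s ∈ cells K, ∃ p : E d →ᵃ[ℝ] ℝ, Set.EqOn g p (convexHull ℝ (s : Set (E d)))}
  add_mem' := by
    rintro u v ⟨g, hg, hug, hgp⟩ ⟨k, hk, hvk, hkp⟩
    refine ⟨g + k, hg.add hk, (Lp.coeFn_add (val u) (val v)).trans (hug.add hvk), ?_⟩
    intro s hs
    obtain ⟨p, hp⟩ := hgp s hs
    obtain ⟨q, hq⟩ := hkp s hs
    exact ⟨p + q, fun x hx => by simp [hp hx, hq hx]⟩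
  zero_mem' :=
    ⟨0, continuousOn_const, Lp.coeFn_zero ℝ 2 (vol Ω), fun _ _ => ⟨0, fun _ _ => by simp⟩⟩
  smul_mem' := by
    rintro c u ⟨g, hg, hug, hgp⟩
    refine ⟨c • g, hg.const_smul c, (Lp.coeFn_smul c (val u)).trans (hug.const_smul c), ?_⟩
    intro s hs
    obtain ⟨p, hp⟩ := hgp s hs
    exact ⟨c • p, fun x hx => by simp [hp hx]⟩

open Classical in
/-- The discrete coefficient-to-solution operator `U_h`: the solution `u ∈ V¹_h` of
`∫_Ω Q ∇u · ∇v = ∫_Ω f v` for all `v ∈ V¹_h`. -/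
def discSolOp {Ω : Set (E d)} (K : Mesh d) (f : L2 Ω) (Q : LinfMat Ω) : H10 Ω :=
  if h : ∃! u : H10 Ω, u ∈ Vh Ω K ∧ ∀ v ∈ Vh Ω K, form Q u v = load f v then h.choose else 0

open Classical in
/-- The function that is affine on every simplex of `K` and takes the value `c a` at every vertex
`a`, extended by `0`: the value at `x = ∑ λ_y y` (barycentric coordinates in a simplex of `K`) is
`∑ λ_y c(y)`; it does not depend on the simplex. -/
def nodalInterp (K : Mesh d) (c : E d → ℝ) (x : E d) : ℝ :=
  if h : ∃ p : Finset (E d) × (E d → ℝ), p.1 ∈ K.faces ∧ (∀ y ∈ p.1, 0 ≤ p.2 y) ∧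
      ∑ y ∈ p.1, p.2 y = 1 ∧ ∑ y ∈ p.1, p.2 y • y = x
  then ∑ y ∈ h.choose.1, h.choose.2 y * c y
  else 0

/-- The union of the cells that have `a` as a vertex. -/
def patch (K : Mesh d) (a : E d) : Set (E d) :=
  ⋃ s ∈ {s | s ∈ cells K ∧ a ∈ s}, convexHull ℝ (s : Set (E d))

open Classical in
/-- The `L²(patch)`-orthogonal projection of `v` onto the affine functions, on the patch of `a`. -/
def localProj {Ω : Set (E d)} (K : Mesh d) (v : L2 Ω) (a : E d) : E d →ᵃ[ℝ] ℝ :=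
  if h : ∃ p : E d →ᵃ[ℝ] ℝ, ∀ q : E d →ᵃ[ℝ] ℝ,
      ∫ x in patch K a, (v x - p x) * q x ∂(vol Ω) = 0
  then h.choose else 0

open Classical in
/-- The Clément interpolant of `v` with homogeneous boundary values: its value at an interior vertex
`a` is the value at `a` of the local projection of `v`, and its value at a boundary vertex is `0`. -/
def clementFun {Ω : Set (E d)} (K : Mesh d) (v : L2 Ω) : E d → ℝ :=
  nodalInterp K (fun a => if a ∈ Ω then localProj K v a a else 0)

open Classical in
/-- The Clément operator `Π_h` on `H¹₀(Ω)`. -/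
def clement {Ω : Set (E d)} (K : Mesh d) (v : H10 Ω) : H10 Ω :=
  if h : ∃ u : H10 Ω, val u =ᵐ[vol Ω] clementFun K (val v) then h.choose else 0

/-- `σ_h(Q) = ‖U(Q) - U_h(Q)‖_{H¹}`. -/
def sigma {Ω : Set (E d)} (K : Mesh d) (f : L2 Ω) (Q : LinfMat Ω) : ℝ :=
  ‖solOp f Q - discSolOp K f Q‖

/-- `γ_h(φ) = ‖φ - Π_h φ‖_{H¹}`. -/
def gamma {Ω : Set (E d)} (K : Mesh d) (φ : H10 Ω) : ℝ := ‖φ - clement K φ‖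

/-- The discrete cost functional
`J_h(Q) = ∫_Ω Q ∇(U_h(Q) - Π_h z) · ∇(U_h(Q) - Π_h z)` with data `z`. -/
def discCost {Ω : Set (E d)} (K : Mesh d) (f : L2 Ω) (z : H10 Ω) (Q : LinfMat Ω) : ℝ :=
  form Q (discSolOp K f Q - clement K z) (discSolOp K f Q - clement K z)

/-- `Q` minimizes `J_h(Q) + ρ ‖Q‖²_{L²}` over the admissible set. -/
def IsDiscRegSol {Ω : Set (E d)} (qlo qhi : ℝ) (K : Mesh d) (f : L2 Ω) (z : H10 Ω) (ρ : ℝ)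
    (Q : LinfMat Ω) : Prop :=
  Q ∈ Qad Ω qlo qhi ∧ ∀ Q' ∈ Qad Ω qlo qhi,
    discCost K f z Q + ρ * normSqL2 Q ≤ discCost K f z Q' + ρ * normSqL2 Q'

/-- The bound of order `δ² + σ_h²(Qd) + γ_h²(U(Qd)) + γ_h²(w) + ρ²`, with the constant `C`, for the
error of the discrete regularized solution `Qh`. -/
def ErrorBound {Ω : Set (E d)} (κ C : ℝ) (K : Mesh d) (f : L2 Ω) (Qd : LinfMat Ω) (w : H10 Ω)
    (δ ρ : ℝ) (Qh : LinfMat Ω) : Prop :=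
  κ / 4 * ‖discSolOp K f Qh - solOp f Qd‖ ^ 2 + ρ * normSqL2 (Qh - Qd) ≤
    C * (δ ^ 2 + sigma K f Qd ^ 2 + gamma K (solOp f Qd) ^ 2 + gamma K w ^ 2 + ρ ^ 2)

end EllipticID

end

/-! Existence and uniqueness of the discrete minimizer come from convexity. By the Galerkin equation
the misfit is the maximum over `v ∈ V_h` of `2 ∫ f v - ∫ Q ∇v · ∇v`, up to terms affine in `Q`.
Hence it is a supremum of functions affine in `Q` (`le_discCost`), and it is convex. With the
uniformly convex penalty `ρ ‖Q‖²`, near-minimizers are close in `L²`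
(`normSqL2_sub_le_of_near_min`). A minimizing sequence then has an a.e. convergent subsequence, the
pointwise matrix constraints survive in the limit, and dominated convergence applies to the affine
minorants.

For the rate, minimality of `Q_h` against `Q†` and an expansion of the squares give `J_h(Q_h) + ρ
‖Q_h - Q†‖² ≤ J_h(Q†) + 2 ρ ∫ (Q† - Q_h) · Q†`. Differentiating the state equation and using the
symmetry of `Q†`, the source condition turns the last integral into `-∫ (Q† - Q_h) ∇U(Q†) · ∇w`
(`SourceCondition.pairing_eq`). Once `w` is replaced by `Π_h w`, both the exact and the discrete
state equation can be tested with it (`form_sub_solOp_eq`). What remains is bounded by `γ_h(w)` and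
by the state error `e` times `‖w‖` or `γ_h(w)`. The factor `ρ` in front lets Young's inequality
trade `ρ e ‖w‖` for `κ e² / 4` plus a multiple of `ρ²`, however large `w` is. This is why no
smallness is needed (`error_arithmetic`).

The term `J_h(Q†)` involves `Π_h z^δ`, so the noise must pass through `Π_h` with a constant
independent of `h`. This uniform `H¹` stability of Clément's operator
(`IsRegularQuasiUniform.exists_norm_clement_sub_le`) is the technical core. On a cell, all nodal
values are compared with the mean of `v`, extended by zero, over a ball of radius `2h`. At interior
vertices an inverse estimate for affine functions and the Poincaré inequality do this. At boundary
vertices the value is `0`, and the mean itself is small because the complement of a polyhedral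
domain contains a ball of comparable size (`exists_exterior_ball`). Summation uses that these balls
overlap boundedly often.

Finally, `H¹₀(Ω)` is a closure of test functions, so interpolants must be shown to belong to it.
They vanish outside `Ω` (`mem_of_open_star`), are Lipschitz, and are `L²` limits of an `H¹`-bounded
sequence of test functions (`exists_H10_of_lipschitz`). -/

noncomputable section

namespace EllipticID

variable {d : ℕ} {Ω : Set (E d)}

/-! ### Square integrable functions -/

section SquareIntegrable

variable {α : Type*} [MeasurableSpace α] {μ : Measure α}

/-- The Cauchy–Schwarz inequality for square integrable functions. -/
lemma sq_integral_mul_le {f g : α → ℝ} (hf : MemLp f 2 μ) (hg : MemLp g 2 μ) :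
    (∫ x, f x * g x ∂μ) ^ 2 ≤ (∫ x, f x ^ 2 ∂μ) * ∫ x, g x ^ 2 ∂μ := by
  have key : ∀ {a b : α → ℝ} (ha : MemLp a 2 μ) (hb : MemLp b 2 μ),
      inner ℝ (ha.toLp a) (hb.toLp b) = ∫ x, a x * b x ∂μ := by
    intro a b ha hb
    rw [L2.inner_def]
    refine integral_congr_ae ?_
    filter_upwards [ha.coeFn_toLp, hb.coeFn_toLp] with x h1 h2
    rw [h1, h2]; simp [mul_comm]
  have h := real_inner_mul_inner_self_le (hf.toLp f) (hg.toLp g)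
  rw [key hf hg, key hf hf, key hg hg] at h
  simpa [sq] using h

lemma norm_sq_eq_integral {F : Type*} [NormedAddCommGroup F] [InnerProductSpace ℝ F]
    (f : Lp F 2 μ) : ‖f‖ ^ 2 = ∫ x, ‖f x‖ ^ 2 ∂μ := by
  rw [← real_inner_self_eq_norm_sq, L2.inner_def]
  simp

lemma integrable_norm_sq {F : Type*} [NormedAddCommGroup F]
    (f : Lp F 2 μ) : Integrable (fun x => ‖f x‖ ^ 2) μ :=
  (Lp.memLp f).integrable_norm_pow (p := 2) (by norm_num)

end SquareIntegrable

/-! ### The bilinear form -/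

scoped instance : NormedAddCommGroup (H10 Ω) := inferInstance
scoped instance : InnerProductSpace ℝ (H10 Ω) := inferInstance
scoped instance : NormedSpace ℝ (H10 Ω) := inferInstance
scoped instance : CompleteSpace (H10 Ω) := inferInstance
scoped instance : NormedAddCommGroup (LinfMat Ω) := inferInstance
scoped instance : NormedSpace ℝ (LinfMat Ω) := inferInstance
scoped instance : NormedAddCommGroup (H10 Ω →L[ℝ] ℝ) := inferInstance
scoped instance : NormedSpace ℝ (H10 Ω →L[ℝ] ℝ) := inferInstance
scoped instance : NormedAddCommGroup (H10 Ω →L[ℝ] H10 Ω →L[ℝ] ℝ) := inferInstance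
scoped instance : NormedSpace ℝ (H10 Ω →L[ℝ] H10 Ω →L[ℝ] ℝ) := inferInstance

lemma val_add (u v : H10 Ω) : val (u + v) = val u + val v := rfl
lemma val_sub (u v : H10 Ω) : val (u - v) = val u - val v := rfl
lemma val_smul (c : ℝ) (u : H10 Ω) : val (c • u) = c • val u := rfl
lemma grad_add (u v : H10 Ω) : grad (u + v) = grad u + grad v := rfl
lemma grad_smul (c : ℝ) (u : H10 Ω) : grad (c • u) = c • grad u := rfl

lemma norm_sq_H10 (u : H10 Ω) : ‖u‖ ^ 2 = ‖val u‖ ^ 2 + ‖grad u‖ ^ 2 := by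
  have : ‖u‖ = ‖(u : L2Pair Ω)‖ := rfl
  rw [this, WithLp.prod_norm_sq_eq_of_L2]; rfl

lemma norm_grad_le (u : H10 Ω) : ‖grad u‖ ≤ ‖u‖ := by
  have := norm_sq_H10 u
  exact le_of_sq_le_sq (by nlinarith [sq_nonneg ‖val u‖]) (norm_nonneg _)

lemma norm_val_le (u : H10 Ω) : ‖val u‖ ≤ ‖u‖ := by
  have := norm_sq_H10 u
  exact le_of_sq_le_sq (by nlinarith [sq_nonneg ‖grad u‖]) (norm_nonneg _)

/-- The function part, as a continuous linear map. -/
def valL (Ω : Set (E d)) : H10 Ω →L[ℝ] L2 Ω :=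
  LinearMap.mkContinuous ⟨⟨val, val_add⟩, val_smul⟩ 1 (fun u => by simpa using norm_val_le u)

@[simp] lemma valL_apply (u : H10 Ω) : valL Ω u = val u := rfl

lemma abs_coord_le (x : E d) (i : Fin d) : |x i| ≤ ‖x‖ := by
  simpa using PiLp.norm_apply_le x i

lemma memLp_coord {μ : Measure (E d)} {g : E d → E d} (hg : MemLp g 2 μ) (i : Fin d) :
    MemLp (fun x => g x i) 2 μ := by
  refine hg.of_le ?_ (Filter.Eventually.of_forall fun x => by simpa using abs_coord_le _ _)
  exact (EuclideanSpace.proj (𝕜 := ℝ) i).continuous.comp_aestronglyMeasurable hg.1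

lemma ae_abs_le_norm (h : Lp ℝ ∞ (vol Ω)) : ∀ᵐ x ∂(vol Ω), |h x| ≤ ‖h‖ := by
  have := ae_le_eLpNormEssSup (f := (h : E d → ℝ)) (μ := vol Ω)
  filter_upwards [this] with x hx
  rw [Lp.norm_def, eLpNorm_exponent_top, ← Real.norm_eq_abs]
  have h2 : eLpNormEssSup h (vol Ω) ≠ ⊤ := by
    rw [← eLpNorm_exponent_top]; exact (Lp.memLp h).2.ne
  rw [← toReal_enorm]
  exact ENNReal.toReal_mono h2 hx

lemma integrable_mul_mul (h : Lp ℝ ∞ (vol Ω)) {f g : E d → ℝ} (hf : MemLp f 2 (vol Ω))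
    (hg : MemLp g 2 (vol Ω)) : Integrable (fun x => h x * f x * g x) (vol Ω) := by
  have h1 : Integrable (fun x => f x * g x) (vol Ω) := hf.integrable_mul hg
  simp_rw [mul_assoc]
  exact h1.bdd_mul (Lp.memLp h).1 (c := ‖h‖) (by simpa using ae_abs_le_norm h)

lemma integrable_form_term (Q : LinfMat Ω) (u v : H10 Ω) (i j : Fin d) :
    Integrable (fun x => Q i j x * grad u x j * grad v x i) (vol Ω) :=
  integrable_mul_mul _ (memLp_coord (Lp.memLp _) j) (memLp_coord (Lp.memLp _) i)

lemma integrable_form (Q : LinfMat Ω) (u v : H10 Ω) :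
    Integrable (fun x => ∑ i, ∑ j, Q i j x * grad u x j * grad v x i) (vol Ω) :=
  integrable_finsetSum _ fun i _ => integrable_finsetSum _ fun j _ =>
    integrable_form_term Q u v i j

lemma form_eq_sum (Q : LinfMat Ω) (u v : H10 Ω) :
    form Q u v = ∑ i, ∑ j, ∫ x in Ω, Q i j x * grad u x j * grad v x i := by
  rw [form, integral_finsetSum _ fun i _ => integrable_finsetSum _ fun j _ =>
    integrable_form_term Q u v i j]
  exact Finset.sum_congr rfl fun i _ => integral_finsetSum _ fun j _ =>
    integrable_form_term Q u v i j

lemma form_add_left (Q : LinfMat Ω) (u u' v : H10 Ω) :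
    form Q (u + u') v = form Q u v + form Q u' v := by
  rw [form, form, form, ← integral_add (integrable_form _ _ _) (integrable_form _ _ _)]
  refine integral_congr_ae ?_
  filter_upwards [Lp.coeFn_add (grad u) (grad u')] with x hx
  simp only [grad_add, hx, Pi.add_apply, PiLp.add_apply, ← Finset.sum_add_distrib]
  exact Finset.sum_congr rfl fun i _ => Finset.sum_congr rfl fun j _ => by ring

lemma form_add_right (Q : LinfMat Ω) (u v v' : H10 Ω) :
    form Q u (v + v') = form Q u v + form Q u v' := by
  rw [form, form, form, ← integral_add (integrable_form _ _ _) (integrable_form _ _ _)]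
  refine integral_congr_ae ?_
  filter_upwards [Lp.coeFn_add (grad v) (grad v')] with x hx
  simp only [grad_add, hx, Pi.add_apply, PiLp.add_apply, ← Finset.sum_add_distrib]
  exact Finset.sum_congr rfl fun i _ => Finset.sum_congr rfl fun j _ => by ring

lemma form_smul_left (Q : LinfMat Ω) (c : ℝ) (u v : H10 Ω) :
    form Q (c • u) v = c * form Q u v := by
  rw [form, form, ← integral_const_mul]
  refine integral_congr_ae ?_
  filter_upwards [Lp.coeFn_smul c (grad u)] with x hx
  simp only [grad_smul, hx, Pi.smul_apply, PiLp.smul_apply, smul_eq_mul, Finset.mul_sum]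
  exact Finset.sum_congr rfl fun i _ => Finset.sum_congr rfl fun j _ => by ring

lemma form_smul_right (Q : LinfMat Ω) (c : ℝ) (u v : H10 Ω) :
    form Q u (c • v) = c * form Q u v := by
  rw [form, form, ← integral_const_mul]
  refine integral_congr_ae ?_
  filter_upwards [Lp.coeFn_smul c (grad v)] with x hx
  simp only [grad_smul, hx, Pi.smul_apply, PiLp.smul_apply, smul_eq_mul, Finset.mul_sum]
  exact Finset.sum_congr rfl fun i _ => Finset.sum_congr rfl fun j _ => by ring

lemma ae_coeFn_mat {P : LinfMat Ω} {F : Fin d → Fin d → E d → ℝ}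
    (h : ∀ i j, P i j =ᵐ[vol Ω] F i j) : ∀ᵐ x ∂(vol Ω), ∀ i j, P i j x = F i j x :=
  ae_all_iff.2 fun i => ae_all_iff.2 fun j => h i j

lemma ae_mat_add (P Q : LinfMat Ω) : ∀ᵐ x ∂(vol Ω), ∀ i j, (P + Q) i j x = P i j x + Q i j x :=
  ae_coeFn_mat (F := fun i j x => P i j x + Q i j x) fun i j => Lp.coeFn_add (P i j) (Q i j)

lemma ae_mat_sub (P Q : LinfMat Ω) : ∀ᵐ x ∂(vol Ω), ∀ i j, (P - Q) i j x = P i j x - Q i j x :=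
  ae_coeFn_mat (F := fun i j x => P i j x - Q i j x) fun i j => Lp.coeFn_sub (P i j) (Q i j)

lemma ae_mat_smul (c : ℝ) (Q : LinfMat Ω) : ∀ᵐ x ∂(vol Ω), ∀ i j, (c • Q) i j x = c * Q i j x :=
  ae_coeFn_mat (F := fun i j x => c * Q i j x) fun i j => Lp.coeFn_smul c (Q i j)

lemma form_add_coeff (P Q : LinfMat Ω) (u v : H10 Ω) :
    form (P + Q) u v = form P u v + form Q u v := by
  rw [form, form, form, ← integral_add (integrable_form _ _ _) (integrable_form _ _ _)]
  refine integral_congr_ae ?_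
  filter_upwards [ae_mat_add P Q] with x hx
  simp only [hx, ← Finset.sum_add_distrib]
  exact Finset.sum_congr rfl fun i _ => Finset.sum_congr rfl fun j _ => by ring

lemma form_smul_coeff (c : ℝ) (Q : LinfMat Ω) (u v : H10 Ω) :
    form (c • Q) u v = c * form Q u v := by
  rw [form, form, ← integral_const_mul]
  refine integral_congr_ae ?_
  filter_upwards [ae_mat_smul c Q] with x hx
  simp only [hx, Finset.mul_sum]
  exact Finset.sum_congr rfl fun i _ => Finset.sum_congr rfl fun j _ => by ring

lemma integral_norm_mul_norm_le (u v : H10 Ω) :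
    ∫ x in Ω, ‖grad u x‖ * ‖grad v x‖ ≤ ‖u‖ * ‖v‖ := by
  have h := sq_integral_mul_le (Lp.memLp (grad u)).norm (Lp.memLp (grad v)).norm
  rw [← norm_sq_eq_integral, ← norm_sq_eq_integral] at h
  refine (le_of_sq_le_sq (by rwa [mul_pow]) (by positivity)).trans
    (mul_le_mul (norm_grad_le u) (norm_grad_le v) (norm_nonneg _) (norm_nonneg _))

/-- The factor `d ^ 2` counts the matrix entries, each bounded by the max norm of `Q`. -/
lemma abs_form_le (Q : LinfMat Ω) (u v : H10 Ω) :
    |form Q u v| ≤ d ^ 2 * ‖Q‖ * ‖u‖ * ‖v‖ := by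
  have hterm : ∀ i j, |∫ x in Ω, Q i j x * grad u x j * grad v x i| ≤ ‖Q‖ * ‖u‖ * ‖v‖ := by
    intro i j
    have hint : Integrable (fun x => ‖Q‖ * (‖grad u x‖ * ‖grad v x‖)) (vol Ω) :=
      ((Lp.memLp (grad u)).norm.integrable_mul (Lp.memLp (grad v)).norm).const_mul _
    calc |∫ x in Ω, Q i j x * grad u x j * grad v x i|
        ≤ ∫ x in Ω, ‖Q‖ * (‖grad u x‖ * ‖grad v x‖) := by
          rw [← Real.norm_eq_abs]
          refine norm_integral_le_of_norm_le hint ?_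
          filter_upwards [ae_abs_le_norm (Q i j)] with x hx
          have h1 : |Q i j x| ≤ ‖Q‖ :=
            hx.trans ((norm_le_pi_norm (Q i) j).trans (norm_le_pi_norm Q i))
          rw [Real.norm_eq_abs, abs_mul, abs_mul, mul_assoc]
          exact mul_le_mul h1 (mul_le_mul (abs_coord_le _ _) (abs_coord_le _ _)
            (abs_nonneg _) (norm_nonneg _)) (by positivity) (norm_nonneg _)
      _ ≤ ‖Q‖ * (‖u‖ * ‖v‖) := by
          rw [integral_const_mul]
          exact mul_le_mul_of_nonneg_left (integral_norm_mul_norm_le u v) (norm_nonneg _)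
      _ = _ := by ring
  rw [form_eq_sum]
  calc |∑ i, ∑ j, ∫ x in Ω, Q i j x * grad u x j * grad v x i|
      ≤ ∑ i, ∑ j, |∫ x in Ω, Q i j x * grad u x j * grad v x i| :=
        (Finset.abs_sum_le_sum_abs _ _).trans
          (Finset.sum_le_sum fun i _ => Finset.abs_sum_le_sum_abs _ _)
    _ ≤ ∑ _i : Fin d, ∑ _j : Fin d, ‖Q‖ * ‖u‖ * ‖v‖ :=
        Finset.sum_le_sum fun i _ => Finset.sum_le_sum fun j _ => hterm i j
    _ = _ := by simp; ring

/-- `form Q` as a bounded bilinear form. -/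
def formB (Q : LinfMat Ω) : H10 Ω →L[ℝ] H10 Ω →L[ℝ] ℝ :=
  LinearMap.mkContinuous₂ (LinearMap.mk₂ ℝ (form Q) (form_add_left Q) (form_smul_left Q)
    (form_add_right Q) (form_smul_right Q)) (d ^ 2 * ‖Q‖) (fun u v => abs_form_le Q u v)

@[simp] lemma formB_apply (Q : LinfMat Ω) (u v : H10 Ω) : formB Q u v = form Q u v := rfl

lemma norm_formB_le (Q : LinfMat Ω) : ‖formB Q‖ ≤ d ^ 2 * ‖Q‖ :=
  LinearMap.mkContinuous₂_norm_le _ (by positivity) _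

/-- The map `Q ↦ form Q`, linear and continuous. -/
def formL (Ω : Set (E d)) : LinfMat Ω →L[ℝ] H10 Ω →L[ℝ] H10 Ω →L[ℝ] ℝ :=
  LinearMap.mkContinuous
    (⟨⟨fun Q => formB (Ω := Ω) Q, fun P Q => ContinuousLinearMap.ext fun u =>
      ContinuousLinearMap.ext fun v => form_add_coeff P Q u v⟩,
      fun c Q => ContinuousLinearMap.ext fun u => ContinuousLinearMap.ext fun v =>
        form_smul_coeff c Q u v⟩ :
      LinfMat Ω →ₗ[ℝ] H10 Ω →L[ℝ] H10 Ω →L[ℝ] ℝ)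
    (d ^ 2) (fun Q => norm_formB_le Q)

@[simp] lemma formL_apply (Q : LinfMat Ω) (u v : H10 Ω) : formL Ω Q u v = form Q u v := rfl

lemma form_sub_left (Q : LinfMat Ω) (u u' v : H10 Ω) :
    form Q (u - u') v = form Q u v - form Q u' v :=
  congrArg (fun l => l v) (map_sub (formB Q) u u')

lemma form_sub_right (Q : LinfMat Ω) (u v v' : H10 Ω) :
    form Q u (v - v') = form Q u v - form Q u v' :=
  map_sub (formB Q u) v v'

lemma form_sub_coeff (P Q : LinfMat Ω) (u v : H10 Ω) :
    form (P - Q) u v = form P u v - form Q u v :=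
  congrArg (fun l => l u v) (map_sub (formL Ω) P Q)

/-- The load functional as a bounded functional. -/
def loadL (f : L2 Ω) : H10 Ω →L[ℝ] ℝ := (innerSL ℝ f).comp (valL Ω)

@[simp] lemma loadL_apply (f : L2 Ω) (v : H10 Ω) : loadL f v = load f v := by
  simp only [loadL, load, ContinuousLinearMap.comp_apply, innerSL_apply_apply, L2.inner_def]
  simp [mul_comm]

/-! ### Admissible matrices -/

/-- Polarization: the quadratic form at `e_i`, `e_j` and `e_i + e_j` determines the entry. This puts
admissible coefficients in a fixed ball of `L^∞`. -/
lemma abs_entry_le_of_mem_matK {qlo qhi : ℝ} (hqlo : 0 < qlo) (hqhi : 0 < qhi)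
    {M : Matrix (Fin d) (Fin d) ℝ} (hM : M ∈ matK d qlo qhi) (i j : Fin d) :
    |M i j| ≤ 2 * qhi := by
  obtain ⟨hs, h⟩ := hM
  have e1 := h (Pi.single i 1)
  have e2 := h (Pi.single j 1)
  have e3 := h (Pi.single i 1 + Pi.single j 1)
  have hsym : M j i = M i j := hs.apply i j
  simp only [Matrix.mulVec_add, dotProduct_add, Matrix.mulVec_single_one, Pi.add_apply,
    dotProduct_single_one, Matrix.col_apply] at e1 e2 e3
  rw [hsym] at e3
  have s1 : (Pi.single i (1 : ℝ) : Fin d → ℝ) j = (Pi.single j (1 : ℝ) : Fin d → ℝ) i := by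
    simp [Pi.single_apply, eq_comm]
  have s2 : (0 : ℝ) ≤ (Pi.single i (1 : ℝ) : Fin d → ℝ) j := by
    simp only [Pi.single_apply]; split <;> norm_num
  have s3 : (Pi.single i (1 : ℝ) : Fin d → ℝ) j ≤ 1 := by
    simp only [Pi.single_apply]; split <;> norm_num
  simp only [Pi.single_eq_same] at e1 e2 e3
  rw [← s1] at e3
  -- `t` is the Kronecker delta of `i` and `j`; only `0 ≤ t ≤ 1` is used, so both cases are treated
  -- at once.
  set t := (Pi.single i (1 : ℝ) : Fin d → ℝ) j
  rw [abs_le]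
  have p1 := mul_nonneg hqlo.le s2
  have p2 := mul_nonneg hqhi.le s2
  have p3 := mul_le_mul_of_nonneg_left s3 hqhi.le
  constructor <;> nlinarith

lemma matK_midpoint {qlo qhi : ℝ} {M N : Matrix (Fin d) (Fin d) ℝ} (hM : M ∈ matK d qlo qhi)
    (hN : N ∈ matK d qlo qhi) : (2⁻¹ : ℝ) • (M + N) ∈ matK d qlo qhi := by
  refine ⟨(hM.1.add hN.1).smul _, fun ξ => ?_⟩
  have h1 := hM.2 ξ
  have h2 := hN.2 ξ
  simp only [Matrix.smul_mulVec, Matrix.add_mulVec, smul_dotProduct, add_dotProduct, smul_eq_mul]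
  constructor <;> linarith [h1.1, h1.2, h2.1, h2.2]

lemma isClosed_matK (qlo qhi : ℝ) : IsClosed (matK d qlo qhi) := by
  have : matK d qlo qhi = {M | M.transpose = M} ∩ ⋂ ξ : Fin d → ℝ,
      {M : Matrix (Fin d) (Fin d) ℝ | qlo * (ξ ⬝ᵥ ξ) ≤ M.mulVec ξ ⬝ᵥ ξ} ∩
      {M | M.mulVec ξ ⬝ᵥ ξ ≤ qhi * (ξ ⬝ᵥ ξ)} := by
    ext M; simp [matK, Matrix.IsSymm]
  rw [this]
  refine (isClosed_eq (by fun_prop) continuous_id).inter (isClosed_iInter fun ξ => ?_)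
  exact (isClosed_le continuous_const (by fun_prop)).inter (isClosed_le (by fun_prop) continuous_const)

lemma norm_le_of_mem_Qad {qlo qhi : ℝ} (hqlo : 0 < qlo) (hqhi : 0 < qhi) {Q : LinfMat Ω}
    (hQ : Q ∈ Qad Ω qlo qhi) : ‖Q‖ ≤ 2 * qhi := by
  refine (pi_norm_le_iff_of_nonneg (by positivity)).2 fun i =>
    (pi_norm_le_iff_of_nonneg (by positivity)).2 fun j => ?_
  rw [Lp.norm_def, eLpNorm_exponent_top]
  refine ENNReal.toReal_le_of_le_ofReal (by positivity) (eLpNormEssSup_le_of_ae_bound ?_)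
  filter_upwards [hQ] with x hx
  exact abs_entry_le_of_mem_matK hqlo hqhi hx i j

lemma Qad_midpoint {qlo qhi : ℝ} {P Q : LinfMat Ω} (hP : P ∈ Qad Ω qlo qhi)
    (hQ : Q ∈ Qad Ω qlo qhi) : (2⁻¹ : ℝ) • (P + Q) ∈ Qad Ω qlo qhi := by
  have h1 := ae_mat_add P Q
  have h2 := ae_mat_smul (2⁻¹ : ℝ) (P + Q)
  show ∀ᵐ x ∂(vol Ω), _
  filter_upwards [h1, h2, hP, hQ] with x h1 h2 hP hQ
  have := matK_midpoint hP hQ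
  convert this using 1
  ext i j
  exact (h2 i j).trans (congrArg _ (h1 i j))

lemma form_symm_of_mem_Qad {qlo qhi : ℝ} {Q : LinfMat Ω} (hQ : Q ∈ Qad Ω qlo qhi)
    (u v : H10 Ω) : form Q u v = form Q v u := by
  refine integral_congr_ae ?_
  filter_upwards [hQ] with x hx
  rw [Finset.sum_comm]
  refine Finset.sum_congr rfl fun i _ => Finset.sum_congr rfl fun j _ => ?_
  have : Q i j x = Q j i x := hx.1.apply j i
  rw [this]; ring

lemma le_form_self_of_mem_Qad {qlo qhi : ℝ} {Q : LinfMat Ω} (hQ : Q ∈ Qad Ω qlo qhi)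
    (u : H10 Ω) : qlo * ‖grad u‖ ^ 2 ≤ form Q u u := by
  rw [norm_sq_eq_integral, ← integral_const_mul]
  refine integral_mono_ae ((integrable_norm_sq _).const_mul _) (integrable_form _ _ _) ?_
  filter_upwards [hQ] with x hx
  have h := (hx.2 (grad u x)).1
  have e1 : (grad u x : Fin d → ℝ) ⬝ᵥ (grad u x) = ‖grad u x‖ ^ 2 := by
    rw [EuclideanSpace.norm_sq_eq]; simp [dotProduct, sq]
  rw [e1] at h
  refine h.trans (le_of_eq ?_)
  simp [Matrix.mulVec, dotProduct, Finset.sum_mul]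

end EllipticID

end

noncomputable section

namespace EllipticID

variable {d : ℕ} {Ω : Set (E d)}

/-! ### The Poincaré inequality -/

lemma lintegral_comp_add_smul {g : E d → ℝ≥0∞} (hg : Measurable g) (a : E d) {t : ℝ}
    (ht : t ≠ 0) : ∫⁻ y, g (a + t • y) = ENNReal.ofReal (|t ^ d|⁻¹) * ∫⁻ y, g y := by
  have h1 : ∫⁻ y, g (a + t • y) = ∫⁻ z, g (a + z) ∂(Measure.map (fun y : E d => t • y) volume) :=
    (lintegral_map (f := fun z => g (a + z)) (hg.comp (measurable_const_add a))
      (measurable_const_smul t)).symm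
  rw [h1, Measure.map_addHaar_smul _ ht, lintegral_smul_measure, lintegral_add_left_eq_self]
  simp [abs_inv]

/-- The substitution has Jacobian `t⁻ᵈ`, and `t ≥ 1/2` keeps it below `2 ^ d`. -/
lemma lintegral_segment_le {g : E d → ℝ≥0∞} (hg : Measurable g) (D : Set (E d)) (b : E d) {t : ℝ}
    (ht : 2⁻¹ ≤ t) : ∫⁻ y in D, g (b + t • y) ≤ 2 ^ d * ∫⁻ y, g y := by
  have ht0 : 0 < t := by linarith [show (0 : ℝ) < 2⁻¹ by norm_num]
  refine (setLIntegral_le_lintegral _ _).trans ?_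
  rw [lintegral_comp_add_smul hg b ht0.ne']
  gcongr
  rw [abs_of_pos (by positivity), ← inv_pow]
  calc ENNReal.ofReal (t⁻¹ ^ d) ≤ ENNReal.ofReal (2 ^ d) := by
        apply ENNReal.ofReal_le_ofReal
        gcongr
        rw [inv_le_comm₀ ht0 (by norm_num)]; exact ht
    _ = 2 ^ d := by rw [ENNReal.ofReal_pow (by norm_num)]; simp

/-- Integrating a nonnegative function over all segments between points of a set. -/
lemma lintegral_lintegral_segment_le {g : E d → ℝ≥0∞} (hg : Measurable g) (D : Set (E d)) :
    ∫⁻ x in D, ∫⁻ y in D, ∫⁻ t in Set.Icc (0 : ℝ) 1, g (x + t • (y - x)) ≤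
      2 ^ d * volume D * ∫⁻ y, g y := by
  have hm : Measurable fun p : (E d × E d) × ℝ => g (p.1.1 + p.2 • (p.1.2 - p.1.1)) :=
    hg.comp (by fun_prop)
  have hslice : ∀ t ∈ Set.Icc (0 : ℝ) 1,
      ∫⁻ x in D, ∫⁻ y in D, g (x + t • (y - x)) ≤ 2 ^ d * volume D * ∫⁻ y, g y := by
    intro t ht
    have key : ∀ s : ℝ, 2⁻¹ ≤ s →
        ∫⁻ x in D, ∫⁻ y in D, g ((1 - s) • x + s • y) ≤ 2 ^ d * volume D * ∫⁻ y, g y := by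
      intro s hs
      calc ∫⁻ x in D, ∫⁻ y in D, g ((1 - s) • x + s • y)
          ≤ ∫⁻ _x in D, 2 ^ d * ∫⁻ y, g y :=
            lintegral_mono fun x => lintegral_segment_le hg D _ hs
        _ = _ := by rw [setLIntegral_const]; ring
    -- Substitute in whichever endpoint carries a weight of at least `1/2`; for small `t` the roles
    -- of `x` and `y` are exchanged.
    rcases le_total 2⁻¹ t with h | h
    · refine (le_of_eq ?_).trans (key t h)
      refine lintegral_congr fun x => lintegral_congr fun y => congrArg g ?_
      module
    · have := key (1 - t) (by linarith [show (2 : ℝ)⁻¹ = 1 - 2⁻¹ by norm_num])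
      refine (le_of_eq ?_).trans this
      rw [lintegral_lintegral_swap]
      · refine lintegral_congr fun x => lintegral_congr fun y => congrArg g ?_
        module
      · exact (hg.comp (f := fun p : E d × E d => p.1 + t • (p.2 - p.1))
          (by fun_prop)).aemeasurable
  calc ∫⁻ x in D, ∫⁻ y in D, ∫⁻ t in Set.Icc (0 : ℝ) 1, g (x + t • (y - x))
      = ∫⁻ x in D, ∫⁻ t in Set.Icc (0 : ℝ) 1, ∫⁻ y in D, g (x + t • (y - x)) := by
        refine lintegral_congr fun x => lintegral_lintegral_swap ?_
        exact (hg.comp (f := fun p : E d × ℝ => x + p.2 • (p.1 - x)) (by fun_prop)).aemeasurable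
    _ = ∫⁻ t in Set.Icc (0 : ℝ) 1, ∫⁻ x in D, ∫⁻ y in D, g (x + t • (y - x)) := by
        refine lintegral_lintegral_swap (Measurable.aemeasurable ?_)
        exact Measurable.lintegral_prod_right' (f := fun p : (E d × ℝ) × E d =>
          g (p.1.1 + p.1.2 • (p.2 - p.1.1))) (hg.comp (by fun_prop))
    _ ≤ ∫⁻ _t in Set.Icc (0 : ℝ) 1, 2 ^ d * volume D * ∫⁻ y, g y :=
        setLIntegral_mono measurable_const hslice
    _ = _ := by simp

/-- The fundamental theorem of calculus along the segment, then Cauchy–Schwarz in the parameter `t`.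
-/
lemma sq_sub_le_integral_segment {φ : E d → ℝ} (hφ : ContDiff ℝ 1 φ) (x y : E d) :
    (φ y - φ x) ^ 2 ≤ ‖y - x‖ ^ 2 *
      ∫ t in Set.Icc (0 : ℝ) 1, ‖fderiv ℝ φ (x + t • (y - x))‖ ^ 2 := by
  have hc : Continuous fun t : ℝ => fderiv ℝ φ (x + t • (y - x)) :=
    (hφ.continuous_fderiv one_ne_zero).comp (by fun_prop)
  have hderiv : ∀ t : ℝ, HasDerivAt (fun t : ℝ => φ (x + t • (y - x)))
      (fderiv ℝ φ (x + t • (y - x)) (y - x)) t := by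
    intro t
    have h1 := ((hφ.differentiable one_ne_zero) (x + t • (y - x))).hasFDerivAt
    have h2 : HasDerivAt (fun t : ℝ => x + t • (y - x)) (y - x) t := by
      simpa using ((hasDerivAt_id t).smul_const (y - x)).const_add x
    exact h1.comp_hasDerivAt t h2
  have hca : Continuous fun t : ℝ => fderiv ℝ φ (x + t • (y - x)) (y - x) := hc.clm_apply continuous_const
  have hftc := intervalIntegral.integral_eq_sub_of_hasDerivAt (a := 0) (b := 1)
    (fun t _ => hderiv t) (hca.intervalIntegrable _ _)
  simp only [one_smul, zero_smul, add_zero, add_sub_cancel] at hftc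
  rw [intervalIntegral.integral_of_le zero_le_one, ← integral_Icc_eq_integral_Ioc] at hftc
  rw [← hftc, ← integral_const_mul]
  have hm : MemLp (fun t : ℝ => fderiv ℝ φ (x + t • (y - x)) (y - x)) 2
      (volume.restrict (Set.Icc 0 1)) :=
    (memLp_two_iff_integrable_sq hca.aestronglyMeasurable).2 (hca.pow 2).integrableOn_Icc
  have hcs := sq_integral_mul_le hm (memLp_const (1 : ℝ))
  simp only [mul_one, one_pow] at hcs
  refine hcs.trans ?_
  simp only [integral_const, measureReal_restrict_apply, MeasurableSet.univ, Set.univ_inter,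
    Real.volume_real_Icc, sub_zero, max_eq_left zero_le_one, smul_eq_mul, mul_one]
  refine setIntegral_mono (hca.pow 2).integrableOn_Icc
    ((hc.norm.pow 2).const_mul _ |>.integrableOn_Icc) fun t => ?_
  rw [← mul_pow, ← sq_abs]
  gcongr
  rw [mul_comm]
  exact (fderiv ℝ φ _).le_opNorm _

lemma integral_sq_diff {D : Set (E d)} (hD : volume D ≠ ⊤) {φ : E d → ℝ}
    (h1 : IntegrableOn φ D) (h2 : IntegrableOn (fun x => φ x ^ 2) D) (c : ℝ) :
    ∫ y in D, (φ y - c) ^ 2 =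
      (∫ y in D, φ y ^ 2) - 2 * c * (∫ y in D, φ y) + c ^ 2 * volume.real D := by
  have : ∀ y, (φ y - c) ^ 2 = φ y ^ 2 - 2 * c * φ y + c ^ 2 := fun y => by ring
  simp_rw [this]
  have hc : IntegrableOn (fun _ => c ^ 2) D (volume : Measure (E d)) := integrableOn_const hD
  rw [integral_add (f := fun y => φ y ^ 2 - 2 * c * φ y)
    (Integrable.sub h2 (h1.const_mul (2 * c))) hc,
    integral_sub h2 (h1.const_mul _), integral_const_mul, setIntegral_const]
  simp [mul_comm]

/-- The Poincaré inequality for a smooth function on a ball. -/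
lemma poincare_closedBall {φ : E d → ℝ} (hφ : ContDiff ℝ 1 φ) (a : E d) (R : ℝ) :
    volume.real (Metric.closedBall a R) * (∫ x in Metric.closedBall a R, φ x ^ 2) -
        (∫ x in Metric.closedBall a R, φ x) ^ 2 ≤
      2 ^ d * (2 * R) ^ 2 * volume.real (Metric.closedBall a R) *
        ∫ x in Metric.closedBall a R, ‖fderiv ℝ φ x‖ ^ 2 := by
  set D := Metric.closedBall a R with hDdef
  have hDc : IsCompact D := isCompact_closedBall a R
  have hDm : MeasurableSet D := hDc.measurableSet
  have hDv : volume D ≠ ⊤ := hDc.measure_lt_top.ne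
  have hcont := hφ.continuous
  have hcf : Continuous fun x => fderiv ℝ φ x := hφ.continuous_fderiv one_ne_zero
  have i1 : IntegrableOn φ D := hcont.continuousOn.integrableOn_compact hDc
  have i2 : IntegrableOn (fun x => φ x ^ 2) D := (hcont.pow 2).continuousOn.integrableOn_compact hDc
  have i3 : IntegrableOn (fun x => ‖fderiv ℝ φ x‖ ^ 2) D :=
    (hcf.norm.pow 2).continuousOn.integrableOn_compact hDc
  set V := volume.real D
  set A := ∫ x in D, φ x ^ 2
  set I := ∫ x in D, φ x
  set G := ∫ x in D, ‖fderiv ℝ φ x‖ ^ 2 with hG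
  have hG0 : 0 ≤ G := integral_nonneg fun x => by positivity
  have hV0 : 0 ≤ V := measureReal_nonneg
  -- The left side of the claim is half the double integral of squared differences, which segment
  -- integrals can bound.
  have hdouble : ∫ x in D, ∫ y in D, (φ y - φ x) ^ 2 = 2 * (V * A - I ^ 2) := by
    have : ∀ x, ∫ y in D, (φ y - φ x) ^ 2 = φ x ^ 2 * V - 2 * I * φ x + A := fun x => by
      rw [integral_sq_diff hDv i1 i2]; ring
    simp_rw [this]
    have hc : IntegrableOn (fun _ => A) D (volume : Measure (E d)) := integrableOn_const hDv
    rw [integral_add (f := fun x => φ x ^ 2 * V - 2 * I * φ x)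
      ((i2.mul_const _).sub (i1.const_mul _)) hc,
      integral_sub (i2.mul_const _) (i1.const_mul _), integral_mul_const, integral_const_mul,
      setIntegral_const]
    simp only [smul_eq_mul]
    ring
  -- The cutoff to the ball loses nothing along segments between its points, by convexity, and
  -- confines the final gradient integral to the ball.
  set g : E d → ℝ≥0∞ := D.indicator fun x => ENNReal.ofReal (‖fderiv ℝ φ x‖ ^ 2) with hg
  have hgm : Measurable g :=
    (ENNReal.measurable_ofReal.comp (hcf.norm.pow 2).measurable).indicator hDm
  have hgi : ∫⁻ x, g x = ENNReal.ofReal G := by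
    rw [hg, lintegral_indicator hDm, hG, ofReal_integral_eq_lintegral_ofReal i3
      (Filter.Eventually.of_forall fun x => by positivity)]
  have hpt : ∀ x ∈ D, ∀ y ∈ D, ENNReal.ofReal ((φ y - φ x) ^ 2) ≤
      ENNReal.ofReal ((2 * R) ^ 2) * ∫⁻ t in Set.Icc (0 : ℝ) 1, g (x + t • (y - x)) := by
    intro x hx y hy
    have hR : ‖y - x‖ ≤ 2 * R := by
      rw [← dist_eq_norm]
      have h1 := Metric.mem_closedBall.1 hx
      have h2 := Metric.mem_closedBall.1 hy
      linarith [dist_triangle_right y x a]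
    have hcl : Continuous fun t : ℝ => ‖fderiv ℝ φ (x + t • (y - x))‖ ^ 2 :=
      (hcf.comp (by fun_prop : Continuous fun t : ℝ => x + t • (y - x))).norm.pow 2
    have e : ∫⁻ t in Set.Icc (0 : ℝ) 1, g (x + t • (y - x)) =
        ENNReal.ofReal (∫ t in Set.Icc (0 : ℝ) 1, ‖fderiv ℝ φ (x + t • (y - x))‖ ^ 2) := by
      rw [ofReal_integral_eq_lintegral_ofReal hcl.integrableOn_Icc
        (Filter.Eventually.of_forall fun x => by positivity)]
      refine setLIntegral_congr_fun measurableSet_Icc fun t ht => ?_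
      have : x + t • (y - x) ∈ D := (convex_closedBall a R).add_smul_sub_mem hx hy ht
      simp [hg, this]
    rw [e, ← ENNReal.ofReal_mul (by positivity)]
    refine ENNReal.ofReal_le_ofReal ((sq_sub_le_integral_segment hφ x y).trans ?_)
    gcongr
  have hle : ENNReal.ofReal (∫ x in D, ∫ y in D, (φ y - φ x) ^ 2) ≤
      ENNReal.ofReal ((2 * R) ^ 2 * (2 ^ d * V * G)) := by
    have hinner : ∀ x, ENNReal.ofReal (∫ y in D, (φ y - φ x) ^ 2) =
        ∫⁻ y in D, ENNReal.ofReal ((φ y - φ x) ^ 2) := fun x =>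
      ofReal_integral_eq_lintegral_ofReal
        (((hcont.sub continuous_const).pow 2).continuousOn.integrableOn_compact hDc)
        (Filter.Eventually.of_forall fun y => by positivity)
    rw [ofReal_integral_eq_lintegral_ofReal]
    · simp_rw [hinner]
      calc ∫⁻ x in D, ∫⁻ y in D, ENNReal.ofReal ((φ y - φ x) ^ 2)
          ≤ ∫⁻ x in D, ∫⁻ y in D, ENNReal.ofReal ((2 * R) ^ 2) *
              ∫⁻ t in Set.Icc (0 : ℝ) 1, g (x + t • (y - x)) :=
            setLIntegral_mono' hDm fun x hx => setLIntegral_mono' hDm fun y hy => hpt x hx y hy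
        _ = ENNReal.ofReal ((2 * R) ^ 2) * ∫⁻ x in D, ∫⁻ y in D,
              ∫⁻ t in Set.Icc (0 : ℝ) 1, g (x + t • (y - x)) := by
            simp_rw [lintegral_const_mul' _ _ ENNReal.ofReal_ne_top]
        _ ≤ ENNReal.ofReal ((2 * R) ^ 2) * (2 ^ d * volume D * ∫⁻ y, g y) := by
            gcongr; exact lintegral_lintegral_segment_le hgm D
        _ = _ := by
            rw [hgi, ENNReal.ofReal_mul (by positivity), ENNReal.ofReal_mul (by positivity),
              ENNReal.ofReal_mul (by positivity), ENNReal.ofReal_pow (by norm_num : (0 : ℝ) ≤ 2),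
              ofReal_measureReal hDv]
            simp
    · have : (fun x => ∫ y in D, (φ y - φ x) ^ 2) = fun x =>
          A - 2 * φ x * I + φ x ^ 2 * V := by
        ext x; rw [integral_sq_diff hDv i1 i2]
      rw [this]
      exact (by fun_prop : Continuous _).continuousOn.integrableOn_compact hDc
    · exact Filter.Eventually.of_forall fun x => integral_nonneg fun y => by positivity
  rw [ENNReal.ofReal_le_ofReal_iff (by positivity), hdouble] at hle
  have : 0 ≤ (2 * R) ^ 2 * (2 ^ d * V * G) := by positivity
  linarith

/-- A closed property of pairs `(φ, ∇φ)` that holds for smooth compactly supported functions holds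
on `H¹₀(Ω)`. -/
lemma H10_induction {P : L2Pair Ω → Prop} (hP : IsClosed {p | P p})
    (h : ∀ p ∈ testPairs Ω, P p) (u : H10 Ω) : P u := by
  have : (closure (testPairs Ω : Set (L2Pair Ω))) ⊆ {p | P p} := closure_minimal h hP
  exact this u.2

lemma continuous_fst_L2Pair : Continuous fun p : L2Pair Ω => p.fst :=
  (WithLp.fstL 2 ℝ _ _).continuous

lemma continuous_snd_L2Pair : Continuous fun p : L2Pair Ω => p.snd :=
  (WithLp.sndL 2 ℝ _ _).continuous

lemma continuous_setIntegral_norm_sq {F : Type*} [NormedAddCommGroup F] [InnerProductSpace ℝ F]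
    {μ : Measure (E d)} (s : Set (E d)) :
    Continuous fun f : Lp F 2 μ => ∫ x in s, ‖f x‖ ^ 2 ∂μ := by
  have : (fun f : Lp F 2 μ => ∫ x in s, ‖f x‖ ^ 2 ∂μ) =
      fun f => ‖LpToLpRestrictCLM (E d) F ℝ μ 2 s f‖ ^ 2 := by
    ext f
    rw [norm_sq_eq_integral]
    refine integral_congr_ae ?_
    filter_upwards [LpToLpRestrictCLM_coeFn ℝ s f] with x hx
    rw [hx]
  rw [this]
  exact (ContinuousLinearMap.continuous _).norm.pow 2

lemma continuous_setIntegral_L2 {μ : Measure (E d)} {s : Set (E d)} (hs : MeasurableSet s)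
    (hμ : μ s ≠ ⊤) : Continuous fun f : Lp ℝ 2 μ => ∫ x in s, f x ∂μ := by
  simp_rw [← L2.inner_indicatorConstLp_one (𝕜 := ℝ) hs hμ]
  fun_prop

lemma norm_gradient_eq (φ : E d → ℝ) (x : E d) : ‖gradient φ x‖ = ‖fderiv ℝ φ x‖ := by
  simp [gradient]

/-- The Poincaré inequality on a ball for functions in `H¹₀(Ω)`, extended by zero. -/
lemma poincare_H10 (u : H10 Ω) (a : E d) (R : ℝ) :
    volume.real (Metric.closedBall a R) * ∫ x in Metric.closedBall a R, ‖val u x‖ ^ 2 ∂(vol Ω) -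
        (∫ x in Metric.closedBall a R, val u x ∂(vol Ω)) ^ 2 ≤
      2 ^ d * (2 * R) ^ 2 * volume.real (Metric.closedBall a R) *
        ∫ x in Metric.closedBall a R, ‖grad u x‖ ^ 2 ∂(vol Ω) := by
  set B := Metric.closedBall a R with hB
  have hBm : MeasurableSet B := Metric.isClosed_closedBall.measurableSet
  have hBv : vol Ω B ≠ ⊤ := ((Measure.restrict_apply_le _ _).trans_lt
    (isCompact_closedBall a R).measure_lt_top).ne
  refine H10_induction (P := fun p : L2Pair Ω =>
    volume.real B * ∫ x in B, ‖p.fst x‖ ^ 2 ∂(vol Ω) - (∫ x in B, p.fst x ∂(vol Ω)) ^ 2 ≤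
      2 ^ d * (2 * R) ^ 2 * volume.real B * ∫ x in B, ‖p.snd x‖ ^ 2 ∂(vol Ω)) ?_ ?_ u
  · refine isClosed_le (Continuous.sub (Continuous.mul continuous_const ?_) (Continuous.pow ?_ 2))
      (Continuous.mul continuous_const ?_)
    · exact (continuous_setIntegral_norm_sq B).comp continuous_fst_L2Pair
    · exact (continuous_setIntegral_L2 hBm hBv).comp continuous_fst_L2Pair
    · exact (continuous_setIntegral_norm_sq B).comp continuous_snd_L2Pair
  · rintro p ⟨φ, hφ, hφc, hφs, h1, h2⟩
    -- A test function supported in `Ω` is its own extension by zero, so integrals over `B ∩ Ω` and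
    -- over `B` agree.
    have aux : ∀ {F G : E d → ℝ}, F =ᵐ[vol Ω] G → (∀ x ∉ tsupport φ, G x = 0) →
        ∫ x in B, F x ∂(vol Ω) = ∫ x in B, G x := by
      intro F G h hG
      rw [integral_congr_ae (ae_restrict_of_ae h), Measure.restrict_restrict hBm,
        ← setIntegral_eq_of_subset_of_forall_sdiff_eq_zero hBm Set.inter_subset_left]
      intro x hx
      exact hG x fun hx' => hx.2 ⟨hx.1, hφs hx'⟩
    have z1 : ∀ x ∉ tsupport φ, φ x = 0 := fun x hx => image_eq_zero_of_notMem_tsupport hx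
    have z2 : ∀ x ∉ tsupport φ, fderiv ℝ φ x = 0 := fun x hx =>
      image_eq_zero_of_notMem_tsupport fun h => hx (tsupport_fderiv_subset ℝ h)
    rw [aux (G := fun x => φ x ^ 2) (h1.mono fun x hx => by simp [hx])
        (fun x hx => by simp [z1 x hx]), aux h1 z1,
      aux (G := fun x => ‖fderiv ℝ φ x‖ ^ 2) (h2.mono fun x hx => by
        simp [hx, norm_gradient_eq]) (fun x hx => by simp [z2 x hx])]
    exact poincare_closedBall (hφ.of_le (by simp)) a R

/-- The global Poincaré inequality on a bounded open set. -/
lemma exists_norm_sq_le_grad (hd : 1 ≤ d) (hΩb : Bornology.IsBounded Ω) :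
    ∃ C : ℝ, 0 < C ∧ ∀ u : H10 Ω, ‖u‖ ^ 2 ≤ C * ‖grad u‖ ^ 2 := by
  have : Nonempty (Fin d) := ⟨⟨0, hd⟩⟩
  obtain ⟨r, hr⟩ := hΩb.subset_closedBall (0 : E d)
  set r' := max r 1 with hr'
  have hr0 : 0 < r' := lt_of_lt_of_le one_pos (le_max_right _ _)
  -- In the doubled ball, `Ω` fills at most the fraction `2⁻ᵈ ≤ 1/2`. By Cauchy–Schwarz the square
  -- of the integral is then at most half of `|B| ‖u‖²`, and it is absorbed.
  set R := 2 * r' with hR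
  set B := Metric.closedBall (0 : E d) R
  have hΩr : Ω ⊆ Metric.closedBall 0 r' := hr.trans (Metric.closedBall_subset_closedBall (le_max_left _ _))
  have hΩB : Ω ⊆ B := hΩr.trans (Metric.closedBall_subset_closedBall (by linarith))
  have hBv : volume B ≠ ⊤ := (isCompact_closedBall _ _).measure_lt_top.ne
  have hω : 0 < volume.real (Metric.closedBall (0 : E d) r') :=
    ENNReal.toReal_pos (Metric.measure_closedBall_pos _ _ hr0).ne'
      (isCompact_closedBall _ _).measure_lt_top.ne
  have hV : volume.real B = 2 ^ d * volume.real (Metric.closedBall (0 : E d) r') := by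
    simp only [Measure.real, B]
    rw [Measure.addHaar_closedBall _ _ (by positivity), Measure.addHaar_closedBall _ _ hr0.le]
    rw [ENNReal.toReal_mul, ENNReal.toReal_mul, ENNReal.toReal_ofReal (by positivity),
      ENNReal.toReal_ofReal (by positivity)]
    simp [hR, mul_pow]; ring
  have h2d : (2 : ℝ) ≤ 2 ^ d := by
    calc (2 : ℝ) = 2 ^ 1 := by norm_num
      _ ≤ 2 ^ d := pow_le_pow_right₀ (by norm_num) hd
  have hΩV : 2 * volume.real Ω ≤ volume.real B := by
    have : volume.real Ω ≤ volume.real (Metric.closedBall (0 : E d) r') :=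
      measureReal_mono hΩr (isCompact_closedBall _ _).measure_lt_top.ne
    rw [hV]; nlinarith
  have hVpos : 0 < volume.real B := by rw [hV]; positivity
  -- The factor `2` is the price of the absorption; the summand `1` accounts for the gradient part
  -- of the `H¹` norm.
  refine ⟨2 * (2 ^ d * (2 * R) ^ 2) + 1, by positivity, fun u => ?_⟩
  have hp := poincare_H10 u 0 R
  have hres : (vol Ω).restrict B = vol Ω := by
    rw [Measure.restrict_restrict Metric.isClosed_closedBall.measurableSet,
      Set.inter_eq_right.2 hΩB]
  rw [hres, ← norm_sq_eq_integral, ← norm_sq_eq_integral] at hp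
  have : IsFiniteMeasure (vol Ω) := ⟨by
    rw [Measure.restrict_apply_univ]; exact (measure_mono hΩB).trans_lt hBv.lt_top⟩
  have hcs := sq_integral_mul_le (Lp.memLp (val u)) (memLp_const (1 : ℝ))
  have e : ∫ x in Ω, val u x ^ 2 = ‖val u‖ ^ 2 := by
    rw [norm_sq_eq_integral]; simp
  simp only [mul_one, one_pow, e, setIntegral_const, smul_eq_mul] at hcs
  have h3 := mul_le_mul_of_nonneg_left hΩV (sq_nonneg ‖val u‖)
  have h4 : volume.real B * ‖val u‖ ^ 2 ≤
      volume.real B * (2 * (2 ^ d * (2 * R) ^ 2) * ‖grad u‖ ^ 2) := by nlinarith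
  have h5 := le_of_mul_le_mul_left h4 hVpos
  rw [norm_sq_H10]; linarith

/-- A coercivity constant exists. -/
lemma exists_isCoercivityConst (hd : 1 ≤ d) (hΩb : Bornology.IsBounded Ω)
    {qlo : ℝ} (hqlo : 0 < qlo) : ∃ κ, IsCoercivityConst Ω qlo κ := by
  obtain ⟨C, hC, h⟩ := exists_norm_sq_le_grad hd hΩb
  refine ⟨qlo / C, by positivity, fun qhi Q hQ u => ?_⟩
  refine le_trans ?_ (le_form_self_of_mem_Qad hQ u)
  rw [div_mul_eq_mul_div, div_le_iff₀ hC]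
  nlinarith [h u]

end EllipticID

end

noncomputable section

namespace EllipticID

variable {d : ℕ} {Ω : Set (E d)}

/-! ### Solvability of the direct problem -/

/-- Lax–Milgram, after representing the functional by Riesz. Since symmetry is not needed, it also
applies to coefficients near the admissible set. -/
lemma existsUnique_of_isCoercive {V : Type*} [NormedAddCommGroup V] [InnerProductSpace ℝ V]
    [CompleteSpace V] {B : V →L[ℝ] V →L[ℝ] ℝ} (hB : IsCoercive B) (F : V →L[ℝ] ℝ) :
    ∃! u : V, ∀ v, B u v = F v := by
  set r := (InnerProductSpace.toDual ℝ V).symm F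
  have hr : ∀ v, inner ℝ r v = F v := fun v => InnerProductSpace.toDual_symm_apply
  refine ⟨hB.continuousLinearEquivOfBilin.symm r, fun v => ?_, fun u hu => ?_⟩
  · rw [← hB.continuousLinearEquivOfBilin_apply, ContinuousLinearEquiv.apply_symm_apply, hr]
  · rw [ContinuousLinearEquiv.eq_symm_apply]
    refine ext_inner_right ℝ fun v => ?_
    rw [hB.continuousLinearEquivOfBilin_apply, hu, hr]

lemma weakSol_spec {Q : LinfMat Ω} (hQ : IsCoercive (formB Q)) (F : H10 Ω →L[ℝ] ℝ) (v : H10 Ω) :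
    form Q (weakSol F Q) v = F v := by
  have h : ∃! u : H10 Ω, ∀ v : H10 Ω, form Q u v = F v := existsUnique_of_isCoercive hQ F
  rw [weakSol, dif_pos h]
  exact h.choose_spec.1 v

lemma solOp_spec {f : L2 Ω} {Q : LinfMat Ω} (hQ : IsCoercive (formB Q)) (v : H10 Ω) :
    form Q (solOp f Q) v = load f v := by
  have : load f = ⇑(loadL f) := funext fun v => (loadL_apply f v).symm
  rw [solOp, this]
  exact weakSol_spec hQ (loadL f) v

lemma IsCoercivityConst.isCoercive {qlo qhi κ : ℝ} (hκ : IsCoercivityConst Ω qlo κ)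
    {Q : LinfMat Ω} (hQ : Q ∈ Qad Ω qlo qhi) : IsCoercive (formB Q) :=
  ⟨κ, hκ.1, fun u => by rw [mul_assoc, ← sq]; exact hκ.2 qhi Q hQ u⟩

/-- Coercivity passes to subspaces, so Lax–Milgram applies on `V_h` as soon as it is complete. -/
lemma discSolOp_spec {K : Mesh d} [CompleteSpace (Vh Ω K)] {f : L2 Ω} {Q : LinfMat Ω}
    (hQ : IsCoercive (formB Q)) :
    discSolOp K f Q ∈ Vh Ω K ∧ ∀ v ∈ Vh Ω K, form Q (discSolOp K f Q) v = load f v := by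
  have hc : IsCoercive ((formB Q).bilinearComp (Vh Ω K).subtypeL (Vh Ω K).subtypeL) := by
    obtain ⟨C, hC, h⟩ := hQ
    exact ⟨C, hC, fun u => h u⟩
  obtain ⟨u, hu, hu'⟩ := existsUnique_of_isCoercive hc ((loadL f).comp (Vh Ω K).subtypeL)
  have h : ∃! u : H10 Ω, u ∈ Vh Ω K ∧ ∀ v ∈ Vh Ω K, form Q u v = load f v := by
    refine ⟨u, ⟨u.2, fun v hv => ?_⟩, ?_⟩
    · simpa using hu ⟨v, hv⟩
    · rintro w ⟨hw, hw'⟩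
      refine congrArg Subtype.val (hu' ⟨w, hw⟩ fun v => ?_)
      simpa using hw' v v.2
  rw [discSolOp, dif_pos h]
  exact h.choose_spec.1

/-! ### Differentiability of the coefficient-to-solution operator -/

lemma eventually_isCoercive {Q : LinfMat Ω} (hQ : IsCoercive (formB Q)) :
    ∀ᶠ P in nhds Q, IsCoercive (formB P) := by
  obtain ⟨C, hC, h⟩ := hQ
  -- A perturbation of this size changes the form by at most half the coercivity constant; the `+ 1`
  -- keeps the denominator positive.
  have hε : 0 < C / (2 * ((d : ℝ) ^ 2 + 1)) := by positivity
  filter_upwards [Metric.ball_mem_nhds Q hε] with P hP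
  refine ⟨C / 2, by positivity, fun u => ?_⟩
  rw [Metric.mem_ball, dist_eq_norm, lt_div_iff₀ (by positivity)] at hP
  have h1 := abs_form_le (P - Q) u u
  have h2 : C * ‖u‖ * ‖u‖ ≤ form Q u u := h u
  rw [form_sub_coeff] at h1
  have h3 := (abs_le.1 h1).1
  show C / 2 * ‖u‖ * ‖u‖ ≤ form P u u
  have h4 : ((d : ℝ) ^ 2 * ‖P - Q‖) * (‖u‖ * ‖u‖) ≤ C / 2 * (‖u‖ * ‖u‖) := by
    refine mul_le_mul_of_nonneg_right ?_ (by positivity)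
    nlinarith [norm_nonneg (P - Q)]
  nlinarith

/-- The operator `u ↦ form Q u` of a coercive form, as an isomorphism onto the dual space. -/
lemma exists_equiv_of_isCoercive {Q : LinfMat Ω} (hQ : IsCoercive (formB Q)) :
    ∃ e : H10 Ω ≃L[ℝ] (H10 Ω →L[ℝ] ℝ), (e : H10 Ω →L[ℝ] (H10 Ω →L[ℝ] ℝ)) = formL Ω Q := by
  have hbij : Function.Bijective (formL Ω Q) := by
    constructor
    · intro u u' h
      exact (existsUnique_of_isCoercive hQ (formL Ω Q u')).unique
        (fun v => congrArg (fun l => l v) h) (fun v => rfl)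
    · intro F
      obtain ⟨u, hu, -⟩ := existsUnique_of_isCoercive hQ F
      exact ⟨u, ContinuousLinearMap.ext hu⟩
  refine ⟨ContinuousLinearEquiv.ofBijective (formL Ω Q) (LinearMap.ker_eq_bot.2 hbij.1)
    (LinearMap.range_eq_top.2 hbij.2), ?_⟩
  exact ContinuousLinearEquiv.coe_ofBijective _ _ _

/-- This writes `U` as operator inversion composed with a continuous linear map in `Q`, so its
smoothness is that of inversion. -/
lemma solOp_eq_inverse {f : L2 Ω} {Q : LinfMat Ω} (hQ : IsCoercive (formB Q)) :
    solOp f Q = (formL Ω Q).inverse (loadL f) := by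
  obtain ⟨e, he⟩ := exists_equiv_of_isCoercive hQ
  rw [← he, ContinuousLinearMap.inverse_equiv]
  refine (e.eq_symm_apply).2 ?_
  have h : ∀ u, e u = formL Ω Q u := fun u => congrArg (fun l => l u) he
  rw [h]
  exact ContinuousLinearMap.ext fun v => (solOp_spec hQ v).trans (loadL_apply f v).symm

lemma differentiableAt_solOp (f : L2 Ω) {Q : LinfMat Ω} (hQ : IsCoercive (formB Q)) :
    DifferentiableAt ℝ (solOp f) Q := by
  obtain ⟨e, he⟩ := exists_equiv_of_isCoercive hQ
  have h1 : DifferentiableAt ℝ ContinuousLinearMap.inverse (formL Ω Q) := by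
    rw [← he]
    exact (contDiffAt_map_inverse (n := 1) e).differentiableAt one_ne_zero
  have h2 : DifferentiableAt ℝ (fun P => (formL Ω P).inverse (loadL f)) Q :=
    (h1.comp Q (formL Ω).differentiableAt).clm_apply (differentiableAt_const _)
  refine h2.congr_of_eventuallyEq ?_
  filter_upwards [eventually_isCoercive hQ] with P hP
  exact solOp_eq_inverse hP

/-- The derivative `U'(Q) H` solves the problem with right-hand side `-∫ H ∇U(Q) · ∇v`. -/
lemma form_fderiv_solOp (f : L2 Ω) {Q : LinfMat Ω} (hQ : IsCoercive (formB Q)) (H : LinfMat Ω)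
    (v : H10 Ω) : form Q (fderiv ℝ (solOp f) Q H) v = - form H (solOp f Q) v := by
  -- Product rule for `P ↦ form P (U(P))`; by the state equation this map is constant near `Q`, so
  -- its derivative vanishes.
  have h1 := (formL Ω).hasFDerivAt (x := Q) |>.clm_apply (differentiableAt_solOp f hQ).hasFDerivAt
  have h2 : HasFDerivAt (fun P => formL Ω P (solOp f P)) (0 : LinfMat Ω →L[ℝ] H10 Ω →L[ℝ] ℝ) Q := by
    refine (hasFDerivAt_const (loadL f) Q).congr_of_eventuallyEq ?_
    filter_upwards [eventually_isCoercive hQ] with P hP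
    exact ContinuousLinearMap.ext fun v => (solOp_spec hP v).trans (loadL_apply f v).symm
  have h3 := congrArg (fun l => l H v) (h1.unique h2)
  have h4 : form Q (fderiv ℝ (solOp f) Q H) v + form H (solOp f Q) v = 0 := h3
  linarith

/-- The source condition turns the penalty into the form at the weak solution with data `w*`. -/
lemma SourceCondition.pairing_eq {f : L2 Ω} {qlo qhi : ℝ} {Q : LinfMat Ω}
    (hQ : Q ∈ Qad Ω qlo qhi) (hc : IsCoercive (formB Q)) {wstar : H10 Ω →L[ℝ] ℝ}
    (hw : SourceCondition f Q wstar) (H : LinfMat Ω) :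
    pairing H Q = - form H (solOp f Q) (weakSol wstar Q) := by
  -- Symmetry of `Q` exchanges the two slots, so the equation for `U'(Q) H` tested with `w` meets
  -- the equation for `w` tested with `U'(Q) H`.
  rw [← hw H, ← form_fderiv_solOp f hc, form_symm_of_mem_Qad hQ, weakSol_spec hc]

end EllipticID

end

noncomputable section

namespace EllipticID

variable {d : ℕ} {Ω : Set (E d)}

/-! ### Weak gradients -/

lemma inner_gradient (φ : E d → ℝ) (x v : E d) : inner ℝ (gradient φ x) v = fderiv ℝ φ x v := by
  simp [gradient]

lemma setIntegral_eq_integral_of_tsupport {ψ F : E d → ℝ} (hψ : tsupport ψ ⊆ Ω)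
    (hF : ∀ x ∉ tsupport ψ, F x = 0) : ∫ x in Ω, F x = ∫ x, F x :=
  setIntegral_eq_integral_of_forall_compl_eq_zero fun x hx => hF x fun h => hx (hψ h)

lemma integral_fderiv_mul_eq_neg {φ ψ : E d → ℝ} (hφ : ContDiff ℝ 1 φ) (hψ : ContDiff ℝ 1 ψ)
    (hψc : HasCompactSupport ψ) (v : E d) :
    ∫ x, fderiv ℝ φ x v * ψ x = - ∫ x, φ x * fderiv ℝ ψ x v := by
  have c1 : Continuous fun x => fderiv ℝ φ x v :=
    (hφ.continuous_fderiv one_ne_zero).clm_apply continuous_const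
  have c2 : Continuous fun x => fderiv ℝ ψ x v :=
    (hψ.continuous_fderiv one_ne_zero).clm_apply continuous_const
  have s2 : HasCompactSupport fun x => fderiv ℝ ψ x v := hψc.fderiv_apply ℝ v
  rw [integral_mul_fderiv_eq_neg_fderiv_mul_of_integrable, neg_neg]
  · exact (c1.mul hψ.continuous).integrable_of_hasCompactSupport hψc.mul_left
  · exact (hφ.continuous.mul c2).integrable_of_hasCompactSupport s2.mul_left
  · exact (hφ.continuous.mul hψ.continuous).integrable_of_hasCompactSupport hψc.mul_left
  · exact fun x _ => hφ.differentiable one_ne_zero x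
  · exact fun x _ => hψ.differentiable one_ne_zero x

/-- Integration by parts in `H¹₀(Ω)`: the second component of a pair is the weak gradient. -/
lemma integral_inner_grad_mul (u : H10 Ω) {ψ : E d → ℝ} (hψ : ContDiff ℝ ∞ ψ)
    (hψc : HasCompactSupport ψ) (v : E d) :
    ∫ x in Ω, inner ℝ (grad u x) v * ψ x = - ∫ x in Ω, val u x * fderiv ℝ ψ x v := by
  have c2 : Continuous fun x => fderiv ℝ ψ x v :=
    (hψ.continuous_fderiv (by simp)).clm_apply continuous_const
  have m1 : MemLp (fun x => ψ x • v) 2 (vol Ω) :=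
    ((hψ.continuous.smul continuous_const).memLp_of_hasCompactSupport
      (μ := volume) hψc.smul_right).restrict Ω
  have m2 : MemLp (fun x => fderiv ℝ ψ x v) 2 (vol Ω) :=
    (c2.memLp_of_hasCompactSupport (μ := volume) (hψc.fderiv_apply ℝ v)).restrict Ω
  have e1 : ∀ g : Lp (E d) 2 (vol Ω), inner ℝ g (m1.toLp _) = ∫ x in Ω, inner ℝ (g x) v * ψ x := by
    intro g
    rw [L2.inner_def]
    refine integral_congr_ae ?_
    filter_upwards [m1.coeFn_toLp] with x hx
    rw [hx, inner_smul_right, mul_comm]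
  have e2 : ∀ g : L2 Ω, inner ℝ g (m2.toLp _) = ∫ x in Ω, g x * fderiv ℝ ψ x v := by
    intro g
    rw [L2.inner_def]
    refine integral_congr_ae ?_
    filter_upwards [m2.coeFn_toLp] with x hx
    rw [hx]; simp [mul_comm]
  refine H10_induction (P := fun p : L2Pair Ω =>
    ∫ x in Ω, inner ℝ (p.snd x) v * ψ x = - ∫ x in Ω, p.fst x * fderiv ℝ ψ x v) ?_ ?_ u
  · simp_rw [← e1, ← e2]
    exact isClosed_eq (continuous_snd_L2Pair.inner continuous_const)
      (continuous_fst_L2Pair.inner continuous_const).neg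
  · rintro p ⟨φ, hφ, hφc, hφs, h1, h2⟩
    have a1 : ∫ x in Ω, inner ℝ (p.snd x) v * ψ x = ∫ x in Ω, fderiv ℝ φ x v * ψ x :=
      integral_congr_ae (h2.mono fun x hx => by simp only [hx, inner_gradient])
    have a2 : ∫ x in Ω, p.fst x * fderiv ℝ ψ x v = ∫ x in Ω, φ x * fderiv ℝ ψ x v :=
      integral_congr_ae (h1.mono fun x hx => by simp only [hx])
    rw [a1, a2, setIntegral_eq_integral_of_tsupport hφs, setIntegral_eq_integral_of_tsupport hφs]
    · exact integral_fderiv_mul_eq_neg (hφ.of_le (by simp)) (hψ.of_le (by simp)) hψc v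
    · exact fun x hx => by simp [image_eq_zero_of_notMem_tsupport hx]
    · intro x hx
      have : fderiv ℝ φ x = 0 :=
        image_eq_zero_of_notMem_tsupport fun h => hx (tsupport_fderiv_subset ℝ h)
      simp [this]

/-- Where an element of `H¹₀(Ω)` is a `C¹` function, its weak gradient is the gradient. -/
lemma grad_ae_eq_gradient (u : H10 Ω) {U : Set (E d)} (hU : IsOpen U) (hUΩ : U ⊆ Ω)
    {g : E d → ℝ} (hg : ContDiff ℝ 1 g) (hug : ∀ᵐ x ∂(vol Ω), x ∈ U → val u x = g x) :
    ∀ᵐ x ∂(vol Ω), x ∈ U → grad u x = gradient g x := by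
  have hcoord : ∀ i : Fin d, ∀ᵐ x ∂(vol Ω), x ∈ U →
      inner ℝ (grad u x) (EuclideanSpace.single i 1) -
        fderiv ℝ g x (EuclideanSpace.single i (1 : ℝ)) = 0 := by
    intro i
    set v : E d := EuclideanSpace.single i 1
    have cg : Continuous fun x => fderiv ℝ g x v :=
      (hg.continuous_fderiv one_ne_zero).clm_apply continuous_const
    have mg : MemLp (fun x => inner ℝ (grad u x) v) 2 (vol Ω) := (Lp.memLp (grad u)).inner_const v
    have l1 : LocallyIntegrable (fun x => inner ℝ (grad u x) v) (vol Ω) :=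
      mg.locallyIntegrable (by norm_num)
    have l2 : LocallyIntegrable (fun x => fderiv ℝ g x v) (vol Ω) := cg.locallyIntegrable
    -- Fundamental lemma of the calculus of variations on `U`: both candidates integrate by parts to
    -- the same value.
    refine hU.ae_eq_zero_of_integral_contDiff_smul_eq_zero
      ((l1.sub l2).locallyIntegrableOn U) fun ψ hψ hψc hψs => ?_
    have z1 : ∀ x ∉ tsupport ψ, fderiv ℝ ψ x = 0 := fun x hx =>
      image_eq_zero_of_notMem_tsupport fun h => hx (tsupport_fderiv_subset ℝ h)
    have z2 : ∀ x ∉ tsupport ψ, ψ x = 0 := fun x hx => image_eq_zero_of_notMem_tsupport hx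
    have i1 : Integrable (fun x => ψ x * inner ℝ (grad u x) v) (vol Ω) :=
      (hψ.continuous.memLp_of_hasCompactSupport (p := 2) (μ := vol Ω) hψc).integrable_mul mg
    have i2 : Integrable (fun x => ψ x * fderiv ℝ g x v) (vol Ω) :=
      ((hψ.continuous.mul cg).integrable_of_hasCompactSupport hψc.mul_right)
    have e1 : ∫ x in Ω, ψ x * inner ℝ (grad u x) v = - ∫ x, g x * fderiv ℝ ψ x v := by
      simp_rw [mul_comm (ψ _)]
      rw [integral_inner_grad_mul u hψ hψc v]
      congr 1
      rw [← setIntegral_eq_integral_of_tsupport (Ω := Ω) (hψs.trans hUΩ)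
        (F := fun x => g x * fderiv ℝ ψ x v) fun x hx => by simp [z1 x hx]]
      refine integral_congr_ae ?_
      filter_upwards [hug] with x hx
      by_cases h : x ∈ U
      · rw [hx h]
      · rw [z1 x fun h' => h (hψs h')]; simp
    have e2 : ∫ x in Ω, ψ x * fderiv ℝ g x v = ∫ x, fderiv ℝ g x v * ψ x := by
      rw [setIntegral_eq_integral_of_tsupport (hψs.trans hUΩ) fun x hx => by simp [z2 x hx]]
      simp_rw [mul_comm (ψ _)]
    simp only [smul_eq_mul, mul_sub]
    rw [integral_sub i1 i2, e1, e2, integral_fderiv_mul_eq_neg hg (hψ.of_le (by simp)) hψc, sub_self]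
  filter_upwards [ae_all_iff.2 hcoord] with x hx hxU
  ext i
  have h := hx i hxU
  rw [← inner_gradient, EuclideanSpace.inner_single_right, EuclideanSpace.inner_single_right] at h
  simpa [sub_eq_zero] using h

/-- Elements of `H¹₀(Ω)` are pairs; a vanishing function has vanishing weak gradient, so the
function determines the pair. This allows elements to be identified through their values on cells.
-/
lemma val_injective (hΩo : IsOpen Ω) : Function.Injective (val : H10 Ω → L2 Ω) := by
  have key : ∀ u : H10 Ω, val u = 0 → u = 0 := by
    intro u hu
    have h0 : ∀ᵐ x ∂(vol Ω), val u x = 0 := by rw [hu]; exact Lp.coeFn_zero ℝ 2 (vol Ω)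
    have h := grad_ae_eq_gradient u hΩo subset_rfl (g := fun _ => 0) contDiff_const
      (h0.mono fun x hx _ => hx)
    have hg : grad u = 0 := by
      refine (Lp.eq_zero_iff_ae_eq_zero).2 ?_
      filter_upwards [h, ae_restrict_mem hΩo.measurableSet] with x hx hxΩ
      rw [hx hxΩ]; simp [gradient]
    have := norm_sq_H10 u
    rw [hu, hg] at this
    simpa using this
  intro u v h
  rw [← sub_eq_zero]
  exact key _ (by rw [val_sub, h, sub_self])

/-! ### The finite element space is finite dimensional -/

instance finiteDimensional_affineMap : FiniteDimensional ℝ (E d →ᵃ[ℝ] ℝ) :=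
  (AffineMap.toConstProdLinearMap ℝ (V1 := E d) (V2 := ℝ)).symm.finiteDimensional

lemma contDiff_affineMap (p : E d →ᵃ[ℝ] ℝ) {n : WithTop ℕ∞} : ContDiff ℝ n p :=
  (ContinuousAffineMap.mk p p.continuous_of_finiteDimensional).contDiff

lemma memLp_vol_of_continuous (hΩb : Bornology.IsBounded Ω) {g : E d → ℝ} (hg : Continuous g) :
    MemLp g 2 (vol Ω) := by
  have h : MemLp g 2 (volume.restrict (closure Ω)) := by
    have hc : IsCompact (closure Ω) := hΩb.isCompact_closure
    obtain ⟨C, hC⟩ := hc.exists_bound_of_continuousOn hg.continuousOn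
    have : IsFiniteMeasure (volume.restrict (closure Ω)) :=
      ⟨by rw [Measure.restrict_apply_univ]; exact hc.measure_lt_top⟩
    exact MemLp.of_bound hg.aestronglyMeasurable C
      ((ae_restrict_iff' isClosed_closure.measurableSet).2 (Filter.Eventually.of_forall hC))
  exact h.mono_measure (Measure.restrict_mono_set _ subset_closure)

/-- The affine functions in `L²(S ∩ Ω)`. -/
def affineL2 (hΩb : Bornology.IsBounded Ω) (S : Set (E d)) :
    (E d →ᵃ[ℝ] ℝ) →ₗ[ℝ] Lp ℝ 2 ((vol Ω).restrict S) where
  toFun p := ((memLp_vol_of_continuous hΩb p.continuous_of_finiteDimensional).restrict S).toLp p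
  map_add' _ _ := MemLp.toLp_add _ _
  map_smul' _ _ := MemLp.toLp_const_smul _ _

lemma coeFn_affineL2 (hΩb : Bornology.IsBounded Ω) (S : Set (E d)) (p : E d →ᵃ[ℝ] ℝ) :
    affineL2 hΩb S p =ᵐ[(vol Ω).restrict S] p :=
  MemLp.coeFn_toLp ((memLp_vol_of_continuous hΩb p.continuous_of_finiteDimensional).restrict S)

lemma measurableSet_convexHull (s : Finset (E d)) :
    MeasurableSet (convexHull ℝ (s : Set (E d))) :=
  (s.finite_toSet.isCompact_convexHull (𝕜 := ℝ)).isClosed.measurableSet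

/-- Restriction to the cells embeds `V_h` into a finite product of spaces of affine functions; it is
injective because the cells cover `Ω`. This gives the completeness needed for Lax–Milgram. -/
lemma finiteDimensional_Vh (hΩo : IsOpen Ω) (hΩb : Bornology.IsBounded Ω) {K : Mesh d}
    (hK : (cells K).Finite) (hcov : Ω ⊆ ⋃ s ∈ cells K, convexHull ℝ (s : Set (E d))) :
    FiniteDimensional ℝ (Vh Ω K) := by
  have : Finite (cells K) := hK
  have : Fintype (cells K) := Fintype.ofFinite _
  have : ∀ S : Set (E d), FiniteDimensional ℝ (LinearMap.range (affineL2 hΩb S)) := fun S =>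
    LinearMap.finiteDimensional_range _
  have hmem : ∀ (s : cells K) (u : Vh Ω K),
      ((LpToLpRestrictCLM (E d) ℝ ℝ (vol Ω) 2 (convexHull ℝ (s.1 : Set (E d)))).toLinearMap.comp
        ((valL Ω).toLinearMap.comp (Vh Ω K).subtype)) u ∈
      LinearMap.range (affineL2 hΩb (convexHull ℝ (s.1 : Set (E d)))) := by
    rintro s ⟨u, g, -, hug, hgp⟩
    obtain ⟨p, hp⟩ := hgp s s.2
    refine ⟨p, Lp.ext ?_⟩
    filter_upwards [coeFn_affineL2 hΩb (convexHull ℝ (s.1 : Set (E d))) p,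
      LpToLpRestrictCLM_coeFn ℝ (convexHull ℝ (s.1 : Set (E d))) (val u),
      ae_restrict_of_ae hug, ae_restrict_mem (measurableSet_convexHull s.1)] with x h1 h2 h3 h4
    rw [h1]
    exact (h2.trans (h3.trans (hp h4))).symm
  let Ψ : Vh Ω K →ₗ[ℝ] ∀ s : cells K, LinearMap.range (affineL2 hΩb (convexHull ℝ (s.1 : Set (E d)))) :=
    LinearMap.pi fun s => LinearMap.codRestrict _ _ (hmem s)
  refine FiniteDimensional.of_injective Ψ ?_
  rw [← LinearMap.ker_eq_bot, LinearMap.ker_eq_bot']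
  intro u hu
  have hz : ∀ s : cells K, ∀ᵐ x ∂(vol Ω), x ∈ convexHull ℝ (s.1 : Set (E d)) →
      val (u : H10 Ω) x = 0 := by
    intro s
    have h1 : LpToLpRestrictCLM (E d) ℝ ℝ (vol Ω) 2 (convexHull ℝ (s.1 : Set (E d)))
        (val (u : H10 Ω)) = 0 := congrArg Subtype.val (congrFun hu s)
    have h2 := LpToLpRestrictCLM_coeFn ℝ (convexHull ℝ (s.1 : Set (E d))) (val (u : H10 Ω))
    rw [h1] at h2
    rw [← ae_restrict_iff' (measurableSet_convexHull s.1)]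
    filter_upwards [h2, Lp.coeFn_zero ℝ 2 ((vol Ω).restrict (convexHull ℝ (s.1 : Set (E d))))]
      with x h2 h3
    rw [← h2, h3]; rfl
  refine Subtype.ext (val_injective hΩo ?_)
  refine (Lp.eq_zero_iff_ae_eq_zero).2 ?_
  filter_upwards [ae_all_iff.2 hz, ae_restrict_mem hΩo.measurableSet] with x hx hxΩ
  obtain ⟨s, hs, hxs⟩ := Set.mem_iUnion₂.1 (hcov hxΩ)
  exact hx ⟨s, hs⟩ hxs

end EllipticID

end

noncomputable section

namespace EllipticID

variable {d : ℕ} {Ω : Set (E d)}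

/-! ### The `L²` pairing of matrix fields -/

lemma isFiniteMeasure_vol (hΩb : Bornology.IsBounded Ω) : IsFiniteMeasure (vol Ω) :=
  ⟨by rw [Measure.restrict_apply_univ]; exact hΩb.measure_lt_top⟩

lemma integrable_pairing (hΩb : Bornology.IsBounded Ω) (P Q : LinfMat Ω) :
    Integrable (fun x => ∑ i, ∑ j, P i j x * Q i j x) (vol Ω) := by
  have := isFiniteMeasure_vol hΩb
  refine integrable_finsetSum _ fun i _ => integrable_finsetSum _ fun j _ => ?_
  exact ((Lp.memLp (P i j)).mono_exponent (p := 2) le_top).integrable_mul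
    ((Lp.memLp (Q i j)).mono_exponent (p := 2) le_top)

lemma normSqL2_nonneg (Q : LinfMat Ω) : 0 ≤ normSqL2 Q :=
  integral_nonneg fun _ => Finset.sum_nonneg fun _ _ => Finset.sum_nonneg fun _ _ =>
    mul_self_nonneg _

/-- The parallelogram law, which makes the penalty uniformly convex. -/
lemma normSqL2_midpoint (hΩb : Bornology.IsBounded Ω) (P Q : LinfMat Ω) :
    normSqL2 ((2⁻¹ : ℝ) • (P + Q)) + 4⁻¹ * normSqL2 (P - Q) =
      2⁻¹ * (normSqL2 P + normSqL2 Q) := by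
  simp only [normSqL2, pairing]
  rw [← integral_const_mul, ← integral_add (integrable_pairing hΩb P P)
    (integrable_pairing hΩb Q Q), ← integral_const_mul, ← integral_add (integrable_pairing hΩb _ _)
    ((integrable_pairing hΩb _ _).const_mul _)]
  refine integral_congr_ae ?_
  filter_upwards [ae_mat_add P Q, ae_mat_sub P Q, ae_mat_smul (2⁻¹ : ℝ) (P + Q)] with x h1 h2 h3
  simp only [h1, h2, h3, Finset.mul_sum, ← Finset.sum_add_distrib]
  exact Finset.sum_congr rfl fun i _ => Finset.sum_congr rfl fun j _ => by ring

/-- Expansion of the square around `P`. In the error estimate `P` is `Q†`, and the pairing on the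
right is what the source condition controls. -/
lemma normSqL2_sub_eq (hΩb : Bornology.IsBounded Ω) (P Q : LinfMat Ω) :
    normSqL2 P - normSqL2 Q + normSqL2 (Q - P) = 2 * pairing (P - Q) P := by
  rw [sub_add_eq_add_sub, sub_eq_iff_eq_add]
  simp only [normSqL2, pairing]
  rw [← integral_const_mul, ← integral_add (integrable_pairing hΩb P P)
    (integrable_pairing hΩb _ _),
    ← integral_add ((integrable_pairing hΩb _ _).const_mul _) (integrable_pairing hΩb _ _)]
  refine integral_congr_ae ?_
  filter_upwards [ae_mat_sub P Q, ae_mat_sub Q P] with x h1 h2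
  simp only [h1, h2, Finset.mul_sum, ← Finset.sum_add_distrib]
  exact Finset.sum_congr rfl fun i _ => Finset.sum_congr rfl fun j _ => by ring

lemma eq_of_normSqL2_sub_eq_zero (hΩb : Bornology.IsBounded Ω) {P Q : LinfMat Ω}
    (h : normSqL2 (P - Q) = 0) : P = Q := by
  rw [normSqL2, pairing, integral_eq_zero_iff_of_nonneg
    (fun x => Finset.sum_nonneg fun i _ => Finset.sum_nonneg fun j _ => mul_self_nonneg _)
    (integrable_pairing hΩb _ _)] at h
  funext i j
  refine Lp.ext ?_
  filter_upwards [h, ae_mat_sub P Q] with x hx h1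
  have h2 := (Finset.sum_eq_zero_iff_of_nonneg fun i _ => Finset.sum_nonneg fun j _ =>
    mul_self_nonneg ((P - Q) i j x)).1 hx i (Finset.mem_univ i)
  have h3 := (Finset.sum_eq_zero_iff_of_nonneg fun j _ =>
    mul_self_nonneg ((P - Q) i j x)).1 h2 j (Finset.mem_univ j)
  have h4 := mul_self_eq_zero.1 h3
  rw [h1] at h4
  linarith

/-! ### Convergence of admissible coefficients -/

section Convergence

variable {qlo qhi : ℝ} {Qn : ℕ → LinfMat Ω} {Q : LinfMat Ω}

lemma ae_abs_entry_le (hqlo : 0 < qlo) (hqhi : 0 < qhi) (hQ : Q ∈ Qad Ω qlo qhi) :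
    ∀ᵐ x ∂(vol Ω), ∀ i j, |Q i j x| ≤ 2 * qhi := by
  filter_upwards [hQ] with x hx i j
  exact abs_entry_le_of_mem_matK hqlo hqhi hx i j

/-- Dominated convergence: admissible coefficients are uniformly bounded, so a.e. convergence of the
entries suffices. Norm convergence in `L^∞` would not be available. -/
lemma tendsto_form (hqlo : 0 < qlo) (hqhi : 0 < qhi) (hQn : ∀ n, Qn n ∈ Qad Ω qlo qhi)
    (hlim : ∀ᵐ x ∂(vol Ω), ∀ i j, Filter.Tendsto (fun n => Qn n i j x) Filter.atTop (nhds (Q i j x)))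
    (u v : H10 Ω) :
    Filter.Tendsto (fun n => form (Qn n) u v) Filter.atTop (nhds (form Q u v)) := by
  refine tendsto_integral_of_dominated_convergence
    (fun x => ∑ _i : Fin d, ∑ _j : Fin d, 2 * qhi * (‖grad u x‖ * ‖grad v x‖))
    (fun n => (integrable_form _ _ _).1) ?_ (fun n => ?_) ?_
  · refine integrable_finsetSum _ fun i _ => integrable_finsetSum _ fun j _ => ?_
    exact ((Lp.memLp (grad u)).norm.integrable_mul (Lp.memLp (grad v)).norm).const_mul _
  · filter_upwards [ae_abs_entry_le hqlo hqhi (hQn n)] with x hx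
    refine (norm_sum_le _ _).trans (Finset.sum_le_sum fun i _ =>
      (norm_sum_le _ _).trans (Finset.sum_le_sum fun j _ => ?_))
    rw [Real.norm_eq_abs, abs_mul, abs_mul, mul_assoc]
    exact mul_le_mul (hx i j) (mul_le_mul (abs_coord_le _ _) (abs_coord_le _ _)
      (abs_nonneg _) (norm_nonneg _)) (by positivity) (by positivity)
  · filter_upwards [hlim] with x hx
    exact tendsto_finsetSum _ fun i _ => tendsto_finsetSum _ fun j _ =>
      ((hx i j).mul_const _).mul_const _

lemma tendsto_normSqL2 (hΩb : Bornology.IsBounded Ω) (hqlo : 0 < qlo) (hqhi : 0 < qhi)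
    (hQn : ∀ n, Qn n ∈ Qad Ω qlo qhi)
    (hlim : ∀ᵐ x ∂(vol Ω), ∀ i j,
      Filter.Tendsto (fun n => Qn n i j x) Filter.atTop (nhds (Q i j x))) :
    Filter.Tendsto (fun n => normSqL2 (Qn n)) Filter.atTop (nhds (normSqL2 Q)) := by
  have := isFiniteMeasure_vol hΩb
  refine tendsto_integral_of_dominated_convergence
    (fun x => ∑ _i : Fin d, ∑ _j : Fin d, 2 * qhi * (2 * qhi))
    (fun n => (integrable_pairing hΩb _ _).1) (integrable_const _) (fun n => ?_) ?_
  · filter_upwards [ae_abs_entry_le hqlo hqhi (hQn n)] with x hx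
    refine (norm_sum_le _ _).trans (Finset.sum_le_sum fun i _ =>
      (norm_sum_le _ _).trans (Finset.sum_le_sum fun j _ => ?_))
    rw [Real.norm_eq_abs, abs_mul]
    exact mul_le_mul (hx i j) (hx i j) (abs_nonneg _) (by positivity)
  · filter_upwards [hlim] with x hx
    exact tendsto_finsetSum _ fun i _ => tendsto_finsetSum _ fun j _ => (hx i j).mul (hx i j)

lemma memLp_mat (hΩb : Bornology.IsBounded Ω) (Q : LinfMat Ω) :
    MemLp (fun x => (WithLp.toLp 2 fun ij : Fin d × Fin d => Q ij.1 ij.2 x :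
      EuclideanSpace ℝ (Fin d × Fin d))) 2 (vol Ω) := by
  have := isFiniteMeasure_vol hΩb
  refine MemLp.of_eval_piLp fun ij => ?_
  exact (Lp.memLp (Q ij.1 ij.2)).mono_exponent le_top

/-- A sequence of admissible coefficients that is Cauchy in `L²` has a subsequence converging
almost everywhere to an admissible coefficient. -/
lemma exists_subseq_tendsto_ae (hΩb : Bornology.IsBounded Ω) (hqlo : 0 < qlo) (hqhi : 0 < qhi)
    (hQn : ∀ n, Qn n ∈ Qad Ω qlo qhi) {b : ℕ → ℝ} (hb : Filter.Tendsto b Filter.atTop (nhds 0))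
    (hcauchy : ∀ n m N, N ≤ n → N ≤ m → normSqL2 (Qn n - Qn m) ≤ b N) :
    ∃ Q ∈ Qad Ω qlo qhi, ∃ ns : ℕ → ℕ, StrictMono ns ∧ ∀ᵐ x ∂(vol Ω), ∀ i j,
      Filter.Tendsto (fun n => Qn (ns n) i j x) Filter.atTop (nhds (Q i j x)) := by
  -- Matrix fields become single vector-valued `L²` functions whose distances are given by
  -- `normSqL2`, so completeness of `L²` applies.
  set G : ℕ → Lp (EuclideanSpace ℝ (Fin d × Fin d)) 2 (vol Ω) := fun n =>
    (memLp_mat hΩb (Qn n)).toLp _ with hG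
  have hGx : ∀ n, ∀ᵐ x ∂(vol Ω), ∀ i j, G n x (i, j) = Qn n i j x := fun n => by
    filter_upwards [(memLp_mat hΩb (Qn n)).coeFn_toLp] with x hx i j
    rw [hG]; simp only [hx]
  have hdist : ∀ n m, ‖G n - G m‖ ^ 2 = normSqL2 (Qn n - Qn m) := by
    intro n m
    rw [norm_sq_eq_integral]
    refine integral_congr_ae ?_
    filter_upwards [Lp.coeFn_sub (G n) (G m), hGx n, hGx m, ae_mat_sub (Qn n) (Qn m)]
      with x h1 h2 h3 h4
    rw [h1, EuclideanSpace.norm_sq_eq, Fintype.sum_prod_type]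
    refine Finset.sum_congr rfl fun i _ => Finset.sum_congr rfl fun j _ => ?_
    rw [h4, Pi.sub_apply, PiLp.sub_apply, h2, h3, Real.norm_eq_abs, sq_abs, sq]
  have hC : CauchySeq G := by
    refine cauchySeq_of_le_tendsto_0 (fun N => Real.sqrt (b N)) (fun n m N hn hm => ?_) ?_
    · rw [dist_eq_norm]
      exact Real.le_sqrt_of_sq_le ((hdist n m).trans_le (hcauchy n m N hn hm))
    · have := (Real.continuous_sqrt.tendsto 0).comp hb
      rwa [Real.sqrt_zero] at this
  obtain ⟨g, hg⟩ := cauchySeq_tendsto_of_complete hC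
  obtain ⟨ns, hns, hae⟩ := (tendstoInMeasure_of_tendsto_Lp hg).exists_seq_tendsto_ae
  have hentry : ∀ᵐ x ∂(vol Ω), ∀ i j,
      Filter.Tendsto (fun n => Qn (ns n) i j x) Filter.atTop (nhds (g x (i, j))) := by
    filter_upwards [hae, ae_all_iff.2 hGx] with x hx h i j
    have := ((EuclideanSpace.proj (𝕜 := ℝ) (i, j)).continuous.tendsto _).comp hx
    refine this.congr fun n => ?_
    exact h (ns n) i j
  -- The pointwise constraint set is closed, hence inherited by the limit; its entrywise bound then
  -- puts the limit back into `L^∞`.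
  have hgK : ∀ᵐ x ∂(vol Ω), Matrix.of (fun i j => g x (i, j)) ∈ matK d qlo qhi := by
    filter_upwards [hentry, ae_all_iff.2 hQn] with x hx hK
    refine (isClosed_matK qlo qhi).mem_of_tendsto (b := Filter.atTop)
      (f := fun n => Matrix.of fun i j => Qn (ns n) i j x) ?_
      (Filter.Eventually.of_forall fun n => hK (ns n))
    exact tendsto_pi_nhds.2 fun i => tendsto_pi_nhds.2 fun j => hx i j
  have hmem : ∀ i j, MemLp (fun x => g x (i, j)) ∞ (vol Ω) := by
    intro i j
    refine memLp_top_of_bound ?_ (2 * qhi) ?_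
    · exact (EuclideanSpace.proj (𝕜 := ℝ) (i, j)).continuous.comp_aestronglyMeasurable
        (Lp.memLp g).1
    · filter_upwards [hgK] with x hx
      exact abs_entry_le_of_mem_matK hqlo hqhi hx i j
  have hQx : ∀ᵐ x ∂(vol Ω), ∀ i j, (hmem i j).toLp _ x = g x (i, j) :=
    ae_all_iff.2 fun i => ae_all_iff.2 fun j => (hmem i j).coeFn_toLp
  refine ⟨fun i j => (hmem i j).toLp _, ?_, ns, hns, ?_⟩
  · show ∀ᵐ x ∂(vol Ω), _
    filter_upwards [hgK, hQx] with x hx h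
    simpa only [h] using hx
  · filter_upwards [hentry, hQx] with x hx h i j
    rw [h]; exact hx i j

end Convergence

/-! ### The discrete regularized problem -/

section Discrete

variable {qlo qhi κ : ℝ} {K : Mesh d} [CompleteSpace (Vh Ω K)] {f : L2 Ω} {z : H10 Ω}
  {P Q : LinfMat Ω}

lemma form_self_nonneg (hqlo : 0 < qlo) (hQ : Q ∈ Qad Ω qlo qhi) (u : H10 Ω) : 0 ≤ form Q u u :=
  le_trans (by positivity) (le_form_self_of_mem_Qad hQ u)

/-- Expand the square: `U_h(Q)` and `Π_h z` both lie in `V_h`, so the Galerkin equation evaluates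
the mixed terms. Writing `2 ∫ f u - ∫ Q ∇u · ∇u` instead of `∫ f u` exhibits an expression affine in
`Q` for fixed `u`. -/
lemma discCost_eq (hκ : IsCoercivityConst Ω qlo κ) (hQ : Q ∈ Qad Ω qlo qhi)
    (hz : clement K z ∈ Vh Ω K) :
    discCost K f z Q = 2 * load f (discSolOp K f Q) - form Q (discSolOp K f Q) (discSolOp K f Q) -
      2 * load f (clement K z) + form Q (clement K z) (clement K z) := by
  obtain ⟨hu, hspec⟩ := discSolOp_spec (K := K) (f := f) (hκ.isCoercive hQ)
  rw [discCost, form_sub_left, form_sub_right, form_sub_right, hspec _ hu, hspec _ hz,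
    form_symm_of_mem_Qad hQ (clement K z), hspec _ hz]
  ring

/-- The discrete cost is a supremum of functions that are affine in the coefficient. -/
lemma le_discCost (hqlo : 0 < qlo) (hκ : IsCoercivityConst Ω qlo κ) (hQ : Q ∈ Qad Ω qlo qhi)
    (hz : clement K z ∈ Vh Ω K) {v : H10 Ω} (hv : v ∈ Vh Ω K) :
    2 * load f v - form Q v v - 2 * load f (clement K z) + form Q (clement K z) (clement K z) ≤
      discCost K f z Q := by
  obtain ⟨hu, hspec⟩ := discSolOp_spec (K := K) (f := f) (hκ.isCoercive hQ)
  -- The gap in the claim is exactly this energy of `U_h(Q) - v`.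
  have h := form_self_nonneg hqlo hQ (discSolOp K f Q - v)
  rw [form_sub_left, form_sub_right, form_sub_right, hspec _ hu, hspec _ hv,
    form_symm_of_mem_Qad hQ v, hspec _ hv] at h
  rw [discCost_eq hκ hQ hz, hspec _ hu]
  linarith

/-- The affine minorant attached to the discrete solution at the midpoint touches the cost there and
lies below it at `P` and `Q`. -/
lemma discCost_midpoint_le (hqlo : 0 < qlo) (hκ : IsCoercivityConst Ω qlo κ)
    (hP : P ∈ Qad Ω qlo qhi) (hQ : Q ∈ Qad Ω qlo qhi) (hz : clement K z ∈ Vh Ω K) :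
    discCost K f z ((2⁻¹ : ℝ) • (P + Q)) ≤ 2⁻¹ * (discCost K f z P + discCost K f z Q) := by
  have hM := Qad_midpoint hP hQ
  obtain ⟨hv, -⟩ := discSolOp_spec (K := K) (f := f) (hκ.isCoercive hM)
  have h1 := le_discCost (f := f) hqlo hκ hP hz hv
  have h2 := le_discCost (f := f) hqlo hκ hQ hz hv
  rw [discCost_eq hκ hM hz]
  simp only [form_smul_coeff, form_add_coeff] at *
  linarith

/-- At the midpoint the functional drops below the average of its values by at least `ρ / 4` times
the squared distance, yet stays above `m`. -/
lemma normSqL2_sub_le_of_near_min (hΩb : Bornology.IsBounded Ω) (hqlo : 0 < qlo)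
    (hκ : IsCoercivityConst Ω qlo κ) (hz : clement K z ∈ Vh Ω K) {ρ m ε : ℝ} (hρ : 0 < ρ)
    (hm : ∀ Q ∈ Qad Ω qlo qhi, m ≤ discCost K f z Q + ρ * normSqL2 Q)
    (hP : P ∈ Qad Ω qlo qhi) (hQ : Q ∈ Qad Ω qlo qhi)
    (hPm : discCost K f z P + ρ * normSqL2 P ≤ m + ε)
    (hQm : discCost K f z Q + ρ * normSqL2 Q ≤ m + ε) : normSqL2 (P - Q) ≤ 4 / ρ * ε := by
  have h1 := hm _ (Qad_midpoint hP hQ)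
  have h2 := discCost_midpoint_le (f := f) hqlo hκ hP hQ hz
  have h3 : ρ * (normSqL2 ((2⁻¹ : ℝ) • (P + Q)) + 4⁻¹ * normSqL2 (P - Q)) =
      ρ * (2⁻¹ * (normSqL2 P + normSqL2 Q)) := by rw [normSqL2_midpoint hΩb P Q]
  rw [div_mul_eq_mul_div, le_div_iff₀ hρ]
  nlinarith

/-- The regularized discrete problem has exactly one solution. -/
lemma existsUnique_isDiscRegSol (hΩb : Bornology.IsBounded Ω) (hqlo : 0 < qlo) (hqhi : 0 < qhi)
    (hκ : IsCoercivityConst Ω qlo κ) (hz : clement K z ∈ Vh Ω K) (hne : (Qad Ω qlo qhi).Nonempty)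
    {ρ : ℝ} (hρ : 0 < ρ) : ∃! Q, IsDiscRegSol qlo qhi K f z ρ Q := by
  set I : LinfMat Ω → ℝ := fun Q => discCost K f z Q + ρ * normSqL2 Q with hI
  have hI0 : ∀ Q ∈ Qad Ω qlo qhi, 0 ≤ I Q := fun Q hQ =>
    add_nonneg (form_self_nonneg hqlo hQ _) (mul_nonneg hρ.le (normSqL2_nonneg Q))
  have hbdd : BddBelow (I '' Qad Ω qlo qhi) := ⟨0, by rintro _ ⟨Q, hQ, rfl⟩; exact hI0 Q hQ⟩
  set m := sInf (I '' Qad Ω qlo qhi) with hmdef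
  have hm : ∀ Q ∈ Qad Ω qlo qhi, m ≤ I Q := fun Q hQ => csInf_le hbdd ⟨Q, hQ, rfl⟩
  have hseq : ∀ n : ℕ, ∃ Q ∈ Qad Ω qlo qhi, I Q ≤ m + 1 / ((n : ℝ) + 1) := by
    intro n
    obtain ⟨_, ⟨Q, hQ, rfl⟩, h⟩ := exists_lt_of_csInf_lt (hne.image I)
      (show sInf (I '' Qad Ω qlo qhi) < m + 1 / ((n : ℝ) + 1) from
        lt_add_of_pos_right m (by positivity))
    exact ⟨Q, hQ, h.le⟩
  choose Qn hQn hQnm using hseq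
  have hmono : ∀ {n N : ℕ}, N ≤ n → I (Qn n) ≤ m + 1 / ((N : ℝ) + 1) := fun {n N} h =>
    (hQnm n).trans (by gcongr)
  have hb : Filter.Tendsto (fun N : ℕ => 4 / ρ * (1 / ((N : ℝ) + 1))) Filter.atTop (nhds 0) := by
    simpa using (tendsto_one_div_add_atTop_nhds_zero_nat (𝕜 := ℝ)).const_mul (4 / ρ)
  obtain ⟨Q, hQ, ns, hns, hlim⟩ := exists_subseq_tendsto_ae hΩb hqlo hqhi hQn hb
    fun n k N hn hk => normSqL2_sub_le_of_near_min hΩb hqlo hκ hz hρ hm (hQn n) (hQn k)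
      (hmono hn) (hmono hk)
  have hQns : ∀ n, Qn (ns n) ∈ Qad Ω qlo qhi := fun n => hQn (ns n)
  -- Lower semicontinuity: `v` is frozen at the discrete solution for the limit coefficient. Its
  -- affine minorant converges to `I Q` and lies below the near-minimal values, so no convergence of
  -- the discrete states is needed.
  have hQmin : I Q ≤ m := by
    obtain ⟨hv, -⟩ := discSolOp_spec (K := K) (f := f) (hκ.isCoercive hQ)
    set v := discSolOp K f Q
    have t1 := tendsto_form hqlo hqhi hQns hlim v v
    have t2 := tendsto_form hqlo hqhi hQns hlim (clement K z) (clement K z)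
    have t3 := tendsto_normSqL2 hΩb hqlo hqhi hQns hlim
    have hl : Filter.Tendsto (fun n => 2 * load f v - form (Qn (ns n)) v v -
        2 * load f (clement K z) + form (Qn (ns n)) (clement K z) (clement K z) +
        ρ * normSqL2 (Qn (ns n))) Filter.atTop (nhds (I Q)) := by
      rw [hI]
      simp only
      rw [discCost_eq hκ hQ hz]
      exact (((tendsto_const_nhds.sub t1).sub tendsto_const_nhds).add t2).add (t3.const_mul ρ)
    have hr : Filter.Tendsto (fun n : ℕ => m + 1 / ((n : ℝ) + 1)) Filter.atTop (nhds m) := by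
      simpa using (tendsto_one_div_add_atTop_nhds_zero_nat (𝕜 := ℝ)).const_add m
    refine le_of_tendsto_of_tendsto' hl hr fun n => ?_
    refine le_trans ?_ (hmono hns.le_apply)
    exact add_le_add (le_discCost hqlo hκ (hQns n) hz hv) le_rfl
  refine ⟨Q, ⟨hQ, fun Q' hQ' => hQmin.trans (hm Q' hQ')⟩, fun P hP => ?_⟩
  have hPm : I P ≤ m := (hP.2 Q hQ).trans hQmin
  refine eq_of_normSqL2_sub_eq_zero hΩb (le_antisymm ?_ (normSqL2_nonneg _))
  -- Two exact minimizers are near-minimizers with `ε = 0`, hence at distance zero.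
  simpa using normSqL2_sub_le_of_near_min (ε := 0) hΩb hqlo hκ hz hρ hm hP.1 hQ
    (by simpa using hPm) (by simpa using hQmin)

end Discrete

end EllipticID

end

noncomputable section

namespace EllipticID

variable {d : ℕ} {Ω : Set (E d)} {K : Mesh d}

/-! ### Barycentric coordinates on the simplices of a mesh -/

lemma affineMap_sum_smul (p : E d →ᵃ[ℝ] ℝ) {s : Finset (E d)} {l : E d → ℝ}
    (hl : ∑ y ∈ s, l y = 1) : p (∑ y ∈ s, l y • y) = ∑ y ∈ s, l y * p y := by
  have h : ∀ x, p x = p.linear x + p 0 := fun x => by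
    have := p.map_vadd 0 x
    simpa using this
  have h' : ∀ y ∈ s, l y * p y = l y * p.linear y + l y * p 0 := fun y _ => by
    rw [h y, mul_add]
  rw [Finset.sum_congr rfl h', Finset.sum_add_distrib, ← Finset.sum_mul, hl, one_mul, h, map_sum]
  simp only [map_smul, smul_eq_mul]

lemma weights_unique {s : Finset (E d)} (hs : AffineIndependent ℝ ((↑) : s → E d))
    {l m : E d → ℝ} (hlm : ∑ y ∈ s, l y = ∑ y ∈ s, m y)
    (h : ∑ y ∈ s, l y • y = ∑ y ∈ s, m y • y) : ∀ y ∈ s, l y = m y := by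
  intro y hy
  have := affineIndependent_iff.1 hs Finset.univ (fun v => l v - m v)
    (by rw [Finset.sum_coe_sort s fun v => l v - m v, Finset.sum_sub_distrib, hlm, sub_self])
    (by
      rw [Finset.sum_coe_sort s fun v => (l v - m v) • v]
      simp_rw [sub_smul]
      rw [Finset.sum_sub_distrib, h, sub_self]) ⟨y, hy⟩ (Finset.mem_univ _)
  simpa [sub_eq_zero] using this

open Classical in
lemma sum_ite_mem_of_subset {M : Type*} [AddCommMonoid M] [Module ℝ M] {s u : Finset (E d)}
    (hu : u ⊆ s) (m : E d → ℝ) (F : E d → M) :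
    ∑ y ∈ s, (if y ∈ u then m y else 0) • F y = ∑ y ∈ u, m y • F y := by
  rw [← Finset.sum_subset hu (f := fun y => (if y ∈ u then m y else 0) • F y)]
  · exact Finset.sum_congr rfl fun y hy => by rw [if_pos hy]
  · intro y _ hy; simp [hy]

-- Barycentric weights of a point carried by a face are those of the face, extended by zero to the
-- remaining vertices.
open Classical in
lemma weights_eq_of_subset {s u : Finset (E d)} (hs : AffineIndependent ℝ ((↑) : s → E d))
    (hu : u ⊆ s) {l m : E d → ℝ} (hl : ∑ y ∈ s, l y = 1) (hm : ∑ y ∈ u, m y = 1)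
    (h : ∑ y ∈ s, l y • y = ∑ y ∈ u, m y • y) : ∀ y ∈ s, l y = if y ∈ u then m y else 0 := by
  refine weights_unique hs ?_ ?_
  · have := sum_ite_mem_of_subset hu m (fun _ => (1 : ℝ))
    simp only [smul_eq_mul, mul_one] at this
    rw [this, hl, hm]
  · rw [sum_ite_mem_of_subset hu m (fun y => y), h]

/-- Conformity places a point shared by two simplices in the hull of their common vertices. -/
lemma exists_weights_inter {s t : Finset (E d)} (hs : s ∈ K.faces) (ht : t ∈ K.faces) {x : E d}
    (hxs : x ∈ convexHull ℝ (s : Set (E d))) (hxt : x ∈ convexHull ℝ (t : Set (E d))) :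
    ∃ u : Finset (E d), u ⊆ s ∧ u ⊆ t ∧ ∃ n : E d → ℝ, ∑ y ∈ u, n y = 1 ∧ ∑ y ∈ u, n y • y = x := by
  classical
  have h := K.inter_subset_convexHull hs ht ⟨hxs, hxt⟩
  rw [← Finset.coe_inter, Finset.mem_convexHull'] at h
  obtain ⟨n, -, h1, h2⟩ := h
  exact ⟨s ∩ t, Finset.inter_subset_left, Finset.inter_subset_right, n, h1, h2⟩

/-- The nodal interpolant in barycentric coordinates of any simplex. -/
lemma nodalInterp_eq_sum {s : Finset (E d)} (hs : s ∈ K.faces) {l : E d → ℝ}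
    (hl0 : ∀ y ∈ s, 0 ≤ l y) (hl : ∑ y ∈ s, l y = 1) (c : E d → ℝ) :
    nodalInterp K c (∑ y ∈ s, l y • y) = ∑ y ∈ s, l y * c y := by
  classical
  set x := ∑ y ∈ s, l y • y with hx
  have hex : ∃ p : Finset (E d) × (E d → ℝ), p.1 ∈ K.faces ∧ (∀ y ∈ p.1, 0 ≤ p.2 y) ∧
      ∑ y ∈ p.1, p.2 y = 1 ∧ ∑ y ∈ p.1, p.2 y • y = x := ⟨(s, l), hs, hl0, hl, rfl⟩
  rw [nodalInterp, dif_pos hex]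
  obtain ⟨ht, hm0, hm, hmx⟩ := hex.choose_spec
  set t := hex.choose.1
  set m := hex.choose.2
  have hxs : x ∈ convexHull ℝ (s : Set (E d)) := (Finset.mem_convexHull').2 ⟨l, hl0, hl, rfl⟩
  have hxt : x ∈ convexHull ℝ (t : Set (E d)) := (Finset.mem_convexHull').2 ⟨m, hm0, hm, hmx⟩
  -- The chosen representation and the given one both reduce to weights on a common face, so they
  -- yield the same value.
  obtain ⟨u, hus, hut, n, hn, hnx⟩ := exists_weights_inter hs ht hxs hxt
  have e1 := weights_eq_of_subset (K.indep hs) hus hl hn (hx.symm.trans hnx.symm)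
  have e2 := weights_eq_of_subset (K.indep ht) hut hm hn (hmx.trans hnx.symm)
  have f1 := sum_ite_mem_of_subset hus n c
  have f2 := sum_ite_mem_of_subset hut n c
  simp only [smul_eq_mul] at f1 f2
  calc ∑ y ∈ t, m y * c y = ∑ y ∈ t, (if y ∈ u then n y else 0) * c y :=
        Finset.sum_congr rfl fun y hy => by rw [e2 y hy]
    _ = ∑ y ∈ s, (if y ∈ u then n y else 0) * c y := f2.trans f1.symm
    _ = ∑ y ∈ s, l y * c y := Finset.sum_congr rfl fun y hy => by rw [e1 y hy]

lemma nodalInterp_of_notMem_space (c : E d → ℝ) {x : E d} (hx : x ∉ K.space) :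
    nodalInterp K c x = 0 := by
  classical
  rw [nodalInterp, dif_neg]
  rintro ⟨⟨s, l⟩, hs, h0, h1, h2⟩
  exact hx (K.mem_space_iff.2 ⟨s, hs, (Finset.mem_convexHull').2 ⟨l, h0, h1, h2⟩⟩)

/-- The chosen barycentric representation of `x` does not involve the nodal values, so linearity is
immediate. -/
lemma nodalInterp_add (c c' : E d → ℝ) (x : E d) :
    nodalInterp K (fun a => c a + c' a) x = nodalInterp K c x + nodalInterp K c' x := by
  classical
  unfold nodalInterp
  split
  · simp only [mul_add, Finset.sum_add_distrib]
  · simp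

lemma nodalInterp_smul (r : ℝ) (c : E d → ℝ) (x : E d) :
    nodalInterp K (fun a => r * c a) x = r * nodalInterp K c x := by
  classical
  unfold nodalInterp
  split
  · rw [Finset.mul_sum]; exact Finset.sum_congr rfl fun y _ => by ring
  · simp

/-! ### Cells -/

/-- The vertices of a cell, as an affine basis. -/
def cellBasis {s : Finset (E d)} (hs : s ∈ cells K) : AffineBasis s ℝ (E d) where
  toFun := (↑)
  ind' := K.indep hs.1
  tot' := by
    rw [(K.indep hs.1).affineSpan_eq_top_iff_card_eq_finrank_add_one]
    simp [hs.2]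

/-- On every cell, the nodal interpolant agrees with an affine function. -/
lemma exists_affine_eqOn {s : Finset (E d)} (hs : s ∈ cells K) (c : E d → ℝ) :
    ∃ p : E d →ᵃ[ℝ] ℝ, (∀ y ∈ s, p y = c y) ∧
      Set.EqOn (nodalInterp K c) p (convexHull ℝ (s : Set (E d))) := by
  classical
  have hp : ∃ p : E d →ᵃ[ℝ] ℝ, ∀ y ∈ s, p y = c y := by
    refine ⟨∑ v : s, c v • (cellBasis hs).coord v, fun y hy => ?_⟩
    have e : y = cellBasis hs ⟨y, hy⟩ := rfl
    have : ∀ (F : s → E d →ᵃ[ℝ] ℝ) (x : E d), (∑ v, F v) x = ∑ v, F v x := fun F x => by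
      induction (Finset.univ : Finset s) using Finset.induction_on with
      | empty => simp
      | insert a t ha ih => rw [Finset.sum_insert ha, Finset.sum_insert ha, ← ih]; rfl
    rw [this]
    conv_lhs => rw [e]
    simp [AffineBasis.coord_apply]
  obtain ⟨p, hp⟩ := hp
  refine ⟨p, hp, fun x hx => ?_⟩
  obtain ⟨l, h0, h1, rfl⟩ := (Finset.mem_convexHull').1 hx
  rw [nodalInterp_eq_sum hs.1 h0 h1, affineMap_sum_smul p h1]
  exact Finset.sum_congr rfl fun y hy => by rw [hp y hy]

/-- At most `d` points span a proper affine subspace, which is null. -/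
lemma volume_convexHull_eq_zero {u : Finset (E d)} (hu : u.card ≤ d) :
    volume (convexHull ℝ (u : Set (E d))) = 0 := by
  classical
  rcases Nat.eq_zero_or_eq_succ_pred u.card with h0 | h0
  · rw [Finset.card_eq_zero.1 h0]; simp
  · refine measure_mono_null (convexHull_subset_affineSpan _)
      (Measure.addHaar_affineSubspace _ _ fun htop => ?_)
    have h1 := finrank_vectorSpan_image_finset_le ℝ (id : E d → E d) u h0
    rw [Finset.image_id] at h1
    have h2 : vectorSpan ℝ (u : Set (E d)) = ⊤ := by
      rw [← direction_affineSpan, htop, AffineSubspace.direction_top]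
    rw [h2, finrank_top, finrank_euclideanSpace_fin] at h1
    omega

/-- Two different cells share at most `d` vertices, so their intersection has lower dimension. -/
lemma volume_inter_cells_eq_zero {s t : Finset (E d)} (hs : s ∈ cells K) (ht : t ∈ cells K)
    (hst : s ≠ t) :
    volume (convexHull ℝ (s : Set (E d)) ∩ convexHull ℝ (t : Set (E d))) = 0 := by
  classical
  refine measure_mono_null (K.inter_subset_convexHull hs.1 ht.1) ?_
  rw [← Finset.coe_inter]
  refine volume_convexHull_eq_zero ?_
  have h1 : s ∩ t ≠ s := fun h => hst
    (Finset.eq_of_subset_of_card_le (Finset.inter_eq_left.1 h) (by rw [hs.2, ht.2]))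
  have := Finset.card_lt_card (Finset.inter_subset_left.ssubset_of_ne h1)
  rw [hs.2] at this
  omega

lemma IsTriangulation.finite_cells (hK : IsTriangulation Ω K) : (cells K).Finite :=
  hK.1.subset fun _ h => h.1

lemma isClosed_biUnion_cells (hK : IsTriangulation Ω K) :
    IsClosed (⋃ s ∈ cells K, convexHull ℝ (s : Set (E d))) :=
  hK.finite_cells.isClosed_biUnion fun s _ =>
    (s.finite_toSet.isCompact_convexHull (𝕜 := ℝ)).isClosed

/-- The cells cover the triangulated set. -/
lemma closure_subset_biUnion_cells (hΩo : IsOpen Ω) (hK : IsTriangulation Ω K) :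
    closure Ω ⊆ ⋃ s ∈ cells K, convexHull ℝ (s : Set (E d)) := by
  refine closure_minimal ?_ (isClosed_biUnion_cells hK)
  set C := ⋃ s ∈ cells K, convexHull ℝ (s : Set (E d)) with hC
  -- The uncovered part of `Ω` is open and lies in finitely many lower-dimensional simplices. An
  -- open null set is empty.
  have hopen : IsOpen (Ω \ C) := hΩo.sdiff (isClosed_biUnion_cells hK)
  have hsub : Ω \ C ⊆ ⋃ s ∈ K.faces \ cells K, convexHull ℝ (s : Set (E d)) := by
    rintro x ⟨hx, hxC⟩
    have : x ∈ K.space := hK.2.1 ▸ subset_closure hx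
    obtain ⟨s, hs, hxs⟩ := K.mem_space_iff.1 this
    exact Set.mem_biUnion (⟨hs, fun h => hxC (Set.mem_biUnion h hxs)⟩ : s ∈ K.faces \ cells K) hxs
  have hnull : volume (⋃ s ∈ K.faces \ cells K, convexHull ℝ (s : Set (E d))) = 0 := by
    refine (measure_biUnion_null_iff (hK.1.subset Set.sdiff_subset).countable).2 fun s hs => ?_
    refine volume_convexHull_eq_zero ?_
    have h1 := (K.indep hs.1).card_le_finrank_succ
    have h2 : Module.finrank ℝ (vectorSpan ℝ (Set.range ((↑) : s → E d))) ≤ d := by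
      simpa using Submodule.finrank_le (vectorSpan ℝ (Set.range ((↑) : s → E d)))
    rw [Fintype.card_coe] at h1
    have h3 : s.card ≠ d + 1 := fun h => hs.2 ⟨hs.1, h⟩
    omega
  have := (hopen.measure_eq_zero_iff volume).1 (measure_mono_null hsub hnull)
  exact Set.sdiff_eq_empty.1 this

lemma subset_biUnion_cells (hΩo : IsOpen Ω) (hK : IsTriangulation Ω K) :
    Ω ⊆ ⋃ s ∈ cells K, convexHull ℝ (s : Set (E d)) :=
  subset_closure.trans (closure_subset_biUnion_cells hΩo hK)

lemma convexHull_subset_closure (hK : IsTriangulation Ω K) {s : Finset (E d)} (hs : s ∈ K.faces) :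
    convexHull ℝ (s : Set (E d)) ⊆ closure Ω :=
  hK.2.1 ▸ K.convexHull_subset_space hs

lemma interior_convexHull_subset (hK : IsTriangulation Ω K) {s : Finset (E d)} (hs : s ∈ K.faces) :
    interior (convexHull ℝ (s : Set (E d))) ⊆ Ω := by
  rw [← hK.2.2]
  exact interior_mono (K.convexHull_subset_space hs)

/-! ### The boundary -/

/-- The open star of an interior vertex lies in the domain. -/
lemma mem_of_open_star (hΩo : IsOpen Ω) (hK : IsTriangulation Ω K) {s : Finset (E d)}
    (hs : s ∈ K.faces) {l : E d → ℝ} (hl0 : ∀ y ∈ s, 0 < l y) (hl : ∑ y ∈ s, l y = 1) {b : E d}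
    (hb : b ∈ s) (hbΩ : b ∈ Ω) : ∑ y ∈ s, l y • y ∈ Ω := by
  classical
  set x := ∑ y ∈ s, l y • y with hx
  have hcomb : ∀ e : ℝ, ∑ y ∈ s, ((1 - e) * (if y = b then 1 else 0) + e * l y) = 1 ∧
      ∑ y ∈ s, ((1 - e) * (if y = b then 1 else 0) + e * l y) • y = b + e • (x - b) := by
    intro e
    constructor
    · rw [Finset.sum_add_distrib, ← Finset.mul_sum, ← Finset.mul_sum, hl]; simp [hb]
    · simp_rw [add_smul, mul_smul]
      rw [Finset.sum_add_distrib, ← Finset.smul_sum, ← Finset.smul_sum, ← hx]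
      simp only [ite_smul, one_smul, zero_smul, Finset.sum_ite_eq', hb, if_true]
      module
  -- A point `y` on the segment from `b` to `x`, so close to `b` that it lies in `Ω`. It still has
  -- positive weight at every vertex of `s`.
  obtain ⟨ε, hε0, hε1, hεΩ⟩ : ∃ ε : ℝ, 0 < ε ∧ ε < 1 ∧ b + ε • (x - b) ∈ Ω := by
    have hc : Continuous fun e : ℝ => b + e • (x - b) := by fun_prop
    have h1 : ∀ᶠ e in nhds (0 : ℝ), b + e • (x - b) ∈ Ω :=
      hc.continuousAt.eventually_mem (by simpa using hΩo.mem_nhds hbΩ)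
    have h2 : ∀ᶠ e in nhdsWithin (0 : ℝ) (Set.Ioi 0), e ∈ Set.Ioo (0 : ℝ) 1 :=
      Ioo_mem_nhdsGT one_pos
    obtain ⟨e, he, he'⟩ := ((h1.filter_mono nhdsWithin_le_nhds).and h2).exists
    exact ⟨e, he'.1, he'.2, he⟩
  set y := b + ε • (x - b) with hy
  set F := {t ∈ cells K | y ∉ convexHull ℝ (t : Set (E d))} with hF
  set W := Ω ∩ ⋂ t ∈ F, (convexHull ℝ (t : Set (E d)))ᶜ with hW
  have hWo : IsOpen W := by
    refine hΩo.inter ((hK.finite_cells.subset fun t ht => ht.1).isOpen_biInter fun t _ => ?_)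
    exact (t.finite_toSet.isCompact_convexHull (𝕜 := ℝ)).isClosed.isOpen_compl
  have hyW : y ∈ W := ⟨hεΩ, Set.mem_iInter₂.2 fun t ht => ht.2⟩
  have hys : y ∈ convexHull ℝ (s : Set (E d)) := by
    refine (Finset.mem_convexHull').2 ⟨_, fun v hv => ?_, (hcomb ε).1, (hcomb ε).2⟩
    have := (hl0 v hv).le
    split <;> nlinarith
  -- A cell meeting `W` must contain `y`, and then all vertices of `s`, because `y` has positive
  -- weights on all of them.
  have hWs : ∀ w ∈ W, ∃ t ∈ cells K, w ∈ convexHull ℝ (t : Set (E d)) ∧ s ⊆ t := by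
    rintro w ⟨hwΩ, hwF⟩
    obtain ⟨t, ht, hwt⟩ := Set.mem_iUnion₂.1 (subset_biUnion_cells hΩo hK hwΩ)
    refine ⟨t, ht, hwt, fun v hv => ?_⟩
    have hyt : y ∈ convexHull ℝ (t : Set (E d)) := by
      by_contra h
      exact Set.mem_iInter₂.1 hwF t ⟨ht, h⟩ hwt
    obtain ⟨u, hus, hut, n, hn, hny⟩ := exists_weights_inter hs ht.1 hys hyt
    have := weights_eq_of_subset (K.indep hs) hus (hcomb ε).1 hn ((hcomb ε).2.trans hny.symm) v hv
    by_contra hvt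
    rw [if_neg fun h => hvt (hut h)] at this
    have hp : 0 < ε * l v := mul_pos hε0 (hl0 v hv)
    have hq : 0 ≤ (1 - ε) * (if v = b then 1 else 0) := by
      split <;> nlinarith
    linarith
  -- The point `z` lies beyond `x` on the ray from `b`. With overshoot `l b`, the weight of `b` in
  -- `z` is `(l b)²`, so `z` remains in `s`.
  set η := l b with hη
  have hη0 : 0 < η := hl0 b hb
  set z := b + (1 + η) • (x - b) with hz
  have hzs : z ∈ convexHull ℝ (s : Set (E d)) := by
    refine (Finset.mem_convexHull').2 ⟨_, fun v hv => ?_, (hcomb (1 + η)).1, (hcomb (1 + η)).2⟩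
    have := (hl0 v hv).le
    split
    · next h => rw [h, ← hη]; nlinarith
    · nlinarith
  set D := η + 1 - ε with hD
  have hD0 : 0 < D := by linarith
  -- Each `w ∈ W` lies in a cell that also contains `z`, so the contraction toward `z` taking `y` to
  -- `x` maps `W` into the triangulated set. The image of `W` is an open neighbourhood of `x`.
  have hmem : ∀ w ∈ W, (η / D) • w + ((1 - ε) / D) • z ∈ K.space := by
    intro w hw
    obtain ⟨t, ht, hwt, hst⟩ := hWs w hw
    refine K.convexHull_subset_space ht.1 ?_
    refine (convex_convexHull ℝ _) hwt (convexHull_mono (Finset.coe_subset.2 hst) hzs)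
      (by positivity) (div_nonneg (by linarith) hD0.le) ?_
    rw [← add_div, div_eq_one_iff_eq hD0.ne', hD]; ring
  rw [← hK.2.2, mem_interior]
  refine ⟨(fun x' => (D / η) • (x' - ((1 - ε) / D) • z)) ⁻¹' W, fun x' hx' => ?_,
    hWo.preimage (by fun_prop), ?_⟩
  · have := hmem _ hx'
    rwa [smul_smul, div_mul_div_cancel₀ hD0.ne', div_self hη0.ne', one_smul, sub_add_cancel] at this
  · have e : (D / η) • (x - ((1 - ε) / D) • z) = y := by
      have e1 : x - ((1 - ε) / D) • z = (η / D) • y := by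
        rw [hz, hy]
        have h1 : (1 - ε) / D = 1 - η / D := by
          rw [eq_sub_iff_add_eq, ← add_div, div_eq_one_iff_eq hD0.ne', hD]; ring
        have h2 : η / D * ε = 1 - (1 - η / D) * (1 + η) := by
          field_simp; rw [hD]; ring
        rw [h1, smul_add (η / D), smul_smul (η / D), h2]
        module
      rw [e1, smul_smul, div_mul_div_cancel₀ hη0.ne', div_self hD0.ne', one_smul]
    show (D / η) • (x - ((1 - ε) / D) • z) ∈ W
    rw [e]; exact hyW

/-- A nodal interpolant with zero boundary values vanishes outside the domain. -/
lemma nodalInterp_eq_zero_of_notMem (hΩo : IsOpen Ω) (hK : IsTriangulation Ω K) {c : E d → ℝ}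
    (hc : ∀ a ∉ Ω, c a = 0) {x : E d} (hx : x ∉ Ω) : nodalInterp K c x = 0 := by
  classical
  by_cases hxs : x ∈ K.space
  · obtain ⟨s, hs, hxs⟩ := K.mem_space_iff.1 hxs
    obtain ⟨l, h0, h1, rfl⟩ := (Finset.mem_convexHull').1 hxs
    -- Without the zero weights the point lies in the open simplex of `s'`. A vertex of `s'` in `Ω`
    -- would put the point itself in `Ω`, so all nodal values involved are zero.
    set s' := s.filter fun y => l y ≠ 0 with hs'
    have e1 : ∑ y ∈ s', l y = 1 := by
      rw [← h1]; exact Finset.sum_filter_ne_zero s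
    have e2 : ∑ y ∈ s', l y • y = ∑ y ∈ s, l y • y :=
      Finset.sum_filter_of_ne fun y _ h h' => h (by rw [h', zero_smul])
    have hne : s'.Nonempty := by
      rw [Finset.nonempty_iff_ne_empty]; intro h; rw [h] at e1; simp at e1
    have hs'f : s' ∈ K.faces := K.down_closed hs (Finset.filter_subset _ _) hne
    have hpos : ∀ y ∈ s', 0 < l y := fun y hy =>
      lt_of_le_of_ne (h0 y (Finset.mem_filter.1 hy).1) (Finset.mem_filter.1 hy).2.symm
    rw [← e2] at hx ⊢
    rw [nodalInterp_eq_sum hs'f (fun y hy => (hpos y hy).le) e1]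
    refine Finset.sum_eq_zero fun y hy => ?_
    rw [hc y fun hyΩ => hx (mem_of_open_star hΩo hK hs'f hpos e1 hy hyΩ), mul_zero]
  · exact nodalInterp_of_notMem_space c hxs

end EllipticID

end

noncomputable section

namespace EllipticID

variable {d : ℕ} {Ω : Set (E d)} {K : Mesh d}

/-! ### Exterior balls at boundary points -/

/-- Finite unions of open convex sets. -/
def IsFinUnionOpenConvex (A : Set (E d)) : Prop :=
  ∃ P : Set (Set (E d)), P.Finite ∧ (∀ B ∈ P, IsOpen B ∧ Convex ℝ B) ∧ A = ⋃₀ P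

lemma isFinUnionOpenConvex_univ : IsFinUnionOpenConvex (Set.univ : Set (E d)) :=
  ⟨{Set.univ}, Set.finite_singleton _, by rintro B rfl; exact ⟨isOpen_univ, convex_univ⟩, by simp⟩

lemma IsFinUnionOpenConvex.inter {A B : Set (E d)} (hA : IsFinUnionOpenConvex A)
    (hB : IsFinUnionOpenConvex B) : IsFinUnionOpenConvex (A ∩ B) := by
  obtain ⟨P, hPf, hP, rfl⟩ := hA
  obtain ⟨R, hRf, hR, rfl⟩ := hB
  refine ⟨Set.image2 (· ∩ ·) P R, hPf.image2 _ hRf, ?_, ?_⟩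
  · rintro _ ⟨A, hA, B, hB, rfl⟩
    exact ⟨(hP A hA).1.inter (hR B hB).1, (hP A hA).2.inter (hR B hB).2⟩
  · ext x
    simp only [Set.mem_inter_iff, Set.mem_sUnion, Set.mem_image2]
    constructor
    · rintro ⟨⟨A, hA, hxA⟩, B, hB, hxB⟩
      exact ⟨A ∩ B, ⟨A, hA, B, hB, rfl⟩, hxA, hxB⟩
    · rintro ⟨_, ⟨A, hA, B, hB, rfl⟩, hxA, hxB⟩
      exact ⟨⟨A, hA, hxA⟩, B, hB, hxB⟩

/-- Outside a simplex some barycentric coordinate is negative, so the complement is a finite union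
of open half-spaces. -/
lemma isFinUnionOpenConvex_compl_cell {s : Finset (E d)} (hs : s ∈ cells K) :
    IsFinUnionOpenConvex (convexHull ℝ (s : Set (E d)))ᶜ := by
  set b := cellBasis hs
  refine ⟨Set.range fun i : s => {x | b.coord i x < 0}, Set.finite_range _, ?_, ?_⟩
  · rintro _ ⟨i, rfl⟩
    exact ⟨isOpen_lt (b.coord i).continuous_of_finiteDimensional continuous_const,
      (convex_Iio (0 : ℝ)).affine_preimage (b.coord i)⟩
  · have h := b.convexHull_eq_nonneg_coord
    have hr : Set.range b = (s : Set (E d)) := Subtype.range_coe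
    rw [hr] at h
    ext x
    rw [h]
    simp

lemma isFinUnionOpenConvex_compl_biUnion {S : Set (Finset (E d))} (hS : S.Finite)
    (hSK : S ⊆ cells K) :
    IsFinUnionOpenConvex (⋃ s ∈ S, convexHull ℝ (s : Set (E d)))ᶜ := by
  induction S, hS using Set.Finite.induction_on with
  | empty => simpa using isFinUnionOpenConvex_univ
  | insert _ _ ih =>
    rw [Set.biUnion_insert, Set.compl_union]
    exact (isFinUnionOpenConvex_compl_cell (hSK (Set.mem_insert _ _))).inter
      (ih ((Set.subset_insert _ _).trans hSK))

/-- Contracting a fixed ball in `B` toward `a` keeps it in `B`, even if `a` is only in the closure.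
The bound on `‖a‖` makes the ratio uniform, and stating it for all small `θ` lets finitely many
convex sets share one. -/
lemma exists_ball_of_convex {B : Set (E d)} (hBo : IsOpen B) (hB : Convex ℝ B) (R : ℝ) :
    ∀ᶠ θ in nhdsWithin (0 : ℝ) (Set.Ioi 0), ∀ a ∈ closure B, ‖a‖ ≤ R → ∀ ρ, 0 < ρ → ρ ≤ 1 →
      ∃ y, Metric.closedBall y (θ * ρ) ⊆ Metric.closedBall a ρ ∩ B := by
  rcases B.eq_empty_or_nonempty with rfl | ⟨p, hp⟩
  · exact Filter.Eventually.of_forall fun θ a ha => by simp at ha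
  obtain ⟨r, hr, hrB⟩ := Metric.nhds_basis_closedBall.mem_iff.1 (hBo.mem_nhds hp)
  -- `D` bounds the distance from `a` to any point of the ball about `p`, so contraction by `t = ρ /
  -- D` brings that ball within `ρ` of `a`.
  set D := ‖p‖ + |R| + r + 1 with hD
  have hD1 : 1 ≤ D := by
    have := norm_nonneg p; have := abs_nonneg R; linarith
  have hD0 : 0 < D := by linarith
  filter_upwards [Ioo_mem_nhdsGT (show (0 : ℝ) < r / D by positivity)] with θ hθ a ha haR ρ hρ0 hρ1
  set t := ρ / D with ht
  have ht0 : 0 < t := by positivity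
  have ht1 : t ≤ 1 := by rw [ht, div_le_one hD0]; linarith
  refine ⟨(1 - t) • a + t • p, fun q hq => ?_⟩
  have hq' : ‖q - ((1 - t) • a + t • p)‖ ≤ t * r := by
    rw [← dist_eq_norm]
    refine (Metric.mem_closedBall.1 hq).trans ?_
    have := mul_le_mul_of_nonneg_right hθ.2.le hρ0.le
    calc θ * ρ ≤ r / D * ρ := this
      _ = t * r := by rw [ht]; ring
  set p' := p + t⁻¹ • (q - ((1 - t) • a + t • p)) with hp'
  have hp'r : p' ∈ Metric.closedBall p r := by
    rw [Metric.mem_closedBall, dist_eq_norm, hp', add_sub_cancel_left, norm_smul, norm_inv,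
      Real.norm_eq_abs, abs_of_pos ht0, inv_mul_le_iff₀ ht0]
    exact hq'
  have hqe : q = (1 - t) • a + t • p' := by
    rw [hp', smul_add, smul_smul, mul_inv_cancel₀ ht0.ne']; module
  constructor
  · have e : q - a = t • (p' - a) := by rw [hqe]; module
    rw [Metric.mem_closedBall, dist_eq_norm, e, norm_smul, Real.norm_eq_abs, abs_of_pos ht0]
    have h1 : ‖p' - a‖ ≤ D := by
      have h2 : ‖p' - p‖ ≤ r := by rw [← dist_eq_norm]; exact Metric.mem_closedBall.1 hp'r
      have h3 : p' - a = (p' - p) + p - a := by abel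
      have h4 := norm_sub_le ((p' - p) + p) a
      have h5 := norm_add_le (p' - p) p
      have h6 := le_abs_self R
      rw [h3]; linarith
    calc t * ‖p' - a‖ ≤ t * D := by gcongr
      _ = ρ := by rw [ht]; field_simp
  · rw [hqe]
    have := hB.combo_closure_interior_mem_interior ha (y := p')
      (by rw [hBo.interior_eq]; exact hrB hp'r) (a := 1 - t) (b := t) (by linarith) ht0 (by ring)
    exact interior_subset this

/-- A triangulated domain satisfies a uniform exterior ball condition: at every boundary point and
every scale, the complement contains a ball of comparable size. -/
lemma exists_exterior_ball (hΩo : IsOpen Ω) (hΩb : Bornology.IsBounded Ω)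
    (hK : IsTriangulation Ω K) :
    ∃ θ : ℝ, 0 < θ ∧ ∀ a ∈ closure Ω, a ∉ Ω → ∀ ρ, 0 < ρ → ρ ≤ 1 →
      ∃ y, Metric.closedBall y (θ * ρ) ⊆ Metric.closedBall a ρ ∩ Ωᶜ := by
  obtain ⟨R, hR⟩ := hΩb.closure.exists_norm_le
  obtain ⟨P, hPf, hP, hPe⟩ := isFinUnionOpenConvex_compl_biUnion hK.finite_cells (K := K) subset_rfl
  have hsp : K.space = ⋃ s ∈ cells K, convexHull ℝ (s : Set (E d)) := by
    refine subset_antisymm ?_ (Set.iUnion₂_subset fun s hs => K.convexHull_subset_space hs.1)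
    rw [hK.2.1]; exact closure_subset_biUnion_cells hΩo hK
  rw [← hsp] at hPe
  have hev := (Filter.eventually_all_finite hPf).2 fun B hB =>
    exists_ball_of_convex (hP B hB).1 (hP B hB).2 R
  obtain ⟨θ, hθ, hθ0⟩ := (hev.and self_mem_nhdsWithin).exists
  refine ⟨θ, hθ0, fun a ha haΩ ρ hρ0 hρ1 => ?_⟩
  -- As `Ω` is the interior of the triangulated set, `a` is a limit of points outside that set,
  -- hence lies in the closure of one of the finitely many convex pieces of the complement.
  have hcl : a ∈ closure (K.space)ᶜ := by
    rw [closure_compl, hK.2.2]; exact haΩ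
  rw [hPe, Set.sUnion_eq_biUnion, hPf.closure_biUnion] at hcl
  obtain ⟨B, hB, haB⟩ := Set.mem_iUnion₂.1 hcl
  obtain ⟨y, hy⟩ := hθ B hB a haB (hR a ha) ρ hρ0 hρ1
  refine ⟨y, hy.trans (Set.inter_subset_inter_right _ fun x hx hxΩ => ?_)⟩
  have h1 : x ∈ (K.space)ᶜ := by rw [hPe]; exact ⟨B, hB, hx⟩
  exact h1 (hK.2.1 ▸ subset_closure hxΩ)

/-! ### Lipschitz continuity of continuous piecewise Lipschitz functions -/

/-- A function that is Lipschitz on each of finitely many closed sets covering a normed space is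
Lipschitz. -/
lemma dist_le_of_finite_closed_cover {ι : Type*} [Finite ι] {A : ι → Set (E d)}
    (hA : ∀ i, IsClosed (A i)) (hcov : ∀ x, ∃ i, x ∈ A i) {g : E d → ℝ} {L : ℝ}
    (hg : ∀ i, ∀ x ∈ A i, ∀ y ∈ A i, |g x - g y| ≤ L * ‖x - y‖) (x y : E d) :
    |g y - g x| ≤ L * ‖y - x‖ := by
  have hgc : Continuous g := by
    refine (locallyFinite_of_finite A).continuous (Set.iUnion_eq_univ_iff.2 hcov) hA fun i => ?_
    refine (LipschitzOnWith.of_dist_le_mul (K := L.toNNReal) fun u hu v hv => ?_).continuousOn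
    rw [Real.dist_eq, dist_eq_norm]
    exact (hg i u hu v hv).trans
      (mul_le_mul_of_nonneg_right (Real.le_coe_toNNReal L) (norm_nonneg _))
  set γ : ℝ → E d := fun t => x + t • (y - x) with hγ
  have hγc : Continuous γ := by fun_prop
  set F : ℝ → ℝ := fun t => g (γ t) - g x with hF
  -- Some piece `A i` is visited for parameters arbitrarily close to `t` from the right. It is
  -- closed and so contains `γ t`, and its Lipschitz bound controls the slope along those
  -- parameters, which suffices for a lower Dini derivative.
  have hslope : ∀ t ∈ Set.Ico (0 : ℝ) 1, ∀ r, L * ‖y - x‖ < r →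
      ∃ᶠ s in nhdsWithin t (Set.Ioi t), slope (norm ∘ F) t s < r := by
    intro t _ r hr
    obtain ⟨i, hi⟩ : ∃ i, ∃ᶠ s in nhdsWithin t (Set.Ioi t), γ s ∈ A i := by
      by_contra hcon
      simp only [not_exists, Filter.not_frequently] at hcon
      obtain ⟨s, hs⟩ := (Filter.eventually_all.2 hcon).exists
      obtain ⟨i, hi⟩ := hcov (γ s)
      exact hs i hi
    have hti : γ t ∈ A i := by
      refine (hA i).closure_subset (mem_closure_iff_frequently.2 ?_)
      have := (hγc.tendsto t).mono_left (nhdsWithin_le_nhds (s := Set.Ioi t))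
      exact this.frequently hi
    refine (hi.and_eventually self_mem_nhdsWithin).mono fun s hs => ?_
    have hst : 0 < s - t := sub_pos.2 hs.2
    rw [slope_def_field, div_lt_iff₀ hst]
    have h1 : ‖F s‖ - ‖F t‖ ≤ |g (γ s) - g (γ t)| := by
      have := norm_sub_norm_le (F s) (F t)
      simpa [hF] using this
    have h2 := hg i _ hs.1 _ hti
    have h3 : γ s - γ t = (s - t) • (y - x) := by simp only [hγ]; module
    rw [h3, norm_smul, Real.norm_eq_abs, abs_of_pos hst] at h2
    simp only [Function.comp]
    nlinarith
  have hres := image_le_of_liminf_slope_right_le_deriv_boundary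
    (f := norm ∘ F) (B := fun t => L * ‖y - x‖ * t) (B' := fun _ => L * ‖y - x‖) (a := 0) (b := 1)
    (by fun_prop) (by simp [hF, hγ]) (by fun_prop)
    (fun t _ => by simpa using ((hasDerivAt_id t).const_mul (L * ‖y - x‖)).hasDerivWithinAt)
    (fun t ht r hr => hslope t ht r hr) (Set.right_mem_Icc.2 zero_le_one)
  simpa [hF, hγ] using hres

end EllipticID

end

noncomputable section

namespace EllipticID

variable {d : ℕ} {Ω : Set (E d)} {K : Mesh d}

/-! ### Lipschitz functions vanishing outside the domain -/

/-- The image of a ball under a bounded operator between Hilbert spaces is closed. -/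
lemma exists_eq_of_tendsto_of_bounded {H X : Type*} [NormedAddCommGroup H] [InnerProductSpace ℝ H]
    [CompleteSpace H] [NormedAddCommGroup X] [InnerProductSpace ℝ X] [CompleteSpace X]
    (T : H →L[ℝ] X) {g : X} {u : ℕ → H} {M : ℝ} (hu : ∀ n, ‖u n‖ ≤ M)
    (hlim : Filter.Tendsto (fun n => T (u n)) Filter.atTop (nhds g)) : ∃ v, T v = g := by
  set l : ℕ → WeakDual ℝ H := fun n => StrongDual.toWeakDual (InnerProductSpace.toDual ℝ H (u n))
  -- Banach–Alaoglu, transported by Riesz: the bounded sequence has a weak cluster point, which `T`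
  -- maps to the strong limit `g`, as pairing with the adjoint shows.
  obtain ⟨l₀, -, hl₀⟩ := (WeakDual.isCompact_closedBall (𝕜 := ℝ) (0 : StrongDual ℝ H) M).exists_mapClusterPt
    (f := Filter.atTop) (u := l) (by
      refine Filter.le_principal_iff.2 (Filter.mem_map.2 (Filter.Eventually.of_forall fun n => ?_))
      show InnerProductSpace.toDual ℝ H (u n) ∈ Metric.closedBall 0 M
      simpa using hu n)
  refine ⟨(InnerProductSpace.toDual ℝ H).symm (WeakDual.toStrongDual l₀), ext_inner_right ℝ fun y => ?_⟩
  rw [← ContinuousLinearMap.adjoint_inner_right, InnerProductSpace.toDual_symm_apply]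
  have h1 : MapClusterPt (l₀ (ContinuousLinearMap.adjoint T y)) Filter.atTop
      fun n => l n (ContinuousLinearMap.adjoint T y) :=
    hl₀.continuousAt_comp (WeakDual.eval_continuous (ContinuousLinearMap.adjoint T y)).continuousAt
  have h2 : Filter.Tendsto (fun n => l n (ContinuousLinearMap.adjoint T y)) Filter.atTop
      (nhds (inner ℝ g y)) := by
    have : ∀ n, l n (ContinuousLinearMap.adjoint T y) = inner ℝ (T (u n)) y := fun n => by
      rw [← ContinuousLinearMap.adjoint_inner_right]; rfl
    simp_rw [this]
    exact hlim.inner tendsto_const_nhds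
  have h3 : (nhds (l₀ (ContinuousLinearMap.adjoint T y)) ⊓ nhds (inner ℝ g y)).NeBot :=
    Filter.NeBot.mono h1 (inf_le_inf_left _ h2)
  exact eq_of_nhds_neBot h3

/-- The soft threshold. -/
def softThreshold (ε t : ℝ) : ℝ := t - max (-ε) (min ε t)

lemma abs_softThreshold_sub_le (ε a b : ℝ) :
    |softThreshold ε a - softThreshold ε b| ≤ |a - b| := by
  unfold softThreshold
  rcases max_cases (-ε) (min ε a) with ⟨h1, h1'⟩ | ⟨h1, h1'⟩ <;>
  rcases max_cases (-ε) (min ε b) with ⟨h2, h2'⟩ | ⟨h2, h2'⟩ <;>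
  rcases min_cases ε a with ⟨h3, h3'⟩ | ⟨h3, h3'⟩ <;>
  rcases min_cases ε b with ⟨h4, h4'⟩ | ⟨h4, h4'⟩ <;>
  rcases abs_cases (a - b) with ⟨h5, h5'⟩ | ⟨h5, h5'⟩ <;>
  rw [h1, h2, h5, abs_le] <;> constructor <;> linarith

lemma abs_softThreshold_sub_self_le {ε : ℝ} (hε : 0 ≤ ε) (t : ℝ) : |softThreshold ε t - t| ≤ ε := by
  have h1 := le_max_left (-ε) (min ε t)
  have h2 : max (-ε) (min ε t) ≤ ε := max_le (by linarith) (min_le_left _ _)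
  rw [softThreshold, sub_sub_cancel_left, abs_neg, abs_le]
  exact ⟨h1, h2⟩

lemma softThreshold_eq_zero {ε t : ℝ} (h : |t| ≤ ε) : softThreshold ε t = 0 := by
  rw [abs_le] at h
  rw [softThreshold, min_eq_right h.2, max_eq_right h.1, sub_self]

open scoped Convolution in
/-- Lipschitz functions vanishing outside `Ω` are uniform limits of test functions with the same
Lipschitz constant. -/
lemma exists_test_function_near (hΩo : IsOpen Ω) (hΩb : Bornology.IsBounded Ω) {g : E d → ℝ} {L : ℝ}
    (hL0 : 0 ≤ L) (hL : ∀ x y, |g x - g y| ≤ L * ‖x - y‖) (hg0 : ∀ x ∉ Ω, g x = 0) {ε : ℝ}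
    (hε : 0 < ε) : ∃ φ : E d → ℝ, ContDiff ℝ ∞ φ ∧ HasCompactSupport φ ∧ tsupport φ ⊆ Ω ∧
      (∀ x, |φ x - g x| ≤ 2 * ε) ∧ ∀ x, ‖fderiv ℝ φ x‖ ≤ L := by
  have hlip : ∀ {k : E d → ℝ}, (∀ x y, |k x - k y| ≤ L * ‖x - y‖) → LipschitzWith L.toNNReal k :=
    fun h => LipschitzWith.of_dist_le_mul fun x y => by
      rw [Real.dist_eq, dist_eq_norm, Real.coe_toNNReal _ hL0]; exact h x y
  have hgc : Continuous g := (hlip hL).continuous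
  -- Thresholding moves the support into the compact set where `|g| ≥ ε`, leaving room in `Ω` for
  -- mollification, and does not increase the Lipschitz constant.
  set k : E d → ℝ := fun x => softThreshold ε (g x) with hk
  have hkL : ∀ x y, |k x - k y| ≤ L * ‖x - y‖ := fun x y =>
    (abs_softThreshold_sub_le _ _ _).trans (hL x y)
  have hkc : Continuous k := (hlip hkL).continuous
  set S := {x | ε ≤ |g x|} with hS
  have hSc : IsClosed S := isClosed_le continuous_const hgc.abs
  have hSΩ : S ⊆ Ω := fun x hx => by
    by_contra h
    have : ε ≤ |g x| := hx
    rw [hg0 x h, abs_zero] at this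
    linarith
  have hScomp : IsCompact S := Metric.isCompact_of_isClosed_isBounded hSc (hΩb.subset hSΩ)
  have hkS : Function.support k ⊆ S := fun x hx => by
    by_contra h
    exact hx (softThreshold_eq_zero (not_le.1 h).le)
  obtain ⟨r, hr, hrΩ⟩ := hScomp.exists_cthickening_subset_open hΩo hSΩ
  -- The radius keeps the mollified support in `Ω` and the mollification error below `ε`;
  -- thresholding costs the other `ε`.
  set r' := min r (ε / (L + 1)) with hr'
  have hr'0 : 0 < r' := lt_min hr (by positivity)
  have hLr : L * r' ≤ ε := by
    have h1 : r' ≤ ε / (L + 1) := min_le_right _ _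
    rw [le_div_iff₀ (by positivity)] at h1
    nlinarith
  let b : ContDiffBump (0 : E d) := ⟨r' / 2, r', by positivity, by linarith⟩
  set φ : E d → ℝ := b.normed volume ⋆[ContinuousLinearMap.lsmul ℝ ℝ, volume] k with hφ
  have hsupp : Function.support φ ⊆ Metric.cthickening r S := by
    refine (support_convolution_subset _).trans ?_
    rw [b.support_normed_eq]
    rintro _ ⟨x, hx, y, hy, rfl⟩
    refine Metric.thickening_subset_cthickening _ _ (Metric.mem_thickening_iff.2 ⟨y, hkS hy, ?_⟩)
    have : ‖x‖ < r' := by simpa [b] using hx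
    simpa [dist_eq_norm] using this.trans_le (min_le_left _ _)
  have htsupp : tsupport φ ⊆ Metric.cthickening r S :=
    closure_minimal hsupp Metric.isClosed_cthickening
  refine ⟨φ, b.hasCompactSupport_normed.contDiff_convolution_left _ b.contDiff_normed
    hkc.locallyIntegrable, ?_, htsupp.trans hrΩ, fun x => ?_, fun x => ?_⟩
  · exact HasCompactSupport.of_support_subset_isCompact hScomp.cthickening hsupp
  · have h1 : dist (φ x) (k x) ≤ ε := by
      refine b.dist_normed_convolution_le hkc.aestronglyMeasurable fun y hy => ?_
      rw [Real.dist_eq]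
      refine (hkL y x).trans ((mul_le_mul_of_nonneg_left ?_ hL0).trans hLr)
      rw [← dist_eq_norm]; exact (Metric.mem_ball.1 hy).le
    have h2 := abs_softThreshold_sub_self_le hε.le (g x)
    rw [Real.dist_eq] at h1
    calc |φ x - g x| ≤ |φ x - k x| + |k x - g x| := abs_sub_le _ _ _
      _ ≤ 2 * ε := by linarith
  · have hint : ∀ x, Integrable (fun t => b.normed volume t * k (x - t)) := fun x =>
      (b.continuous_normed.mul (hkc.comp (by fun_prop))).integrable_of_hasCompactSupport
        b.hasCompactSupport_normed.mul_right
    -- Averaging against a probability density preserves the Lipschitz constant, which bounds the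
    -- derivative.
    have hφL : ∀ x y, |φ x - φ y| ≤ L * ‖x - y‖ := by
      intro x y
      have e : φ x - φ y = ∫ t, b.normed volume t * (k (x - t) - k (y - t)) := by
        simp_rw [mul_sub]
        rw [integral_sub (hint x) (hint y)]
        rfl
      rw [e, ← Real.norm_eq_abs]
      calc ‖∫ t, b.normed volume t * (k (x - t) - k (y - t))‖
          ≤ ∫ t, b.normed volume t * (L * ‖x - y‖) := by
            refine norm_integral_le_of_norm_le (b.integrable_normed.mul_const _)
              (Filter.Eventually.of_forall fun t => ?_)
            rw [norm_mul, Real.norm_of_nonneg (b.nonneg_normed t)]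
            refine mul_le_mul_of_nonneg_left ?_ (b.nonneg_normed t)
            simpa using hkL (x - t) (y - t)
        _ = L * ‖x - y‖ := by rw [integral_mul_const, b.integral_normed, one_mul]
    simpa [Real.coe_toNNReal _ hL0] using norm_fderiv_le_of_lipschitz ℝ (x₀ := x) (hlip hφL)

/-- The element of `H¹₀(Ω)` given by a test function. -/
lemma exists_H10_of_test (hΩb : Bornology.IsBounded Ω) {φ : E d → ℝ} (hφ : ContDiff ℝ ∞ φ)
    (hφc : HasCompactSupport φ) (hφs : tsupport φ ⊆ Ω) {L : ℝ} (hL0 : 0 ≤ L)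
    (hL : ∀ x, ‖fderiv ℝ φ x‖ ≤ L) :
    ∃ u : H10 Ω, val u =ᵐ[vol Ω] φ ∧ ‖grad u‖ ≤ (measureUnivNNReal (vol Ω) : ℝ) ^ (2⁻¹ : ℝ) * L := by
  have := isFiniteMeasure_vol hΩb
  have hgc : Continuous (gradient φ) :=
    (InnerProductSpace.toDual ℝ (E d)).symm.continuous.comp (hφ.continuous_fderiv (by simp))
  have m1 : MemLp φ 2 (vol Ω) := memLp_vol_of_continuous hΩb hφ.continuous
  have m2 : MemLp (gradient φ) 2 (vol Ω) :=
    MemLp.of_bound hgc.aestronglyMeasurable L (Filter.Eventually.of_forall fun x => by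
      rw [norm_gradient_eq]; exact hL x)
  have hmem : (WithLp.toLp 2 (m1.toLp φ, m2.toLp _) : L2Pair Ω) ∈ testPairs Ω :=
    ⟨φ, hφ, hφc, hφs, m1.coeFn_toLp, m2.coeFn_toLp⟩
  refine ⟨⟨_, (testPairs Ω).le_topologicalClosure hmem⟩, m1.coeFn_toLp, ?_⟩
  have := Lp.norm_le_of_ae_bound (f := m2.toLp _) hL0 (by
    filter_upwards [m2.coeFn_toLp] with x hx
    rw [hx, norm_gradient_eq]; exact hL x)
  rwa [ENNReal.toReal_ofNat] at this

/-- Lipschitz functions vanishing outside `Ω` belong to `H¹₀(Ω)`. -/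
lemma exists_H10_of_lipschitz (hΩo : IsOpen Ω) (hΩb : Bornology.IsBounded Ω) {g : E d → ℝ} {L : ℝ}
    (hL0 : 0 ≤ L) (hL : ∀ x y, |g x - g y| ≤ L * ‖x - y‖) (hg0 : ∀ x ∉ Ω, g x = 0) :
    ∃ u : H10 Ω, val u =ᵐ[vol Ω] g := by
  have := isFiniteMeasure_vol hΩb
  have hgc : Continuous g := by
    refine (LipschitzWith.of_dist_le_mul (K := L.toNNReal) fun x y => ?_).continuous
    rw [Real.dist_eq, dist_eq_norm, Real.coe_toNNReal _ hL0]; exact hL x y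
  have mg : MemLp g 2 (vol Ω) := memLp_vol_of_continuous hΩb hgc
  set V := (measureUnivNNReal (vol Ω) : ℝ) ^ (2⁻¹ : ℝ) with hV
  have hV0 : 0 ≤ V := by positivity
  have hseq : ∀ n : ℕ, ∃ u : H10 Ω, ‖val u - mg.toLp g‖ ≤ V * (2 * (1 / ((n : ℝ) + 1))) ∧
      ‖grad u‖ ≤ V * L := by
    intro n
    obtain ⟨φ, h1, h2, h3, h4, h5⟩ := exists_test_function_near hΩo hΩb hL0 hL hg0
      (show (0 : ℝ) < 1 / ((n : ℝ) + 1) by positivity)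
    obtain ⟨u, hu, hgu⟩ := exists_H10_of_test hΩb h1 h2 h3 hL0 h5
    refine ⟨u, ?_, hgu⟩
    have := Lp.norm_le_of_ae_bound (f := val u - mg.toLp g) (C := 2 * (1 / ((n : ℝ) + 1)))
      (by positivity) (by
        filter_upwards [hu, mg.coeFn_toLp, Lp.coeFn_sub (val u) (mg.toLp g)] with x e1 e2 e3
        rw [e3, Pi.sub_apply, e1, e2]; exact h4 x)
    simpa using this
  choose u hu1 hu2 using hseq
  have hlim : Filter.Tendsto (fun n => valL Ω (u n)) Filter.atTop (nhds (mg.toLp g)) := by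
    rw [tendsto_iff_norm_sub_tendsto_zero]
    refine squeeze_zero (fun n => norm_nonneg _) hu1 ?_
    simpa using ((tendsto_one_div_add_atTop_nhds_zero_nat (𝕜 := ℝ)).const_mul 2).const_mul V
  have hbound : ∀ n, ‖u n‖ ≤ (‖mg.toLp g‖ + V * 2) + V * L := by
    intro n
    have h1 : ‖val (u n)‖ ≤ ‖mg.toLp g‖ + V * 2 := by
      have h2 := norm_sub_norm_le (val (u n)) (mg.toLp g)
      have h3 : V * (2 * (1 / ((n : ℝ) + 1))) ≤ V * 2 := by
        refine mul_le_mul_of_nonneg_left ?_ hV0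
        have : 1 / ((n : ℝ) + 1) ≤ 1 := by
          rw [div_le_one (by positivity)]; linarith [n.cast_nonneg (α := ℝ)]
        linarith
      linarith [hu1 n]
    have h4 := norm_sq_H10 (u n)
    refine le_of_sq_le_sq ?_ (by positivity)
    rw [h4]
    nlinarith [norm_nonneg (val (u n)), norm_nonneg (grad (u n)), hu2 n]
  -- The approximants converge only in `L²`, but their `H¹` bound yields a weak limit in `H¹₀(Ω)`
  -- with the right function part.
  obtain ⟨v, hv⟩ := exists_eq_of_tendsto_of_bounded (valL Ω) hbound hlim
  refine ⟨v, ?_⟩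
  rw [valL_apply] at hv
  rw [hv]
  exact mg.coeFn_toLp

/-- A nodal interpolant with zero boundary values is Lipschitz. -/
lemma exists_lipschitz_nodalInterp (hΩo : IsOpen Ω) (hK : IsTriangulation Ω K) {c : E d → ℝ}
    (hc : ∀ a ∉ Ω, c a = 0) :
    ∃ L : ℝ, 0 ≤ L ∧ ∀ x y, |nodalInterp K c x - nodalInterp K c y| ≤ L * ‖x - y‖ := by
  have : Finite (cells K) := hK.finite_cells
  have hcell : ∀ s : cells K, ∃ L : ℝ, 0 ≤ L ∧ ∀ x ∈ convexHull ℝ (s.1 : Set (E d)),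
      ∀ y ∈ convexHull ℝ (s.1 : Set (E d)),
      |nodalInterp K c x - nodalInterp K c y| ≤ L * ‖x - y‖ := by
    intro s
    obtain ⟨p, -, hp⟩ := exists_affine_eqOn s.2 c
    refine ⟨‖p.linear.toContinuousLinearMap‖, norm_nonneg _, fun x hx y hy => ?_⟩
    rw [hp hx, hp hy]
    have : p x - p y = p.linear.toContinuousLinearMap (x - y) := by
      have := p.linearMap_vsub x y
      simpa using this.symm
    rw [this]
    exact p.linear.toContinuousLinearMap.le_opNorm _
  choose Ls hLs0 hLs using hcell
  have := Fintype.ofFinite (cells K)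
  set L := ∑ s, Ls s
  have hL0 : 0 ≤ L := Finset.sum_nonneg fun s _ => hLs0 s
  refine ⟨L, hL0, fun x y => ?_⟩
  -- The complement of `Ω`, where the interpolant vanishes, completes the cells to a finite closed
  -- cover of the whole space.
  refine dist_le_of_finite_closed_cover (ι := Option (cells K))
    (A := fun o => o.elim Ωᶜ fun s => convexHull ℝ (s.1 : Set (E d))) ?_ ?_ ?_ y x
  · rintro (_ | s)
    · exact hΩo.isClosed_compl
    · exact (s.1.finite_toSet.isCompact_convexHull (𝕜 := ℝ)).isClosed
  · intro x
    by_cases hx : x ∈ Ω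
    · obtain ⟨s, hs, hxs⟩ := Set.mem_iUnion₂.1 (subset_biUnion_cells hΩo hK hx)
      exact ⟨some ⟨s, hs⟩, hxs⟩
    · exact ⟨none, hx⟩
  · rintro (_ | s) x hx y hy
    · rw [nodalInterp_eq_zero_of_notMem hΩo hK hc hx, nodalInterp_eq_zero_of_notMem hΩo hK hc hy]
      simpa using mul_nonneg hL0 (norm_nonneg (x - y))
    · refine (hLs s x hx y hy).trans (mul_le_mul_of_nonneg_right ?_ (norm_nonneg _))
      exact Finset.single_le_sum (f := Ls) (fun s _ => hLs0 s) (Finset.mem_univ s)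

lemma exists_H10_nodalInterp (hΩo : IsOpen Ω) (hΩb : Bornology.IsBounded Ω)
    (hK : IsTriangulation Ω K) {c : E d → ℝ} (hc : ∀ a ∉ Ω, c a = 0) :
    ∃ u : H10 Ω, val u =ᵐ[vol Ω] nodalInterp K c := by
  obtain ⟨L, hL0, hL⟩ := exists_lipschitz_nodalInterp hΩo hK hc
  exact exists_H10_of_lipschitz hΩo hΩb hL0 hL fun x hx => nodalInterp_eq_zero_of_notMem hΩo hK hc hx

lemma mem_Vh_of_val_eq_nodalInterp (hΩo : IsOpen Ω) (hK : IsTriangulation Ω K) {c : E d → ℝ}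
    (hc : ∀ a ∉ Ω, c a = 0) {u : H10 Ω} (hu : val u =ᵐ[vol Ω] nodalInterp K c) : u ∈ Vh Ω K := by
  obtain ⟨L, hL0, hL⟩ := exists_lipschitz_nodalInterp hΩo hK hc
  have hcont : Continuous (nodalInterp K c) := by
    refine (LipschitzWith.of_dist_le_mul (K := L.toNNReal) fun x y => ?_).continuous
    rw [Real.dist_eq, dist_eq_norm, Real.coe_toNNReal _ hL0]; exact hL x y
  refine ⟨_, hcont.continuousOn, hu, fun s hs => ?_⟩
  obtain ⟨p, -, hp⟩ := exists_affine_eqOn hs c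
  exact ⟨p, hp⟩

end EllipticID

end

noncomputable section

namespace EllipticID

variable {d : ℕ} {Ω : Set (E d)} {K : Mesh d}

/-! ### Estimates for affine functions -/

/-- The volume of the unit ball. -/
def unitVol (d : ℕ) : ℝ := volume.real (Metric.closedBall (0 : E d) 1)

lemma unitVol_pos : 0 < unitVol d :=
  ENNReal.toReal_pos (Metric.measure_closedBall_pos _ _ one_pos).ne'
    (isCompact_closedBall _ _).measure_lt_top.ne

lemma volume_real_closedBall (x : E d) {r : ℝ} (hr : 0 ≤ r) :
    volume.real (Metric.closedBall x r) = r ^ d * unitVol d := by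
  rw [Measure.real, Measure.addHaar_closedBall' _ _ hr, ENNReal.toReal_mul,
    ENNReal.toReal_ofReal (by positivity)]
  simp [unitVol, Measure.real]

lemma affine_sub_eq (p : E d →ᵃ[ℝ] ℝ) (x y : E d) : p x - p y = p.linear (x - y) := by
  simpa using (p.linearMap_vsub x y).symm

/-- The mean value inequality for the square of an affine function. -/
lemma sq_affine_mul_volume_le (p : E d →ᵃ[ℝ] ℝ) (w : E d) {r : ℝ} (hr : 0 ≤ r) :
    p w ^ 2 * (r ^ d * unitVol d) ≤ ∫ x in Metric.closedBall w r, p x ^ 2 := by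
  have hc : Continuous p := p.continuous_of_finiteDimensional
  set F : E d → ℝ := (Metric.closedBall w r).indicator fun x => p x ^ 2 with hF
  have hFi : Integrable F := by
    refine (integrable_indicator_iff Metric.isClosed_closedBall.measurableSet).2 ?_
    exact (hc.pow 2).continuousOn.integrableOn_compact (isCompact_closedBall _ _)
  have i1 : Integrable fun y => F (w + y) := hFi.comp_add_left w
  have i2 : Integrable fun y => F (w - y) := hFi.comp_sub_left w
  have e1 : ∫ y, F (w + y) = ∫ y, F y := integral_add_left_eq_self F w
  have e2 : ∫ y, F (w - y) = ∫ y, F y := integral_sub_left_eq_self F volume w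
  have e3 : ∫ y, F y = ∫ x in Metric.closedBall w r, p x ^ 2 :=
    integral_indicator Metric.isClosed_closedBall.measurableSet
  -- The value of an affine function at the centre is the average of its values at the antipodal
  -- points `w ± y`; convexity of the square gives the pointwise bound.
  have hle : ∫ y, (Metric.closedBall (0 : E d) r).indicator (fun _ => p w ^ 2) y ≤
      ∫ y, 2⁻¹ * (F (w + y) + F (w - y)) := by
    refine integral_mono ?_ ((i1.add i2).const_mul _) fun y => ?_
    · exact (integrable_indicator_iff Metric.isClosed_closedBall.measurableSet).2
        (integrableOn_const (isCompact_closedBall _ _).measure_lt_top.ne)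
    · by_cases hy : y ∈ Metric.closedBall (0 : E d) r
      · have h1 : w + y ∈ Metric.closedBall w r := by simpa using hy
        have h2 : w - y ∈ Metric.closedBall w r := by simpa using hy
        simp only [Set.indicator_of_mem hy, hF, Set.indicator_of_mem h1, Set.indicator_of_mem h2]
        have h3 := affine_sub_eq p (w + y) w
        have h4 := affine_sub_eq p (w - y) w
        rw [add_sub_cancel_left] at h3
        rw [sub_sub_cancel_left, map_neg] at h4
        have h5 : p w = 2⁻¹ * (p (w + y) + p (w - y)) := by linarith
        rw [h5]
        nlinarith [sq_nonneg (p (w + y) - p (w - y))]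
      · simp only [Set.indicator_of_notMem hy]
        have h1 : 0 ≤ F (w + y) := Set.indicator_nonneg (fun x _ => sq_nonneg _) _
        have h2 : 0 ≤ F (w - y) := Set.indicator_nonneg (fun x _ => sq_nonneg _) _
        positivity
  rw [integral_const_mul, integral_add i1 i2, e1, e2, e3,
    integral_indicator Metric.isClosed_closedBall.measurableSet, setIntegral_const,
    volume_real_closedBall _ hr, smul_eq_mul] at hle
  linarith

/-- The constant of the inverse estimate `sq_affine_mul_pow_le`. -/
def invConst (d : ℕ) (γ : ℝ) : ℝ :=
  2 * ((1 + 2 / γ) ^ 2 + (2 / γ) ^ 2) / ((γ / 2) ^ d * unitVol d)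

lemma invConst_pos {γ : ℝ} (hγ : 0 < γ) : 0 < invConst d γ := by
  have := unitVol_pos (d := d)
  unfold invConst; positivity

/-- An inverse estimate: point values of affine functions are controlled by their `L²` norm on a
ball of comparable size. -/
lemma sq_affine_mul_pow_le (p : E d →ᵃ[ℝ] ℝ) {a z : E d} {h γ : ℝ} (hh : 0 < h) (hγ : 0 < γ)
    (haz : ‖a - z‖ ≤ h) :
    p a ^ 2 * h ^ d ≤ invConst d γ * ∫ x in Metric.closedBall z (γ * h), p x ^ 2 := by
  have hω := unitVol_pos (d := d)
  set I := ∫ x in Metric.closedBall z (γ * h), p x ^ 2 with hI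
  -- `p a` is extrapolated along the line through `z` and `z'`. The balls of radius `γ h / 2` about
  -- these two points lie in the given ball.
  set z' := z + (γ / 2) • (a - z) with hz'
  have hmean : ∀ w, ‖w - z‖ ≤ γ / 2 * h → p w ^ 2 * ((γ / 2 * h) ^ d * unitVol d) ≤ I := by
    intro w hw
    refine (sq_affine_mul_volume_le p w (by positivity)).trans ?_
    refine setIntegral_mono_set ?_ (Filter.Eventually.of_forall fun x => sq_nonneg _)
      (LE.le.eventuallyLE (Metric.closedBall_subset_closedBall' ?_))
    · exact (p.continuous_of_finiteDimensional.pow 2).continuousOn.integrableOn_compact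
        (isCompact_closedBall _ _)
    · rw [dist_eq_norm]; linarith
  have h1 := hmean z (by simp; positivity)
  have h2 := hmean z' (by
    rw [hz', add_sub_cancel_left, norm_smul, Real.norm_of_nonneg (by positivity)]
    gcongr)
  have e : p a = (1 - 2 / γ) * p z + 2 / γ * p z' := by
    have h3 := affine_sub_eq p a z
    have h4 := affine_sub_eq p z' z
    rw [hz', add_sub_cancel_left, map_smul, smul_eq_mul, ← hz'] at h4
    have h5 : 2 / γ * (p z' - p z) = p a - p z := by
      rw [h4, h3]; field_simp
    linarith
  have hτ : 0 < 2 / γ := by positivity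
  have hsq : p a ^ 2 ≤ 2 * ((1 + 2 / γ) ^ 2 * p z ^ 2 + (2 / γ) ^ 2 * p z' ^ 2) := by
    rw [e]
    have h6 : (1 - 2 / γ) ^ 2 * p z ^ 2 ≤ (1 + 2 / γ) ^ 2 * p z ^ 2 :=
      mul_le_mul_of_nonneg_right (by nlinarith) (sq_nonneg _)
    nlinarith [sq_nonneg ((1 - 2 / γ) * p z - 2 / γ * p z')]
  set V := (γ / 2) ^ d * unitVol d with hV
  have hV0 : 0 < V := by positivity
  have hVe : (γ / 2 * h) ^ d * unitVol d = h ^ d * V := by rw [mul_pow, hV]; ring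
  rw [hVe] at h1 h2
  rw [invConst, ← hV, div_mul_eq_mul_div, le_div_iff₀ hV0]
  have h7 := mul_le_mul_of_nonneg_right hsq (show 0 ≤ h ^ d * V by positivity)
  have h8 := mul_le_mul_of_nonneg_left h1 (sq_nonneg (1 + 2 / γ))
  have h9 := mul_le_mul_of_nonneg_left h2 (sq_nonneg (2 / γ))
  nlinarith

/-- An affine function that oscillates little on a ball has a small gradient. -/
lemma norm_gradient_affine_le (p : E d →ᵃ[ℝ] ℝ) {z : E d} {r m M : ℝ} (hr : 0 < r) (hM : 0 ≤ M)
    (hp : ∀ x ∈ Metric.closedBall z r, |p x - m| ≤ M) (x : E d) : ‖gradient p x‖ ≤ 2 * M / r := by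
  have hfd : fderiv ℝ p x = p.linear.toContinuousLinearMap := by
    have : HasFDerivAt p (p.linear.toContinuousLinearMap) x := by
      have h1 : HasFDerivAt (fun y => p.linear.toContinuousLinearMap y + p 0)
          p.linear.toContinuousLinearMap x := p.linear.toContinuousLinearMap.hasFDerivAt.add_const _
      refine h1.congr_of_eventuallyEq (Filter.Eventually.of_forall fun y => ?_)
      have := affine_sub_eq p y 0
      rw [sub_zero] at this
      simp only [LinearMap.coe_toContinuousLinearMap']
      linarith
    exact this.fderiv
  rw [norm_gradient_eq, hfd]
  refine ContinuousLinearMap.opNorm_le_bound _ (by positivity) fun e => ?_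
  rcases eq_or_ne e 0 with rfl | he
  · simp
  have he' : 0 < ‖e‖ := norm_pos_iff.2 he
  set y := z + (r / ‖e‖) • e with hy
  have h1 := hp y (by
    rw [Metric.mem_closedBall, dist_eq_norm, hy, add_sub_cancel_left, norm_smul,
      Real.norm_of_nonneg (by positivity), div_mul_cancel₀ _ he'.ne'])
  have h2 := hp z (Metric.mem_closedBall_self hr.le)
  have h3 := affine_sub_eq p y z
  rw [hy, add_sub_cancel_left, map_smul, smul_eq_mul, ← hy] at h3
  have h4 : |r / ‖e‖ * p.linear e| ≤ 2 * M := by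
    rw [← h3]
    calc |p y - p z| = |(p y - m) - (p z - m)| := by ring_nf
      _ ≤ |p y - m| + |p z - m| := abs_sub _ _
      _ ≤ 2 * M := by linarith
  rw [abs_mul, abs_of_pos (show 0 < r / ‖e‖ by positivity)] at h4
  simp only [LinearMap.coe_toContinuousLinearMap', Real.norm_eq_abs]
  rw [div_mul_eq_mul_div, le_div_iff₀ hr]
  rw [div_mul_eq_mul_div, div_le_iff₀ he'] at h4
  linarith

/-! ### The local projections -/

/-- The local projection exists. -/
lemma exists_localProj (hΩb : Bornology.IsBounded Ω) (v : L2 Ω) (S : Set (E d)) :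
    ∃ p : E d →ᵃ[ℝ] ℝ, ∀ q : E d →ᵃ[ℝ] ℝ, ∫ x in S, (v x - p x) * q x ∂(vol Ω) = 0 := by
  -- Orthogonal projection onto a finite dimensional subspace; on a null set the affine
  -- representative is not unique, but existence is all that is needed.
  set W := LinearMap.range (affineL2 hΩb S)
  have : FiniteDimensional ℝ W := LinearMap.finiteDimensional_range _
  set f := LpToLpRestrictCLM (E d) ℝ ℝ (vol Ω) 2 S v
  obtain ⟨p, hp⟩ : W.starProjection f ∈ W := W.starProjection_apply_mem f
  refine ⟨p, fun q => ?_⟩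
  have h1 : inner ℝ (affineL2 hΩb S q) (f - affineL2 hΩb S p) = 0 := by
    rw [hp]
    exact W.inner_right_of_mem_orthogonal ⟨q, rfl⟩ (W.sub_starProjection_mem_orthogonal f)
  rw [L2.inner_def] at h1
  rw [← h1]
  refine integral_congr_ae ?_
  filter_upwards [LpToLpRestrictCLM_coeFn ℝ S v, coeFn_affineL2 hΩb S p, coeFn_affineL2 hΩb S q,
    Lp.coeFn_sub f (affineL2 hΩb S p)] with x e1 e2 e3 e4
  rw [e4, Pi.sub_apply, e1, e2, e3]
  simp

lemma localProj_spec (hΩb : Bornology.IsBounded Ω) (v : L2 Ω) (a : E d) (q : E d →ᵃ[ℝ] ℝ) :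
    ∫ x in patch K a, (v x - localProj K v a x) * q x ∂(vol Ω) = 0 := by
  have h := exists_localProj hΩb v (patch K a)
  rw [localProj, dif_pos h]
  exact h.choose_spec q

lemma memLp_sub_const (hΩb : Bornology.IsBounded Ω) (v : L2 Ω) (m : ℝ) :
    MemLp (fun x => v x - m) 2 (vol Ω) :=
  (Lp.memLp v).sub (memLp_vol_of_continuous hΩb continuous_const)

/-- The projection error relative to a constant does not exceed that of the function. -/
lemma integral_sq_proj_sub_le (hΩb : Bornology.IsBounded Ω) {v : L2 Ω} {S : Set (E d)}
    {p : E d →ᵃ[ℝ] ℝ} (hp : ∀ q : E d →ᵃ[ℝ] ℝ, ∫ x in S, (v x - p x) * q x ∂(vol Ω) = 0) (m : ℝ) :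
    ∫ x in S, (p x - m) ^ 2 ∂(vol Ω) ≤ ∫ x in S, (v x - m) ^ 2 ∂(vol Ω) := by
  have hpc := p.continuous_of_finiteDimensional
  have m1 : MemLp (fun x => v x - p x) 2 ((vol Ω).restrict S) :=
    ((Lp.memLp v).sub (memLp_vol_of_continuous hΩb hpc)).restrict S
  have m2 : MemLp (fun x => p x - m) 2 ((vol Ω).restrict S) :=
    (memLp_vol_of_continuous hΩb (hpc.sub continuous_const)).restrict S
  -- Constants are affine, so `p - m` is an admissible test function and Pythagoras applies.
  have h0 : ∫ x in S, (v x - p x) * (p x - m) ∂(vol Ω) = 0 := hp (p - AffineMap.const ℝ (E d) m)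
  have e : ∫ x in S, (v x - m) ^ 2 ∂(vol Ω) = ∫ x in S, (v x - p x) ^ 2 ∂(vol Ω) +
      (2 * ∫ x in S, (v x - p x) * (p x - m) ∂(vol Ω) + ∫ x in S, (p x - m) ^ 2 ∂(vol Ω)) := by
    have i2 : Integrable (fun x => 2 * ((v x - p x) * (p x - m))) ((vol Ω).restrict S) :=
      (m1.integrable_mul m2).const_mul 2
    have i3 : Integrable (fun x => 2 * ((v x - p x) * (p x - m)) + (p x - m) ^ 2)
        ((vol Ω).restrict S) := i2.add m2.integrable_sq
    rw [← integral_const_mul, ← integral_add i2 m2.integrable_sq,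
      ← integral_add m1.integrable_sq i3]
    exact integral_congr_ae (Filter.Eventually.of_forall fun x => by ring)
  rw [e, h0]
  have : 0 ≤ ∫ x in S, (v x - p x) ^ 2 ∂(vol Ω) := integral_nonneg fun x => sq_nonneg _
  linarith

/-- The Poincaré inequality on a ball in terms of the mean of the extension by zero. -/
lemma poincare_mean (hΩb : Bornology.IsBounded Ω) (v : H10 Ω) (a : E d) {R : ℝ} (hR : 0 < R) :
    ∃ m : ℝ, ∫ x in Metric.closedBall a R, (val v x - m) ^ 2 ∂(vol Ω) +
        m ^ 2 * (volume.real (Metric.closedBall a R) - (vol Ω).real (Metric.closedBall a R)) ≤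
      2 ^ d * (2 * R) ^ 2 * ∫ x in Metric.closedBall a R, ‖grad v x‖ ^ 2 ∂(vol Ω) := by
  have := isFiniteMeasure_vol hΩb
  have hp := poincare_H10 v a R
  set B := Metric.closedBall a R
  set V := volume.real B with hV
  have hV0 : 0 < V := by
    have := unitVol_pos (d := d)
    rw [hV, volume_real_closedBall _ hR.le]; positivity
  set I := ∫ x in B, val v x ∂(vol Ω)
  set m := I / V with hm
  refine ⟨m, ?_⟩
  have mv : MemLp (val v) 2 ((vol Ω).restrict B) := (Lp.memLp (val v)).restrict B
  have iv : Integrable (val v) ((vol Ω).restrict B) := mv.integrable (by norm_num)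
  -- The term `m ^ 2` times the volume of `B` outside `Ω` is the part of the variance where the
  -- extension is zero; it will bound `m` near the boundary.
  have e : ∫ x in B, (val v x - m) ^ 2 ∂(vol Ω) =
      ∫ x in B, ‖val v x‖ ^ 2 ∂(vol Ω) - 2 * m * I + m ^ 2 * (vol Ω).real B := by
    have h1 : ∀ x, (val v x - m) ^ 2 = ‖val v x‖ ^ 2 - 2 * m * val v x + m ^ 2 := fun x => by
      rw [Real.norm_eq_abs, sq_abs]; ring
    simp_rw [h1]
    have i1 : Integrable (fun x => ‖val v x‖ ^ 2) ((vol Ω).restrict B) := (integrable_norm_sq _).restrict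
    rw [integral_add (f := fun x => ‖val v x‖ ^ 2 - 2 * m * val v x)
      (i1.sub (iv.const_mul (2 * m))) (integrable_const _),
      integral_sub i1 (iv.const_mul (2 * m)), integral_const_mul, setIntegral_const]
    simp only [smul_eq_mul]
    ring
  rw [e]
  have hI : I = m * V := by rw [hm]; field_simp
  have h2 : V * (∫ x in B, ‖val v x‖ ^ 2 ∂(vol Ω) - m ^ 2 * V) ≤
      V * (2 ^ d * (2 * R) ^ 2 * ∫ x in B, ‖grad v x‖ ^ 2 ∂(vol Ω)) := by
    rw [hI] at hp; linarith
  have h3 := le_of_mul_le_mul_left h2 hV0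
  rw [hI]; linarith

end EllipticID

end

noncomputable section

namespace EllipticID

variable {d : ℕ} {Ω : Set (E d)} {K : Mesh d}

/-! ### Stability of the Clément operator -/

/-- `K` is a triangulation of mesh size `h` whose cells contain balls of radius `γ h` in `Ω`, and
`Ω` has an exterior ball of radius `θ h` near every boundary point. -/
structure IsRegularMesh (Ω : Set (E d)) (K : Mesh d) (γ θ h : ℝ) : Prop where
  isTriangulation : IsTriangulation Ω K
  diam_le : ∀ s ∈ cells K, Metric.diam (convexHull ℝ (s : Set (E d))) ≤ h
  exists_ball : ∀ s ∈ cells K, ∃ z,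
    Metric.closedBall z (γ * h) ⊆ convexHull ℝ (s : Set (E d)) ∩ Ω
  exists_exterior_ball : ∀ a ∈ closure Ω, a ∉ Ω → ∃ y,
    Metric.closedBall y (θ * h) ⊆ Metric.closedBall a h ∩ Ωᶜ

lemma isBounded_convexHull_finset (s : Finset (E d)) :
    Bornology.IsBounded (convexHull ℝ (s : Set (E d))) :=
  isBounded_convexHull.2 s.finite_toSet.isBounded

lemma IsRegularMesh.norm_sub_le_of_mem {γ θ h : ℝ} (hK : IsRegularMesh Ω K γ θ h) {s : Finset (E d)}
    (hs : s ∈ cells K) {x y : E d} (hx : x ∈ convexHull ℝ (s : Set (E d)))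
    (hy : y ∈ convexHull ℝ (s : Set (E d))) : ‖x - y‖ ≤ h := by
  rw [← dist_eq_norm]
  exact (Metric.dist_le_diam_of_mem (isBounded_convexHull_finset s) hx hy).trans (hK.diam_le s hs)

lemma IsRegularMesh.patch_subset {γ θ h : ℝ} (hK : IsRegularMesh Ω K γ θ h) {s : Finset (E d)}
    (hs : s ∈ cells K) {z a : E d} (hz : z ∈ convexHull ℝ (s : Set (E d))) (ha : a ∈ s) :
    patch K a ⊆ Metric.closedBall z (2 * h) := by
  intro x hx
  simp only [patch, Set.mem_iUnion, Set.mem_ofPred_eq] at hx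
  obtain ⟨t, ⟨ht, hat⟩, hx⟩ := hx
  have h1 := hK.norm_sub_le_of_mem ht hx (subset_convexHull ℝ _ (Finset.mem_coe.2 hat))
  have h2 := hK.norm_sub_le_of_mem hs (subset_convexHull ℝ _ (Finset.mem_coe.2 ha)) hz
  rw [mem_closedBall_iff_norm]
  calc ‖x - z‖ = ‖(x - a) + (a - z)‖ := by rw [sub_add_sub_cancel]
    _ ≤ _ := norm_add_le _ _
    _ ≤ 2 * h := by linarith

/-- The constant in the bound of the nodal values. -/
def nodalConst (d : ℕ) (γ θ : ℝ) : ℝ := 2 ^ d * 16 * (invConst d γ + 1 / (θ ^ d * unitVol d))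

lemma nodalConst_pos {γ θ : ℝ} (hγ : 0 < γ) (hθ : 0 < θ) : 0 < nodalConst d γ θ := by
  have h1 := invConst_pos (d := d) hγ
  have h2 := unitVol_pos (d := d)
  unfold nodalConst; positivity

/-- The nodal values of the Clément interpolant on a cell are close to a common constant. -/
lemma IsRegularMesh.exists_sq_nodal_sub_le {γ θ h : ℝ} (hΩb : Bornology.IsBounded Ω)
    (hK : IsRegularMesh Ω K γ θ h) (hh : 0 < h) (hγ : 0 < γ) (hθ : 0 < θ) {v : H10 Ω} {c : E d → ℝ}
    (hc : ∀ a ∉ Ω, c a = 0)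
    (hp : ∀ a ∈ Ω, ∃ p : E d →ᵃ[ℝ] ℝ, p a = c a ∧
      ∀ q : E d →ᵃ[ℝ] ℝ, ∫ x in patch K a, (val v x - p x) * q x ∂(vol Ω) = 0)
    {s : Finset (E d)} (hs : s ∈ cells K) {z : E d}
    (hz : Metric.closedBall z (γ * h) ⊆ convexHull ℝ (s : Set (E d)) ∩ Ω) :
    ∃ m : ℝ, ∀ b ∈ s, (c b - m) ^ 2 * h ^ d ≤
      nodalConst d γ θ * h ^ 2 * ∫ x in Metric.closedBall z (2 * h), ‖grad v x‖ ^ 2 ∂(vol Ω) := by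
  have := isFiniteMeasure_vol hΩb
  -- The ball of radius `2 h` contains the patches of all vertices of the cell, so one mean `m`
  -- serves them all.
  obtain ⟨m, hm⟩ := poincare_mean hΩb v z (R := 2 * h) (by positivity)
  refine ⟨m, fun b hb => ?_⟩
  set B := Metric.closedBall z (2 * h) with hB
  set G := ∫ x in B, ‖grad v x‖ ^ 2 ∂(vol Ω)
  have hG : 0 ≤ G := integral_nonneg fun x => by positivity
  have hV := unitVol_pos (d := d)
  have hI := invConst_pos (d := d) hγ
  have hzs : z ∈ convexHull ℝ (s : Set (E d)) := (hz (Metric.mem_closedBall_self (by positivity))).1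
  have hbs : b ∈ convexHull ℝ (s : Set (E d)) := subset_convexHull ℝ _ (Finset.mem_coe.2 hb)
  have hbz := hK.norm_sub_le_of_mem hs hbs hzs
  have hvol : (vol Ω).real B ≤ volume.real B :=
    ENNReal.toReal_mono (isCompact_closedBall _ _).measure_lt_top.ne (Measure.restrict_apply_le _ _)
  have hint : 0 ≤ ∫ x in B, (val v x - m) ^ 2 ∂(vol Ω) := integral_nonneg fun x => sq_nonneg _
  have hmG : 2 ^ d * (2 * (2 * h)) ^ 2 * G = 2 ^ d * 16 * h ^ 2 * G := by ring
  rw [hmG] at hm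
  have hconst : nodalConst d γ θ * h ^ 2 * G = invConst d γ * (2 ^ d * 16 * h ^ 2 * G) +
      1 / (θ ^ d * unitVol d) * (2 ^ d * 16 * h ^ 2 * G) := by unfold nodalConst; ring
  rw [hconst]
  by_cases hbΩ : b ∈ Ω
  · obtain ⟨p, hpb, hpo⟩ := hp b hbΩ
    have h1 := sq_affine_mul_pow_le (p - AffineMap.const ℝ (E d) m) hh hγ hbz
    simp only [AffineMap.coe_sub, AffineMap.coe_const, Pi.sub_apply, Function.const_apply, hpb] at h1
    have hpc := p.continuous_of_finiteDimensional
    have hball : MeasurableSet (Metric.closedBall z (γ * h)) := Metric.isClosed_closedBall.measurableSet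
    have e : ∫ x in Metric.closedBall z (γ * h), (p x - m) ^ 2 =
        ∫ x in Metric.closedBall z (γ * h), (p x - m) ^ 2 ∂(vol Ω) := by
      rw [Measure.restrict_restrict hball, Set.inter_eq_left.2 fun x hx => (hz hx).2]
    have hsub : Metric.closedBall z (γ * h) ⊆ patch K b := fun x hx =>
      Set.mem_biUnion (show s ∈ {s | s ∈ cells K ∧ b ∈ s} from ⟨hs, hb⟩) (hz hx).1
    have i1 : Integrable (fun x => (p x - m) ^ 2) (vol Ω) :=
      (memLp_vol_of_continuous hΩb (hpc.sub continuous_const)).integrable_sq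
    have i2 : Integrable (fun x => (val v x - m) ^ 2) (vol Ω) :=
      (memLp_sub_const hΩb (val v) m).integrable_sq
    -- The inner ball lies in the patch, where the projection is no further from `m` than `v`; the
    -- patch lies in the large ball, where Poincaré applies.
    have h2 : ∫ x in Metric.closedBall z (γ * h), (p x - m) ^ 2 ≤ 2 ^ d * 16 * h ^ 2 * G := by
      rw [e]
      calc _ ≤ ∫ x in patch K b, (p x - m) ^ 2 ∂(vol Ω) :=
            setIntegral_mono_set i1.integrableOn
              (Filter.Eventually.of_forall fun x => sq_nonneg _) (LE.le.eventuallyLE hsub)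
        _ ≤ ∫ x in patch K b, (val v x - m) ^ 2 ∂(vol Ω) := integral_sq_proj_sub_le hΩb hpo m
        _ ≤ ∫ x in B, (val v x - m) ^ 2 ∂(vol Ω) :=
            setIntegral_mono_set i2.integrableOn
              (Filter.Eventually.of_forall fun x => sq_nonneg _)
              (LE.le.eventuallyLE (hK.patch_subset hs hzs hb))
        _ ≤ _ := by nlinarith [mul_nonneg (sq_nonneg m) (sub_nonneg.2 hvol)]
    have h3 : 0 ≤ 1 / (θ ^ d * unitVol d) * (2 ^ d * 16 * h ^ 2 * G) := by positivity
    have h4 := mul_le_mul_of_nonneg_left h2 hI.le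
    linarith
  -- At a boundary vertex the nodal value is `0`, so `m` itself must be small: the extension by zero
  -- vanishes on an exterior ball of radius `θ h` inside `B`.
  · have hbc : b ∈ closure Ω := convexHull_subset_closure hK.isTriangulation hs.1 hbs
    obtain ⟨y, hy⟩ := hK.exists_exterior_ball b hbc hbΩ
    have hyB : Metric.closedBall y (θ * h) ⊆ B := fun x hx => by
      have h1 := (hy hx).1
      rw [mem_closedBall_iff_norm] at h1 ⊢
      calc ‖x - z‖ = ‖(x - b) + (b - z)‖ := by rw [sub_add_sub_cancel]
        _ ≤ _ := norm_add_le _ _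
        _ ≤ 2 * h := by linarith
    have hdis : Disjoint (B ∩ Ω) (Metric.closedBall y (θ * h)) :=
      Set.disjoint_left.2 fun x hx hx' => (hy hx').2 hx.2
    have hle : (vol Ω).real B + volume.real (Metric.closedBall y (θ * h)) ≤ volume.real B := by
      have h1 : (vol Ω).real B = volume.real (B ∩ Ω) := by
        rw [Measure.real, Measure.restrict_apply Metric.isClosed_closedBall.measurableSet, Measure.real]
      have hfin : volume B ≠ ⊤ := (isCompact_closedBall _ _).measure_lt_top.ne
      rw [h1, ← measureReal_union hdis Metric.isClosed_closedBall.measurableSet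
        (measure_ne_top_of_subset Set.inter_subset_left hfin)
        (isCompact_closedBall _ _).measure_lt_top.ne]
      exact measureReal_mono (Set.union_subset Set.inter_subset_left hyB) hfin
    rw [volume_real_closedBall _ (by positivity), mul_pow] at hle
    have h2 : m ^ 2 * (θ ^ d * h ^ d * unitVol d) ≤ 2 ^ d * 16 * h ^ 2 * G := by
      have := mul_le_mul_of_nonneg_left (le_sub_iff_add_le'.2 hle) (sq_nonneg m)
      linarith
    have h3 : m ^ 2 * h ^ d ≤ 1 / (θ ^ d * unitVol d) * (2 ^ d * 16 * h ^ 2 * G) := by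
      rw [one_div, inv_mul_eq_div, le_div_iff₀ (by positivity)]
      linarith
    have h4 : 0 ≤ invConst d γ * (2 ^ d * 16 * h ^ 2 * G) := by positivity
    rw [hc b hbΩ, zero_sub, neg_sq]
    linarith

/-- The local stability estimate. -/
lemma IsRegularMesh.integral_norm_grad_sq_le {γ θ h : ℝ} (hΩb : Bornology.IsBounded Ω)
    (hK : IsRegularMesh Ω K γ θ h) (hh : 0 < h) (hγ : 0 < γ) (hθ : 0 < θ) {v u : H10 Ω}
    {c : E d → ℝ} (hc : ∀ a ∉ Ω, c a = 0)
    (hp : ∀ a ∈ Ω, ∃ p : E d →ᵃ[ℝ] ℝ, p a = c a ∧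
      ∀ q : E d →ᵃ[ℝ] ℝ, ∫ x in patch K a, (val v x - p x) * q x ∂(vol Ω) = 0)
    (hu : val u =ᵐ[vol Ω] nodalInterp K c) {s : Finset (E d)} (hs : s ∈ cells K) {z : E d}
    (hz : Metric.closedBall z (γ * h) ⊆ convexHull ℝ (s : Set (E d)) ∩ Ω) :
    ∫ x in convexHull ℝ (s : Set (E d)), ‖grad u x‖ ^ 2 ∂(vol Ω) ≤
      4 * nodalConst d γ θ * unitVol d / γ ^ 2 *
        ∫ x in Metric.closedBall z (2 * h), ‖grad v x‖ ^ 2 ∂(vol Ω) := by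
  have := isFiniteMeasure_vol hΩb
  obtain ⟨m, hm⟩ := hK.exists_sq_nodal_sub_le hΩb hh hγ hθ hc hp hs hz
  set G := ∫ x in Metric.closedBall z (2 * h), ‖grad v x‖ ^ 2 ∂(vol Ω)
  have hG : 0 ≤ G := integral_nonneg fun x => by positivity
  have hV := unitVol_pos (d := d)
  have hN := nodalConst_pos (d := d) hγ hθ
  obtain ⟨p, hpc, hpe⟩ := exists_affine_eqOn hs c
  set T := convexHull ℝ (s : Set (E d)) with hT
  have hTm : MeasurableSet T := measurableSet_convexHull s
  -- `M` bounds the deviation from `m` at the vertices, hence by convexity on the whole cell; an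
  -- affine function with this oscillation on a ball of radius `γ h` has gradient at most `2 M / (γ
  -- h)`.
  set M := √(nodalConst d γ θ * h ^ 2 * G / h ^ d) with hM
  have hM2 : M ^ 2 = nodalConst d γ θ * h ^ 2 * G / h ^ d := Real.sq_sqrt (by positivity)
  have hvert : ∀ b ∈ s, |p b - m| ≤ M := fun b hb => by
    rw [hpc b hb]
    exact Real.abs_le_sqrt ((le_div_iff₀ (by positivity)).2 (hm b hb))
  have hhull : ∀ x ∈ T, |p x - m| ≤ M := by
    have hconv : Convex ℝ {x | |p x - m| ≤ M} := by
      have : {x | |p x - m| ≤ M} = p ⁻¹' Set.Icc (m - M) (m + M) := by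
        ext x
        simp only [Set.mem_ofPred_eq, Set.mem_preimage, Set.mem_Icc, abs_le]
        constructor <;> rintro ⟨h1, h2⟩ <;> constructor <;> linarith
      rw [this]
      exact (convex_Icc _ _).affine_preimage p
    exact convexHull_min (fun b hb => hvert b hb) hconv
  have hgr : ∀ x, ‖gradient p x‖ ≤ 2 * M / (γ * h) :=
    norm_gradient_affine_le p (by positivity) (Real.sqrt_nonneg _) fun x hx => hhull x (hz hx).1
  have hae : ∀ᵐ x ∂((vol Ω).restrict T), ‖grad u x‖ ^ 2 ≤ (2 * M / (γ * h)) ^ 2 := by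
    rw [ae_restrict_iff' hTm]
    have h1 := grad_ae_eq_gradient u isOpen_interior
      (interior_convexHull_subset hK.isTriangulation hs.1) (contDiff_affineMap p)
      (by filter_upwards [hu] with x hx hxT
          rw [hx]; exact hpe (interior_subset hxT))
    -- The weak gradient is identified only in the interior of the cell; the boundary of a convex
    -- set is null.
    have h2 : ∀ᵐ x ∂(vol Ω), x ∉ frontier T := by
      refine ae_restrict_of_ae ?_
      rw [ae_iff]
      simpa using (convex_convexHull ℝ (s : Set (E d))).addHaar_frontier volume
    filter_upwards [h1, h2] with x h1 h2 hxT
    have hxi : x ∈ interior T := by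
      by_contra hxi
      exact h2 ⟨subset_closure hxT, hxi⟩
    rw [h1 hxi]
    exact pow_le_pow_left₀ (norm_nonneg _) (hgr x) 2
  have hvolT : (vol Ω).real T ≤ h ^ d * unitVol d := by
    rw [← volume_real_closedBall z hh.le]
    refine (ENNReal.toReal_mono ((isBounded_convexHull_finset s).measure_lt_top).ne
      (Measure.restrict_apply_le _ _)).trans ?_
    refine measureReal_mono (fun x hx => ?_) (isCompact_closedBall _ _).measure_lt_top.ne
    rw [mem_closedBall_iff_norm]
    exact hK.norm_sub_le_of_mem hs hx (hz (Metric.mem_closedBall_self (by positivity))).1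
  calc ∫ x in T, ‖grad u x‖ ^ 2 ∂(vol Ω) ≤ ∫ _ in T, (2 * M / (γ * h)) ^ 2 ∂(vol Ω) :=
        integral_mono_ae (integrable_norm_sq _).restrict (integrable_const _) hae
    _ = (vol Ω).real T * (2 * M / (γ * h)) ^ 2 := by rw [setIntegral_const, smul_eq_mul]
    _ ≤ h ^ d * unitVol d * (2 * M / (γ * h)) ^ 2 := by gcongr
    _ = _ := by
      rw [div_pow, mul_pow 2 M, hM2]
      field_simp
      ring

/-- The balls attached to the cells overlap boundedly often. -/
lemma IsRegularMesh.card_le {γ θ h : ℝ} (hK : IsRegularMesh Ω K γ θ h) (hh : 0 < h) (hγ : 0 < γ)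
    {z : Finset (E d) → E d} (hz : ∀ s ∈ cells K,
      Metric.closedBall (z s) (γ * h) ⊆ convexHull ℝ (s : Set (E d)) ∩ Ω) {x : E d}
    {S : Finset (Finset (E d))} (hS : ∀ s ∈ S, s ∈ cells K)
    (hx : ∀ s ∈ S, x ∈ Metric.closedBall (z s) (2 * h)) : (S.card : ℝ) ≤ (3 / γ) ^ d := by
  have hV := unitVol_pos (d := d)
  have hfin : ∀ s : Finset (E d), volume (convexHull ℝ (s : Set (E d))) ≠ ⊤ := fun s =>
    (isBounded_convexHull_finset s).measure_lt_top.ne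
  -- Volume packing: the cells are disjoint up to null sets, lie in a ball of radius `3 h`, and each
  -- contains a ball of radius `γ h`.
  have h1 : volume (⋃ s ∈ S, convexHull ℝ (s : Set (E d))) =
      ∑ s ∈ S, volume (convexHull ℝ (s : Set (E d))) :=
    measure_biUnion_finset₀
      (fun s hs t ht hst => volume_inter_cells_eq_zero (hS s hs) (hS t ht) hst)
      fun s _ => (measurableSet_convexHull s).nullMeasurableSet
  have h2 : (⋃ s ∈ S, convexHull ℝ (s : Set (E d))) ⊆ Metric.closedBall x (3 * h) := by
    refine Set.iUnion₂_subset fun s hs y hy => ?_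
    have e1 := hK.norm_sub_le_of_mem (hS s hs) hy
      (hz s (hS s hs) (Metric.mem_closedBall_self (by positivity))).1
    have e2 := hx s hs
    rw [mem_closedBall_iff_norm] at e2 ⊢
    calc ‖y - x‖ = ‖(y - z s) - (x - z s)‖ := by rw [sub_sub_sub_cancel_right]
      _ ≤ _ := norm_sub_le _ _
      _ ≤ 3 * h := by linarith
  have h3 := measureReal_mono (μ := volume) h2 (isCompact_closedBall _ _).measure_lt_top.ne
  rw [Measure.real, h1, ENNReal.toReal_sum fun s _ => hfin s,
    volume_real_closedBall _ (by positivity)] at h3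
  have h4 : (S.card : ℝ) * ((γ * h) ^ d * unitVol d) ≤
      ∑ s ∈ S, (volume (convexHull ℝ (s : Set (E d)))).toReal := by
    rw [← nsmul_eq_mul]
    refine Finset.card_nsmul_le_sum _ _ _ fun s hs => ?_
    rw [← volume_real_closedBall (z s) (by positivity)]
    exact measureReal_mono (fun y hy => (hz s (hS s hs) hy).1) (hfin s)
  have h5 : (S.card : ℝ) * ((γ * h) ^ d * unitVol d) ≤ (3 * h) ^ d * unitVol d := h4.trans h3
  rw [← mul_assoc] at h5
  have h6 := le_of_mul_le_mul_right h5 hV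
  rw [div_pow, le_div_iff₀ (by positivity)]
  rw [mul_pow, mul_pow, ← mul_assoc] at h6
  exact le_of_mul_le_mul_right h6 (by positivity)

/-- The stability estimate for the gradients. -/
lemma IsRegularMesh.norm_grad_sq_le {γ θ h : ℝ} (hΩo : IsOpen Ω) (hΩb : Bornology.IsBounded Ω)
    (hK : IsRegularMesh Ω K γ θ h) (hh : 0 < h) (hγ : 0 < γ) (hθ : 0 < θ) {v u : H10 Ω}
    {c : E d → ℝ} (hc : ∀ a ∉ Ω, c a = 0)
    (hp : ∀ a ∈ Ω, ∃ p : E d →ᵃ[ℝ] ℝ, p a = c a ∧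
      ∀ q : E d →ᵃ[ℝ] ℝ, ∫ x in patch K a, (val v x - p x) * q x ∂(vol Ω) = 0)
    (hu : val u =ᵐ[vol Ω] nodalInterp K c) :
    ‖grad u‖ ^ 2 ≤ 4 * nodalConst d γ θ * unitVol d / γ ^ 2 * (3 / γ) ^ d * ‖grad v‖ ^ 2 := by
  classical
  have hex : ∀ s : Finset (E d), ∃ z, s ∈ cells K →
      Metric.closedBall z (γ * h) ⊆ convexHull ℝ (s : Set (E d)) ∩ Ω := fun s => by
    by_cases hs : s ∈ cells K
    · obtain ⟨z, hz⟩ := hK.exists_ball s hs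
      exact ⟨z, fun _ => hz⟩
    · exact ⟨0, fun h => absurd h hs⟩
  choose z hz using hex
  set C := 4 * nodalConst d γ θ * unitVol d / γ ^ 2 with hC
  have hC0 : 0 < C := by
    have := nodalConst_pos (d := d) hγ hθ
    have := unitVol_pos (d := d)
    positivity
  set S := hK.isTriangulation.finite_cells.toFinset with hS
  have hSmem : ∀ s, s ∈ S ↔ s ∈ cells K := fun s => Set.Finite.mem_toFinset _
  have hsum : ∀ (w : H10 Ω) (A : Finset (E d) → Set (E d)), (∀ s ∈ S, MeasurableSet (A s)) →
      Integrable (fun x => ∑ s ∈ S, (A s).indicator (fun x => ‖grad w x‖ ^ 2) x) (vol Ω) ∧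
      ∫ x in Ω, ∑ s ∈ S, (A s).indicator (fun x => ‖grad w x‖ ^ 2) x =
        ∑ s ∈ S, ∫ x in A s, ‖grad w x‖ ^ 2 ∂(vol Ω) := by
    intro w A hA
    have hi : ∀ s ∈ S, Integrable ((A s).indicator fun x => ‖grad w x‖ ^ 2) (vol Ω) := fun s hs =>
      (integrable_norm_sq _).indicator (hA s hs)
    refine ⟨integrable_finsetSum _ hi, ?_⟩
    rw [integral_finsetSum _ hi]
    exact Finset.sum_congr rfl fun s hs => integral_indicator (hA s hs)
  obtain ⟨i1, e1⟩ := hsum u (fun s => convexHull ℝ (s : Set (E d))) fun s _ =>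
    measurableSet_convexHull s
  obtain ⟨i2, e2⟩ := hsum v (fun s => Metric.closedBall (z s) (2 * h)) fun s _ =>
    Metric.isClosed_closedBall.measurableSet
  have h1 : ‖grad u‖ ^ 2 ≤ ∑ s ∈ S, ∫ x in convexHull ℝ (s : Set (E d)), ‖grad u x‖ ^ 2 ∂(vol Ω) := by
    rw [norm_sq_eq_integral, ← e1]
    refine integral_mono_ae (integrable_norm_sq _) i1 ?_
    filter_upwards [ae_restrict_mem hΩo.measurableSet] with x hx
    obtain ⟨s, hs, hxs⟩ := Set.mem_iUnion₂.1 (subset_biUnion_cells hΩo hK.isTriangulation hx)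
    have h2 := Finset.single_le_sum
      (f := fun s : Finset (E d) => (convexHull ℝ (s : Set (E d))).indicator (fun x => ‖grad u x‖ ^ 2) x)
      (fun t _ => Set.indicator_nonneg (fun y _ => by positivity) x) ((hSmem s).2 hs)
    simpa only [Set.indicator_of_mem hxs] using h2
  have h2 : ∑ s ∈ S, ∫ x in Metric.closedBall (z s) (2 * h), ‖grad v x‖ ^ 2 ∂(vol Ω) ≤
      (3 / γ) ^ d * ‖grad v‖ ^ 2 := by
    rw [norm_sq_eq_integral, ← e2, ← integral_const_mul]
    refine integral_mono i2 ((integrable_norm_sq _).const_mul _) fun x => ?_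
    -- At each `x` the sum counts the balls containing `x`, and their number is bounded by the
    -- packing estimate.
    simp only [Set.indicator_apply]
    rw [← Finset.sum_filter, Finset.sum_const, nsmul_eq_mul]
    refine mul_le_mul_of_nonneg_right ?_ (by positivity)
    refine hK.card_le hh hγ (fun s hs => hz s hs) (x := x) (fun s hs => ?_) fun s hs => ?_
    · exact (hSmem s).1 (Finset.mem_filter.1 hs).1
    · exact (Finset.mem_filter.1 hs).2
  calc ‖grad u‖ ^ 2
      ≤ ∑ s ∈ S, C * ∫ x in Metric.closedBall (z s) (2 * h), ‖grad v x‖ ^ 2 ∂(vol Ω) :=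
        h1.trans (Finset.sum_le_sum fun s hs => hK.integral_norm_grad_sq_le hΩb hh hγ hθ hc hp hu
          ((hSmem s).1 hs) (hz s ((hSmem s).1 hs)))
    _ ≤ C * ((3 / γ) ^ d * ‖grad v‖ ^ 2) := by
        rw [← Finset.mul_sum]; exact mul_le_mul_of_nonneg_left h2 hC0.le
    _ = _ := by ring

end EllipticID

end

noncomputable section

namespace EllipticID

variable {d : ℕ} {Ω : Set (E d)} {K : Mesh d}

/-! ### Uniform Lipschitz continuity of Clément's operator -/

open Classical in
lemma val_clement (hΩo : IsOpen Ω) (hΩb : Bornology.IsBounded Ω) (hK : IsTriangulation Ω K)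
    (v : H10 Ω) : val (clement K v) =ᵐ[vol Ω]
      nodalInterp K (fun a => if a ∈ Ω then localProj K (val v) a a else 0) := by
  have h : ∃ u : H10 Ω, val u =ᵐ[vol Ω] clementFun K (val v) :=
    exists_H10_nodalInterp hΩo hΩb hK fun a ha => by simp [ha]
  rw [clement, dif_pos h]
  exact h.choose_spec

lemma clement_mem_Vh (hΩo : IsOpen Ω) (hΩb : Bornology.IsBounded Ω) (hK : IsTriangulation Ω K)
    (v : H10 Ω) : clement K v ∈ Vh Ω K := by
  classical
  exact mem_Vh_of_val_eq_nodalInterp hΩo hK (fun a ha => by simp [ha]) (val_clement hΩo hΩb hK v)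

/-- The Clément operator is Lipschitz continuous, with a constant that depends on the mesh only
through its regularity constants. -/
lemma IsRegularMesh.norm_grad_clement_sub_sq_le {γ θ h : ℝ} (hΩo : IsOpen Ω)
    (hΩb : Bornology.IsBounded Ω) (hK : IsRegularMesh Ω K γ θ h) (hh : 0 < h) (hγ : 0 < γ)
    (hθ : 0 < θ) (v w : H10 Ω) :
    ‖grad (clement K v - clement K w)‖ ^ 2 ≤
      4 * nodalConst d γ θ * unitVol d / γ ^ 2 * (3 / γ) ^ d * ‖grad (v - w)‖ ^ 2 := by
  classical
  have hT := hK.isTriangulation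
  set cv : E d → ℝ := fun a => if a ∈ Ω then localProj K (val v) a a else 0 with hcv
  set cw : E d → ℝ := fun a => if a ∈ Ω then localProj K (val w) a a else 0 with hcw
  refine hK.norm_grad_sq_le (c := fun a => cv a + -1 * cw a) hΩo hΩb hh hγ hθ
    (fun a ha => by simp [hcv, hcw, ha]) (fun a ha => ?_) ?_
  -- Orthogonality is linear, so the difference of the two chosen projections is a projection of `v
  -- - w`, without any appeal to uniqueness.
  · refine ⟨localProj K (val v) a - localProj K (val w) a, ?_, fun q => ?_⟩
    · simp only [hcv, hcw, ha, if_true, AffineMap.coe_sub, Pi.sub_apply]; ring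
    · have m : ∀ u : H10 Ω, Integrable (fun x => (val u x - localProj K (val u) a x) * q x)
          ((vol Ω).restrict (patch K a)) := fun u =>
        (((Lp.memLp (val u)).sub (memLp_vol_of_continuous hΩb
          (localProj K (val u) a).continuous_of_finiteDimensional)).integrable_mul
          (memLp_vol_of_continuous hΩb q.continuous_of_finiteDimensional)).restrict
      have e := integral_sub (m v) (m w)
      rw [localProj_spec hΩb, localProj_spec hΩb, sub_zero] at e
      rw [← e]
      refine integral_congr_ae (ae_restrict_of_ae ?_)
      filter_upwards [Lp.coeFn_sub (val v) (val w)] with x hx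
      rw [val_sub, hx]
      simp only [AffineMap.coe_sub, Pi.sub_apply]
      ring
  · rw [val_sub]
    filter_upwards [Lp.coeFn_sub (val (clement K v)) (val (clement K w)),
      val_clement hΩo hΩb hT v, val_clement hΩo hΩb hT w] with x hx h1 h2
    rw [hx, Pi.sub_apply, h1, h2, nodalInterp_add, nodalInterp_smul]
    ring

/-- The inscribed radius is at least `c * (c * h)` by quasi-uniformity; halving it gives a closed
ball in the interior of the cell, hence in `Ω`. -/
lemma IsRegularQuasiUniform.exists_isRegularMesh (hΩo : IsOpen Ω) (hΩb : Bornology.IsBounded Ω)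
    {T : ℝ → Mesh d} (hT : IsRegularQuasiUniform Ω T) :
    ∃ γ θ : ℝ, 0 < γ ∧ 0 < θ ∧ ∀ h ∈ Set.Ioo (0 : ℝ) 1, IsRegularMesh Ω (T h) γ θ h := by
  obtain ⟨h1, c, hc, h2⟩ := hT
  -- The exterior ball property concerns `Ω` alone, so any one mesh of the family provides a `θ`
  -- valid for all `h`.
  obtain ⟨θ, hθ, hext⟩ := exists_exterior_ball hΩo hΩb (h1 (1 / 2) (by norm_num)).1
  refine ⟨c ^ 2 / 2, θ, by positivity, hθ, fun h hh => ⟨(h1 h hh).1, (h1 h hh).2, fun s hs => ?_,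
    fun a ha ha' => hext a ha ha' h hh.1 hh.2.le⟩⟩
  obtain ⟨⟨z, hz⟩, hd⟩ := h2 h hh s hs
  have hsub : Metric.closedBall z (c ^ 2 / 2 * h) ⊆ interior (convexHull ℝ (s : Set (E d))) := by
    have h3 : c * (c * h) ≤ c * Metric.diam (convexHull ℝ (s : Set (E d))) :=
      mul_le_mul_of_nonneg_left hd hc.le
    have h4 : Metric.ball z (c * (c * h)) ⊆ convexHull ℝ (s : Set (E d)) :=
      (Metric.ball_subset_closedBall.trans (Metric.closedBall_subset_closedBall h3)).trans hz
    have h5 : 0 < c * (c * h) := mul_pos hc (mul_pos hc hh.1)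
    exact (Metric.closedBall_subset_ball (by linarith)).trans
      (interior_maximal h4 Metric.isOpen_ball)
  exact ⟨z, Set.subset_inter (hsub.trans interior_subset)
    (hsub.trans (interior_convexHull_subset (h1 h hh).1 hs.1))⟩

/-- The Clément operators of a regular and quasi-uniform family are uniformly Lipschitz. -/
lemma IsRegularQuasiUniform.exists_norm_clement_sub_le (hd : 1 ≤ d) (hΩo : IsOpen Ω)
    (hΩb : Bornology.IsBounded Ω) {T : ℝ → Mesh d} (hT : IsRegularQuasiUniform Ω T) :
    ∃ C : ℝ, 0 < C ∧ ∀ h ∈ Set.Ioo (0 : ℝ) 1, ∀ v w : H10 Ω,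
      ‖clement (T h) v - clement (T h) w‖ ≤ C * ‖v - w‖ := by
  obtain ⟨γ, θ, hγ, hθ, hreg⟩ := hT.exists_isRegularMesh hΩo hΩb
  obtain ⟨P, hP, hpoin⟩ := exists_norm_sq_le_grad hd hΩb
  set D := 4 * nodalConst d γ θ * unitVol d / γ ^ 2 * (3 / γ) ^ d
  have hD : 0 < D := by
    have := nodalConst_pos (d := d) hγ hθ
    have := unitVol_pos (d := d)
    positivity
  refine ⟨√(P * D), by positivity, fun h hh v w => ?_⟩
  refine le_of_sq_le_sq ?_ (by positivity)
  rw [mul_pow, Real.sq_sqrt (by positivity), mul_assoc]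
  refine (hpoin _).trans (mul_le_mul_of_nonneg_left ?_ hP.le)
  refine ((hreg h hh).norm_grad_clement_sub_sq_le hΩo hΩb hh.1 hγ hθ v w).trans ?_
  exact mul_le_mul_of_nonneg_left (pow_le_pow_left₀ (norm_nonneg _) (norm_grad_le _) 2) hD.le

/-! ### The error estimate -/

lemma IsTriangulation.completeSpace_Vh (hΩo : IsOpen Ω) (hΩb : Bornology.IsBounded Ω)
    (hK : IsTriangulation Ω K) : CompleteSpace (Vh Ω K) :=
  have := finiteDimensional_Vh hΩo hΩb hK.finite_cells (subset_biUnion_cells hΩo hK)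
  FiniteDimensional.complete ℝ _

/-- The consequence of minimality. -/
lemma IsDiscRegSol.cost_add_le (hΩb : Bornology.IsBounded Ω) {qlo qhi : ℝ} {f : L2 Ω} {z : H10 Ω}
    {ρ : ℝ} {Qh Qd : LinfMat Ω} (hQh : IsDiscRegSol qlo qhi K f z ρ Qh) (hQd : Qd ∈ Qad Ω qlo qhi) :
    discCost K f z Qh + ρ * normSqL2 (Qh - Qd) ≤
      discCost K f z Qd + ρ * (2 * pairing (Qd - Qh) Qd) := by
  have h1 := hQh.2 Qd hQd
  rw [← normSqL2_sub_eq hΩb Qd Qh]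
  linarith

lemma sq_norm_sub_le {V : Type*} [SeminormedAddCommGroup V] (x y z : V) :
    ‖x - z‖ ^ 2 ≤ 2 * ‖x - y‖ ^ 2 + 2 * ‖y - z‖ ^ 2 := by
  have h := norm_sub_le_norm_sub_add_norm_sub x y z
  nlinarith [sq_nonneg (‖x - y‖ - ‖y - z‖), norm_nonneg (x - z)]

/-- The splitting of the source term. -/
lemma form_sub_solOp_eq [CompleteSpace (Vh Ω K)] {f : L2 Ω} {Q P : LinfMat Ω}
    (hQ : IsCoercive (formB Q)) (hP : IsCoercive (formB P)) (w : H10 Ω) {y : H10 Ω}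
    (hy : y ∈ Vh Ω K) :
    form (Q - P) (solOp f Q) w = form (Q - P) (solOp f Q) (w - y) +
      form P (discSolOp K f P - solOp f Q) w + form P (discSolOp K f P - solOp f Q) (y - w) := by
  -- Tested with `y ∈ V_h`, the exact and the discrete equation have the same right-hand side, so
  -- `form Q (U(Q)) y` may be replaced by `form P (U_h(P)) y`.
  have h1 := solOp_spec (f := f) hQ y
  have h2 := (discSolOp_spec (K := K) (f := f) hP).2 y hy
  simp only [form_sub_coeff, form_sub_left, form_sub_right]
  linarith

/-- The energy estimate, stated so that it covers both the exact and the discrete solution. -/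
lemma norm_le_of_form_self_eq {κ : ℝ} (hκ : 0 < κ) {f : L2 Ω} {Q : LinfMat Ω} {u : H10 Ω}
    (hQ : κ * ‖u‖ ^ 2 ≤ form Q u u) (hu : form Q u u = load f u) : ‖u‖ ≤ ‖loadL f‖ / κ := by
  rw [le_div_iff₀ hκ]
  rcases (norm_nonneg u).eq_or_lt with h0 | h0
  · rw [← h0, zero_mul]; exact norm_nonneg _
  · have h1 : load f u ≤ ‖loadL f‖ * ‖u‖ := by
      rw [← loadL_apply]; exact (le_abs_self _).trans ((loadL f).le_opNorm u)
    refine le_of_mul_le_mul_right ?_ h0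
    linarith [sq ‖u‖]

/-- The absorption argument behind the error estimate: `e` is the error of the state, `N` that of the
coefficient, `x`, `y`, `t` are distances to the interpolated data and `b` is the interpolation error
caused by the noise. -/
lemma error_arithmetic {κ A ρ e x y t g gw σ a b S δ L N P J₁ J₂ W : ℝ} (hκ : 0 < κ) (hA : 0 ≤ A)
    (hρ : 0 < ρ) (he0 : 0 ≤ e) (hy0 : 0 ≤ y) (ht0 : 0 ≤ t) (hb : b = S * δ)
    (hmin : J₁ + ρ * N ≤ J₂ + ρ * (2 * P)) (hJ₁ : κ * x ^ 2 ≤ J₁) (hJ₂ : J₂ ≤ A * t ^ 2)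
    (hP : P ≤ 2 * A * a * gw + A * e * W + A * e * gw) (hy : y ≤ g + b) (ht : t ≤ σ + (g + b))
    (he : e ^ 2 ≤ 2 * x ^ 2 + 2 * y ^ 2) (heL : e ≤ L) :
    κ / 4 * e ^ 2 + ρ * N ≤ ((3 * A + 2 * κ) * (1 + S ^ 2) + (4 * A ^ 2 * a ^ 2 +
      4 * A ^ 2 * W ^ 2 / κ + A ^ 2 * L ^ 2) + 2) * (δ ^ 2 + σ ^ 2 + g ^ 2 + gw ^ 2 + ρ ^ 2) := by
  have q1 : y ^ 2 ≤ 2 * (g ^ 2 + b ^ 2) :=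
    (pow_le_pow_left₀ hy0 hy 2).trans (by nlinarith [sq_nonneg (g - b)])
  have q2 : t ^ 2 ≤ 3 * (σ ^ 2 + g ^ 2 + b ^ 2) :=
    (pow_le_pow_left₀ ht0 ht 2).trans (by
      nlinarith [sq_nonneg (g - b), sq_nonneg (σ - g), sq_nonneg (σ - b)])
  have y1 : ρ * (4 * A * a * gw) ≤ 4 * A ^ 2 * a ^ 2 * ρ ^ 2 + gw ^ 2 := by
    have := sq_nonneg (2 * A * a * ρ - gw)
    linarith
  -- Young's inequality, weighted to use only `κ / 4` of the available `κ / 2` times `e ^ 2`; the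
  -- remaining `κ / 4` is the one in the claim.
  have y2 : ρ * (2 * A * e * W) ≤ κ / 4 * e ^ 2 + 4 * A ^ 2 * W ^ 2 / κ * ρ ^ 2 := by
    have h1 : κ / 4 * e ^ 2 + 4 * A ^ 2 * W ^ 2 / κ * ρ ^ 2 - ρ * (2 * A * e * W) =
        (κ * e / 2 - 2 * A * W * ρ) ^ 2 / κ := by field_simp; ring
    have h2 : 0 ≤ (κ * e / 2 - 2 * A * W * ρ) ^ 2 / κ := by positivity
    linarith
  -- Here the a priori bound `e ≤ L` is used instead of absorption.
  have y3 : ρ * (2 * A * e * gw) ≤ A ^ 2 * L ^ 2 * ρ ^ 2 + gw ^ 2 := by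
    have h1 : A ^ 2 * e ^ 2 * ρ ^ 2 ≤ A ^ 2 * L ^ 2 * ρ ^ 2 := by gcongr
    have := sq_nonneg (A * e * ρ - gw)
    linarith
  have y0 := mul_le_mul_of_nonneg_left hP (mul_nonneg zero_le_two hρ.le)
  have c1 := mul_le_mul_of_nonneg_left q1 hκ.le
  have c2 := mul_le_mul_of_nonneg_left q2 hA
  have c3 := mul_le_mul_of_nonneg_left he hκ.le
  have main : κ / 4 * e ^ 2 + ρ * N ≤ (3 * A + 2 * κ) * (σ ^ 2 + g ^ 2 + b ^ 2) +
      (4 * A ^ 2 * a ^ 2 + 4 * A ^ 2 * W ^ 2 / κ + A ^ 2 * L ^ 2) * ρ ^ 2 + 2 * gw ^ 2 := by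
    have := mul_nonneg hκ.le (sq_nonneg σ)
    linarith
  refine main.trans ?_
  set M := 4 * A ^ 2 * a ^ 2 + 4 * A ^ 2 * W ^ 2 / κ + A ^ 2 * L ^ 2
  have hM : 0 ≤ M := by positivity
  have hAκ : 0 ≤ 3 * A + 2 * κ := by positivity
  set Z := δ ^ 2 + σ ^ 2 + g ^ 2 + gw ^ 2 + ρ ^ 2 with hZ
  have f1 : σ ^ 2 + g ^ 2 + b ^ 2 ≤ (1 + S ^ 2) * Z := by
    have : 0 ≤ S ^ 2 * (σ ^ 2 + g ^ 2 + gw ^ 2 + ρ ^ 2) + (δ ^ 2 + gw ^ 2 + ρ ^ 2) := by positivity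
    rw [hZ, hb]; linarith [mul_pow S δ 2]
  have f2 : ρ ^ 2 ≤ Z := by
    have : 0 ≤ δ ^ 2 + σ ^ 2 + g ^ 2 + gw ^ 2 := by positivity
    linarith
  have f3 : gw ^ 2 ≤ Z := by
    have : 0 ≤ δ ^ 2 + σ ^ 2 + g ^ 2 + ρ ^ 2 := by positivity
    linarith
  calc _ ≤ (3 * A + 2 * κ) * ((1 + S ^ 2) * Z) + M * Z + 2 * Z := by gcongr
    _ = _ := by ring

/-- The error estimate for one mesh; `A` bounds the bilinear forms, `S` is the Lipschitz constant of
the Clément operator. -/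
lemma IsDiscRegSol.errorBound [CompleteSpace (Vh Ω K)] (hΩb : Bornology.IsBounded Ω)
    {qlo qhi κ S A : ℝ} (hκ : IsCoercivityConst Ω qlo κ) (hA : 0 ≤ A)
    (hAQ : ∀ Q ∈ Qad Ω qlo qhi, ∀ u v : H10 Ω, |form Q u v| ≤ A * ‖u‖ * ‖v‖)
    (hcl : ∀ v : H10 Ω, clement K v ∈ Vh Ω K)
    (hstab : ∀ v w : H10 Ω, ‖clement K v - clement K w‖ ≤ S * ‖v - w‖) (hS : 0 ≤ S)
    {f : L2 Ω} {z w : H10 Ω} {δ ρ : ℝ} (hρ : 0 < ρ) {Qh Qd : LinfMat Ω}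
    (hQd : Qd ∈ Qad Ω qlo qhi) (hz : ‖z - solOp f Qd‖ ≤ δ)
    (hQh : IsDiscRegSol qlo qhi K f z ρ Qh)
    (hpair : pairing (Qd - Qh) Qd ≤ |form (Qd - Qh) (solOp f Qd) w|) :
    ErrorBound κ ((3 * A + 2 * κ) * (1 + S ^ 2) + (4 * A ^ 2 * ‖solOp f Qd‖ ^ 2 +
      4 * A ^ 2 * ‖w‖ ^ 2 / κ + A ^ 2 * (2 * (‖loadL f‖ / κ)) ^ 2) + 2) K f Qd w δ ρ Qh := by
  obtain ⟨hκ0, hκQ⟩ := hκ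
  have cd := IsCoercivityConst.isCoercive ⟨hκ0, hκQ⟩ hQd
  have ch := IsCoercivityConst.isCoercive ⟨hκ0, hκQ⟩ hQh.1
  obtain ⟨huV, huh⟩ := discSolOp_spec (K := K) (f := f) ch
  have hL1 := norm_le_of_form_self_eq hκ0 (hκQ _ _ hQh.1 _) (huh _ huV)
  have hL2 := norm_le_of_form_self_eq hκ0 (hκQ _ _ hQd _) (solOp_spec (f := f) cd _)
  have hmin := hQh.cost_add_le hΩb hQd
  have hsplit := form_sub_solOp_eq (K := K) (f := f) cd ch w (hcl w)
  have hcoer := hκQ _ _ hQh.1 (discSolOp K f Qh - clement K z)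
  have hcost := (le_abs_self _).trans
    (hAQ Qd hQd (discSolOp K f Qd - clement K z) (discSolOp K f Qd - clement K z))
  set U := solOp f Qd
  set u := discSolOp K f Qh
  have b1 : |form (Qd - Qh) U (w - clement K w)| ≤ 2 * A * ‖U‖ * gamma K w := by
    rw [form_sub_coeff]
    refine (abs_sub _ _).trans ?_
    have h1 := hAQ Qd hQd U (w - clement K w)
    have h2 := hAQ Qh hQh.1 U (w - clement K w)
    rw [gamma]; linarith
  have b2 := hAQ Qh hQh.1 (u - U) w
  have b3 := hAQ Qh hQh.1 (u - U) (clement K w - w)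
  rw [norm_sub_rev (clement K w) w, ← gamma] at b3
  have hpair' : pairing (Qd - Qh) Qd ≤
      2 * A * ‖U‖ * gamma K w + A * ‖u - U‖ * ‖w‖ + A * ‖u - U‖ * gamma K w := by
    refine hpair.trans ?_
    rw [hsplit]
    refine (abs_add_three _ _ _).trans ?_
    linarith
  have hcz : ‖clement K U - clement K z‖ ≤ S * δ := by
    refine (hstab U z).trans (mul_le_mul_of_nonneg_left ?_ hS)
    rwa [norm_sub_rev]
  -- Passing through `Π_h U(Q†)` separates the interpolation error from the propagated noise.
  have hUz : ‖U - clement K z‖ ≤ gamma K U + S * δ :=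
    (norm_sub_le_norm_sub_add_norm_sub U (clement K U) _).trans (add_le_add le_rfl hcz)
  have hUdz : ‖discSolOp K f Qd - clement K z‖ ≤ sigma K f Qd + (gamma K U + S * δ) := by
    refine (norm_sub_le_norm_sub_add_norm_sub _ U _).trans (add_le_add ?_ hUz)
    rw [norm_sub_rev]; rfl
  have he : ‖u - U‖ ^ 2 ≤ 2 * ‖u - clement K z‖ ^ 2 + 2 * ‖U - clement K z‖ ^ 2 := by
    have := sq_norm_sub_le u (clement K z) U
    rwa [norm_sub_rev (clement K z) U] at this
  have heE : ‖u - U‖ ≤ 2 * (‖loadL f‖ / κ) := by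
    linarith [norm_sub_le u U]
  change form Qd _ _ ≤ _ at hcost
  change κ / 4 * ‖u - U‖ ^ 2 + ρ * normSqL2 (Qh - Qd) ≤ _
  unfold discCost at hmin
  rw [mul_assoc, ← sq] at hcost
  exact error_arithmetic hκ0 hA hρ (norm_nonneg _) (norm_nonneg _) (norm_nonneg _) rfl hmin
    hcoer hcost hpair' hUz hUdz he heE

/-- The convergence rate with a constant independent of the mesh size, the data and the
regularization parameter. -/
lemma IsRegularQuasiUniform.exists_errorBound (hd : 1 ≤ d) (hΩo : IsOpen Ω)
    (hΩb : Bornology.IsBounded Ω) {T : ℝ → Mesh d} (hT : IsRegularQuasiUniform Ω T) {qlo qhi κ : ℝ}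
    (hqlo : 0 < qlo) (hqhi : 0 < qhi) (hκ : IsCoercivityConst Ω qlo κ) (f : L2 Ω) {Qd : LinfMat Ω}
    (hQd : Qd ∈ Qad Ω qlo qhi) (w : H10 Ω) : ∃ C : ℝ, ∀ h ∈ Set.Ioo (0 : ℝ) 1, ∀ δ > 0, ∀ ρ > 0,
      ∀ z : H10 Ω, ‖z - solOp f Qd‖ ≤ δ → ∀ Qh, IsDiscRegSol qlo qhi (T h) f z ρ Qh →
      pairing (Qd - Qh) Qd ≤ |form (Qd - Qh) (solOp f Qd) w| →
      ErrorBound κ C (T h) f Qd w δ ρ Qh := by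
  obtain ⟨S, hS, hstab⟩ := hT.exists_norm_clement_sub_le hd hΩo hΩb
  have hform : ∀ Q ∈ Qad Ω qlo qhi, ∀ u v : H10 Ω,
      |form Q u v| ≤ d ^ 2 * (2 * qhi) * ‖u‖ * ‖v‖ := fun Q hQ u v => by
    refine (abs_form_le Q u v).trans ?_
    gcongr
    exact norm_le_of_mem_Qad hqlo hqhi hQ
  set A : ℝ := d ^ 2 * (2 * qhi)
  refine ⟨(3 * A + 2 * κ) * (1 + S ^ 2) + (4 * A ^ 2 * ‖solOp f Qd‖ ^ 2 +
      4 * A ^ 2 * ‖w‖ ^ 2 / κ + A ^ 2 * (2 * (‖loadL f‖ / κ)) ^ 2) + 2,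
    fun h hh δ _ ρ hρ z hz Qh hQh hpair => ?_⟩
  have hK := (hT.1 h hh).1
  have := hK.completeSpace_Vh hΩo hΩb
  exact hQh.errorBound hΩb hκ (by positivity) hform (clement_mem_Vh hΩo hΩb hK) (hstab h hh) hS.le
    hρ hQd hz hpair

end EllipticID

end

theorem theorem5p1 {d : ℕ} (hd1 : 1 ≤ d) (hd3 : d ≤ 3)
    (Ω : Set (EllipticID.E d)) (hΩo : IsOpen Ω) (hΩb : Bornology.IsBounded Ω)
    (hΩc : IsConnected Ω)
    (T : ℝ → EllipticID.Mesh d) (hT : EllipticID.IsRegularQuasiUniform Ω T)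
    (qlo qhi : ℝ) (hqlo : 0 < qlo) (hqhi : 0 < qhi) (f : EllipticID.L2 Ω)
    (ubar : EllipticID.H10 Ω) (Qd : EllipticID.LinfMat Ω)
    (hQd : EllipticID.IsMinNormSol f qlo qhi ubar Qd) :
    -- the notions in the claim are well defined
    (∃ κ, EllipticID.IsCoercivityConst Ω qlo κ) ∧
    DifferentiableAt ℝ (EllipticID.solOp f) Qd ∧
    (∀ h ∈ Set.Ioo (0 : ℝ) 1, ∀ ρ > 0, ∀ z : EllipticID.H10 Ω,
      ∃! Qh, EllipticID.IsDiscRegSol qlo qhi (T h) f z ρ Qh) ∧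
    -- the rate under the source condition
    (∀ κ, EllipticID.IsCoercivityConst Ω qlo κ →
      ∀ wstar : EllipticID.H10 Ω →L[ℝ] ℝ, EllipticID.SourceCondition f Qd wstar →
      ∃ C : ℝ, ∀ h ∈ Set.Ioo (0 : ℝ) 1, ∀ δ > 0, ∀ ρ > 0, ∀ z : EllipticID.H10 Ω,
        ‖z - ubar‖ ≤ δ → ∀ Qh, EllipticID.IsDiscRegSol qlo qhi (T h) f z ρ Qh →
        EllipticID.ErrorBound κ C (T h) f Qd (EllipticID.weakSol wstar Qd) δ ρ Qh) ∧
    -- the same rate under the weaker condition on the pair of `Qd` and `Qh`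
    (∀ κ, EllipticID.IsCoercivityConst Ω qlo κ →
      ∀ w : EllipticID.H10 Ω,
      ∃ C : ℝ, ∀ h ∈ Set.Ioo (0 : ℝ) 1, ∀ δ > 0, ∀ ρ > 0, ∀ z : EllipticID.H10 Ω,
        ‖z - ubar‖ ≤ δ → ∀ Qh, EllipticID.IsDiscRegSol qlo qhi (T h) f z ρ Qh →
        EllipticID.pairing (Qd - Qh) Qd ≤
          |EllipticID.form (Qd - Qh) (EllipticID.solOp f Qd) w| →
        EllipticID.ErrorBound κ C (T h) f Qd w δ ρ Qh) := by
  obtain ⟨⟨hQad, rfl⟩, -⟩ := hQd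
  obtain ⟨κ₀, hκ₀⟩ := EllipticID.exists_isCoercivityConst hd1 hΩb hqlo
  refine ⟨⟨κ₀, hκ₀⟩, EllipticID.differentiableAt_solOp f (hκ₀.isCoercive hQad),
    fun h hh ρ hρ z => ?_, fun κ hκ wstar hw => ?_,
    fun κ hκ w => hT.exists_errorBound hd1 hΩo hΩb hqlo hqhi hκ f hQad w⟩
  · have hK := (hT.1 h hh).1
    have := hK.completeSpace_Vh hΩo hΩb
    exact EllipticID.existsUnique_isDiscRegSol hΩb hqlo hqhi hκ₀
      (EllipticID.clement_mem_Vh hΩo hΩb hK z) ⟨Qd, hQad⟩ hρ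
  · obtain ⟨C, hC⟩ := hT.exists_errorBound hd1 hΩo hΩb hqlo hqhi hκ f hQad
      (EllipticID.weakSol wstar Qd)
    refine ⟨C, fun h hh δ hδ ρ hρ z hz Qh hQh => hC h hh δ hδ ρ hρ z hz Qh hQh ?_⟩
    -- Under the source condition the pairing is minus the form at the weak solution for `wstar`, so
    -- the hypothesis of part (b) holds for every minimizer.
    rw [hw.pairing_eq hQad (hκ.isCoercive hQad)]
    exact neg_le_abs _
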